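/- **Theorem.** For $s\in\mathbb C$ and $n\in\mathbb N$ put $\tau_s(n)=\sum_{n_1n_2=n}(n_1/n_2)^s$. For an integer $k\ge 2$, $t\in\mathbb R$, $v=it$ and real $z\neq 0,1$ let $$H_k(0,v;z)=\begin{cases}\dfrac{(-1)^k}{2}\,z^{1/2-k}\,I_1(1/z), & z>0,\\[2mm] \dfrac12(-z)^{1/2-k}I_2(-1/z), & z<0,\end{cases}$$ where, for $x>0$ and $1-2k<\Delta<-1$, $$I_1(x)=\frac1{2\pi i}\int_{\Re s=\Delta}\Gamma_k(s)\sin\Big(\frac{\pi s}2\Big)x^{s/2}\,ds,\qquad I_2(x)=\frac1{2\pi i}\int_{\Re s=\Delta}\Gamma_k(s)\,x^{s/2}\,ds,$$ $$\Gamma_k(s)=\frac{\Gamma(k-\frac12+\frac s2)}{\Gamma(k+\frac12-\frac s2)}\,\Gamma\Big(\frac12+v-\frac s2\Big)\Gamma\Big(\frac12-v-\frac s2\Big),$$ the integrals being limits as $R\to\infty$ of the integrals from $\Delta-iR$ to $\Delta+iR$. For positive integers $N,l,r$ define $$V_{N,1}(r)=\frac{\cos \pi v}{r^{-k+v}}\sum_{n\ge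 (1+r)/N}\frac{\tau_0(n)\tau_v(nN-r)}{(nN-r)^k}H_k\Big(0,v;\frac{-r}{nN-r}\Big),$$ $$V_{N,2}(r)=\frac{(-1)^k}{r^{-k+v}}\sum_{(1-r)/N\le n\le -1}\frac{\tau_0(|n|)\tau_v(nN+r)}{(nN+r)^k}H_k\Big(0,v;\frac{r}{nN+r}\Big),$$ $$V_{N,3}(r)=\frac{(-1)^k}{r^{-k+v}}\sum_{n\ge 1}\frac{\tau_0(n)\tau_v(nN+r)}{(nN+r)^k}H_k\Big(0,v;\frac{r}{nN+r}\Big),$$ $$V_N(l)=\frac{2(-1)^k}{l^{1/2-v}}\sum_{d\mid l}\sum_{r\mid d}\mu(d/r)\big(V_{N,1}(r)+V_{N,2}(r)+V_{N,3}(r)\big),$$ with $\mu$ the Möbius function. Let $T=3+|t|$. Then the series defining $V_{N,1}(r)$ and $V_{N,3}(r)$ converge absolutely, and for every $\epsilon>0$ there is a constant $C>0$ depending only on $\epsilon$ such that for all integers $k\ge 2$, $N\ge 1$, $l\ge 1$ and all $t\in\mathbb R$ $$|V_N(l)|\le C\cdot\begin{cases}(lkT^2)^{\epsilon}\,\dfrac{l^{1/2}(k+T)}{N},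 & l\ge N/(1+T^2),\\[3mm]\left(\dfrac{lT^2}{4(N-l)}\right)^{k}\dfrac{N^{\epsilon}}{l^{1/2}T}, & l<N/(1+T^2).\end{cases}$$ -/

import Mathlib

namespace SecondMoment

open Complex

/-- `τ_s(n) = ∑_{n₁ n₂ = n} (n₁ / n₂)^s`; in particular `τ_0(n)` is the number of divisors. -/
noncomputable def tau (s : ℂ) (n : ℕ) : ℂ :=
  ∑ p ∈ n.divisorsAntidiagonal, ((p.1 : ℂ) / (p.2 : ℂ)) ^ s

/-- `Γ(u, v, λ; s) =
Γ(λ - 1/2 + s/2) / Γ(λ + 1/2 - s/2) · Γ(1/2 - u + v - s/2) · Γ(1/2 - u - v - s/2)`. -/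
noncomputable def gammaKernel (u v lam s : ℂ) : ℂ :=
  Gamma (lam - 1 / 2 + s / 2) / Gamma (lam + 1 / 2 - s / 2) *
    Gamma (1 / 2 - u + v - s / 2) * Gamma (1 / 2 - u - v - s / 2)

/-- `(1 / (2πi)) ∫_{Re s = Δ} f(s) ds`, as the limit of the integrals over the segments
`Δ - iR, Δ + iR` for `R → ∞` (the integrals below need not converge absolutely). -/
noncomputable def lineIntegral (Δ : ℝ) (f : ℂ → ℂ) : ℂ :=
  Filter.limUnder Filter.atTop fun R : ℝ =>
    1 / (2 * (Real.pi : ℂ)) * ∫ y in (-R)..R, f ((Δ : ℂ) + (y : ℂ) * I)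

/-- An abscissa `Δ` with `1 - 2 Re λ < Δ < -1 - 2 Re u`: the midpoint of this interval, which is
non-empty for `Re λ > 1 + Re u`. The integrands below are holomorphic in the strip, and the
integrals do not depend on the choice of `Δ` in the interval. -/
noncomputable def abscissa (lam u : ℂ) : ℝ := -lam.re - u.re

/-- `I₁(x) = (1 / (2πi)) ∫_{Re s = Δ} Γ(u, v, λ; s) sin(π (u + s/2)) x^{s/2} ds`. -/
noncomputable def I₁ (lam u v : ℂ) (x : ℝ) : ℂ :=
  lineIntegral (abscissa lam u) fun s =>
    gammaKernel u v lam s * sin (Real.pi * (u + s / 2)) * (x : ℂ) ^ (s / 2)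

/-- `I₂(x) = (1 / (2πi)) ∫_{Re s = Δ} Γ(u, v, λ; s) x^{s/2} ds`. -/
noncomputable def I₂ (lam u v : ℂ) (x : ℝ) : ℂ :=
  lineIntegral (abscissa lam u) fun s => gammaKernel u v lam s * (x : ℂ) ^ (s / 2)

/-- The function `H_λ(u, v; z)` of a real argument `z ≠ 0`. -/
noncomputable def hypH (lam u v : ℂ) (z : ℝ) : ℂ :=
  if 0 < z then
    1 / (2 * cos (Real.pi * (lam - u))) * (z : ℂ) ^ (1 / 2 - lam) * I₁ lam u v (1 / z)
  else
    1 / 2 * ((-z : ℝ) : ℂ) ^ (1 / 2 - lam) * I₂ lam u v (-1 / z)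

/-- The `n`-th term, `n ≥ (1 + r) / N`, of the series in `V_{N,1}(r)`. -/
noncomputable def V₁term (k N : ℕ) (v : ℂ) (r n : ℕ) : ℂ :=
  if 1 + r ≤ n * N then
    tau 0 n * tau v (n * N - r) / ((n * N - r : ℕ) : ℂ) ^ k *
      hypH k 0 v (-(r : ℝ) / ((n : ℝ) * N - r))
  else 0

/-- `V_{N,1}(r) = cos(πv) r^{k-v} ∑_{n ≥ (1+r)/N} τ_0(n) τ_v(nN-r) (nN-r)^{-k} H_k(0,v;-r/(nN-r))`. -/
noncomputable def V₁ (k N : ℕ) (v : ℂ) (r : ℕ) : ℂ :=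
  cos (Real.pi * v) * (r : ℂ) ^ ((k : ℂ) - v) * ∑' n : ℕ, V₁term k N v r n

/-- `V_{N,2}(r) = (-1)^k r^{k-v}
  ∑_{(1-r)/N ≤ n ≤ -1} τ_0(|n|) τ_v(nN+r) (nN+r)^{-k} H_k(0,v;r/(nN+r))`,
written as a sum over `-n`, that is, over `1 ≤ n ≤ (r-1)/N`. -/
noncomputable def V₂ (k N : ℕ) (v : ℂ) (r : ℕ) : ℂ :=
  (-1) ^ k * (r : ℂ) ^ ((k : ℂ) - v) *
    ∑ n ∈ Finset.Icc 1 ((r - 1) / N),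
      tau 0 n * tau v (r - n * N) / ((r - n * N : ℕ) : ℂ) ^ k *
        hypH k 0 v ((r : ℝ) / ((r : ℝ) - n * N))

/-- The `n`-th term, `n ≥ 1`, of the series in `V_{N,3}(r)`. -/
noncomputable def V₃term (k N : ℕ) (v : ℂ) (r n : ℕ) : ℂ :=
  if 1 ≤ n then
    tau 0 n * tau v (n * N + r) / ((n * N + r : ℕ) : ℂ) ^ k *
      hypH k 0 v ((r : ℝ) / ((n : ℝ) * N + r))
  else 0

/-- `V_{N,3}(r) = (-1)^k r^{k-v} ∑_{n ≥ 1} τ_0(n) τ_v(nN+r) (nN+r)^{-k} H_k(0,v;r/(nN+r))`. -/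
noncomputable def V₃ (k N : ℕ) (v : ℂ) (r : ℕ) : ℂ :=
  (-1) ^ k * (r : ℂ) ^ ((k : ℂ) - v) * ∑' n : ℕ, V₃term k N v r n

/-- `V_N(l) = 2 (-1)^k l^{-(1/2-v)} ∑_{d ∣ l} ∑_{r ∣ d} μ(d/r) (V_{N,1}(r)+V_{N,2}(r)+V_{N,3}(r))`. -/
noncomputable def V (k N : ℕ) (v : ℂ) (l : ℕ) : ℂ :=
  2 * (-1) ^ k / (l : ℂ) ^ (1 / 2 - v) *
    ∑ d ∈ l.divisors, ∑ r ∈ d.divisors,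
      (ArithmeticFunction.moebius (d / r) : ℂ) * (V₁ k N v r + V₂ k N v r + V₃ k N v r)

end SecondMoment

/-!
After the substitution `s = 2w`, `I₁` and `I₂` are Mellin–Barnes integrals of meromorphic kernels
which are holomorphic in the strip `1/2 - k < Re w < 1/2`, so their contour may be moved freely
inside it. The lines `Re w = 1/2 - δ` and `Re w = -1/2 - δ` give bounds of polynomial size in `k`
and `t`, which are used for large `l`; a line close to the left edge `Re w = 1/2 - k` gives the
power `x ^ (1/2 - k + ε)`, which is used for small `l`. The Gamma quotients are estimated uniformly
in `k` and `t` by Stirling-type bounds and by comparing `|Γ|` on two vertical lines through Euler's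
product and the convexity of `log (1 + (y / x) ^ 2)`.

The integral `I₁` does not converge absolutely. However `(1 - x) * I₁(x)` is the integral of the
first difference of the kernel, which decays faster by a power of `|Im w|`; the resulting factor
`1 / |1 - x|` is harmless since `x = a / r ≠ 1` in every term of `V₂` and `V₃`. The sums themselves
are then controlled by the divisor bound.
-/

namespace SecondMoment

open Filter Topology MeasureTheory Real

/-! ### The modulus of the Gamma function on vertical lines -/

/-- The modulus `|Γ(a + iy)|`, as a function of two real variables. -/
noncomputable def gammaNorm (a y : ℝ) : ℝ := ‖Complex.Gamma (a + y * Complex.I)‖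

lemma gammaNorm_neg (a y : ℝ) : gammaNorm a (-y) = gammaNorm a y := by
  unfold gammaNorm
  rw [← Complex.norm_conj (Complex.Gamma (a + y * Complex.I)), ← Complex.Gamma_conj]
  simp

lemma gammaNorm_pos {a : ℝ} (ha : 0 < a) (y : ℝ) : 0 < gammaNorm a y :=
  norm_pos_iff.mpr (Complex.Gamma_ne_zero_of_re_pos (by simpa using ha))

lemma gammaNorm_add_one {a : ℝ} (ha : a ≠ 0) (y : ℝ) :
    gammaNorm (a + 1) y = √(a ^ 2 + y ^ 2) * gammaNorm a y := by
  have hne : (a + y * Complex.I : ℂ) ≠ 0 := fun h => ha (by simpa using congrArg Complex.re h)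
  unfold gammaNorm
  rw [← Complex.norm_add_mul_I, ← norm_mul, ← Complex.Gamma_add_one _ hne]
  push_cast
  ring_nf

lemma gammaNorm_half_sq (y : ℝ) : gammaNorm (1 / 2) y ^ 2 = π / cosh (π * y) := by
  have reflection := Complex.Gamma_mul_Gamma_one_sub ((1 / 2 : ℝ) + y * Complex.I)
  have one_sub : (1 - ((1 / 2 : ℝ) + y * Complex.I) : ℂ) =
      (1 / 2 : ℝ) + (-y : ℝ) * Complex.I := by
    push_cast; ring
  have sin_eq_cosh : Complex.sin (π * ((1 / 2 : ℝ) + y * Complex.I)) = cosh (π * y) := by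
    rw [show (π * ((1 / 2 : ℝ) + y * Complex.I) : ℂ) = (π * y : ℝ) * Complex.I + π / 2 by
      push_cast; ring, Complex.sin_add_pi_div_two, Complex.cos_mul_I, Complex.ofReal_cosh]
  rw [one_sub, sin_eq_cosh] at reflection
  calc gammaNorm (1 / 2) y ^ 2 = gammaNorm (1 / 2) y * gammaNorm (1 / 2) (-y) := by
        rw [gammaNorm_neg, pow_two]
    _ = ‖((π : ℂ) / (cosh (π * y) : ℝ))‖ := by rw [← reflection, norm_mul]; rfl
    _ = π / cosh (π * y) := by
        rw [norm_div, Complex.norm_of_nonneg pi_pos.le, Complex.norm_of_nonneg (cosh_pos _).le]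

lemma exp_abs_div_two_le_cosh (x : ℝ) : exp |x| / 2 ≤ cosh x := by
  rw [← cosh_abs, cosh_eq]
  linarith [exp_pos (-|x|)]

lemma cosh_le_exp_abs (x : ℝ) : cosh x ≤ exp |x| := by
  rw [← cosh_abs, cosh_eq]
  linarith [exp_le_exp.mpr (show -|x| ≤ |x| by linarith [abs_nonneg x])]

lemma exp_neg_pi_mul_abs_div_two_sq (y : ℝ) :
    exp (-(π * |y|) / 2) ^ 2 * exp |π * y| = 1 := by
  rw [← exp_nat_mul, ← exp_add, abs_mul, abs_of_pos pi_pos, exp_eq_one_iff]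
  push_cast
  ring

lemma gammaNorm_half_le (y : ℝ) : gammaNorm (1 / 2) y ≤ 3 * exp (-(π * |y|) / 2) := by
  refine le_of_sq_le_sq ?_ (by positivity)
  rw [gammaNorm_half_sq, mul_pow, div_le_iff₀ (cosh_pos _)]
  have hcosh := mul_le_mul_of_nonneg_left (exp_abs_div_two_le_cosh (π * y))
    (sq_nonneg (exp (-(π * |y|) / 2)))
  linarith [exp_neg_pi_mul_abs_div_two_sq y, pi_le_four]

lemma le_gammaNorm_half (y : ℝ) : exp (-(π * |y|) / 2) ≤ gammaNorm (1 / 2) y := by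
  refine le_of_sq_le_sq ?_ (gammaNorm_pos (by norm_num) y).le
  rw [gammaNorm_half_sq, le_div_iff₀ (cosh_pos _)]
  have hcosh := mul_le_mul_of_nonneg_left (cosh_le_exp_abs (π * y))
    (sq_nonneg (exp (-(π * |y|) / 2)))
  linarith [exp_neg_pi_mul_abs_div_two_sq y, pi_gt_three]

lemma hasDerivAt_log_one_add_div_sq (y : ℝ) {x : ℝ} (hx : 0 < x) :
    HasDerivAt (fun x : ℝ => log (1 + (y / x) ^ 2)) (-(2 * y ^ 2 / (x * (x ^ 2 + y ^ 2)))) x := by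
  have hdiv : HasDerivAt (fun x : ℝ => y / x) (-y / x ^ 2) x := by
    simpa [div_eq_mul_inv] using (hasDerivAt_inv hx.ne').const_mul y
  have hsq : HasDerivAt (fun x : ℝ => 1 + (y / x) ^ 2) (2 * (y / x) * (-y / x ^ 2)) x := by
    simpa using (hdiv.fun_pow 2).const_add 1
  convert hsq.log (by positivity) using 1
  have : 0 < x ^ 2 + y ^ 2 := by positivity
  field_simp

lemma convexOn_log_one_add_div_sq (y : ℝ) :
    ConvexOn ℝ (Set.Ioi 0) (fun x : ℝ => log (1 + (y / x) ^ 2)) := by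
  refine MonotoneOn.convexOn_of_deriv (convex_Ioi 0)
    (fun x hx => (hasDerivAt_log_one_add_div_sq y hx).continuousAt.continuousWithinAt) ?_ ?_
  · rw [interior_Ioi]
    exact fun x hx => (hasDerivAt_log_one_add_div_sq y hx).differentiableAt.differentiableWithinAt
  · rw [interior_Ioi]
    intro a (ha : 0 < a) b (hb : 0 < b) hab
    rw [(hasDerivAt_log_one_add_div_sq y ha).deriv, (hasDerivAt_log_one_add_div_sq y hb).deriv,
      neg_le_neg_iff]
    gcongr

lemma log_one_add_div_sq_sub_le {a b : ℝ} (ha : 0 < a) (hab : a ≤ b) (y : ℝ) :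
    (b - a) * (log (1 + (y / b) ^ 2) - log (1 + (y / (b + 1)) ^ 2)) ≤
      log (1 + (y / a) ^ 2) - log (1 + (y / b) ^ 2) := by
  rcases hab.eq_or_lt with rfl | hlt
  · simp
  have hb : (0 : ℝ) < b + 1 := by linarith
  have hslope := (convexOn_log_one_add_div_sq y).slope_mono_adjacent (x := a) (y := b) (z := b + 1)
    ha hb hlt (by linarith)
  rw [show b + 1 - b = 1 by ring, div_one, div_le_iff₀ (by linarith)] at hslope
  linarith

lemma mul_log_sub_le_sum_log_sub_sum_log {a b : ℝ} (ha : 0 < a) (hab : a ≤ b) (y : ℝ) (n : ℕ) :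
    (b - a) * (log (1 + (y / b) ^ 2) - log (1 + (y / (b + n)) ^ 2)) ≤
      ∑ j ∈ Finset.range n, log (1 + (y / (a + j)) ^ 2) -
        ∑ j ∈ Finset.range n, log (1 + (y / (b + j)) ^ 2) := by
  have telescope := Finset.sum_range_sub' (fun j : ℕ => log (1 + (y / (b + j)) ^ 2)) n
  simp only [Nat.cast_zero, add_zero] at telescope
  rw [← telescope, Finset.mul_sum, ← Finset.sum_sub_distrib]
  refine Finset.sum_le_sum fun j _ => ?_
  have : (0 : ℝ) ≤ j := j.cast_nonneg
  have hstep := log_one_add_div_sq_sub_le (a := a + j) (b := b + j) (by linarith) (by linarith) y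
  rw [add_sub_add_right_eq_sub] at hstep
  push_cast
  rwa [← add_assoc]

lemma norm_add_mul_I_add_natCast {a : ℝ} (ha : 0 < a) (y : ℝ) (j : ℕ) :
    ‖(a + y * Complex.I + j : ℂ)‖ = (a + j) * exp (log (1 + (y / (a + j)) ^ 2) / 2) := by
  have hj : 0 < a + j := by positivity
  rw [show (a + y * Complex.I + j : ℂ) = ((a + j : ℝ) : ℂ) + y * Complex.I by push_cast; ring,
    Complex.norm_add_mul_I, exp_half, exp_log (by positivity)]
  nth_rw 2 [← sqrt_sq hj.le]
  rw [← sqrt_mul (by positivity)]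
  congr 1
  field_simp

lemma norm_GammaSeq {a : ℝ} (ha : 0 < a) (y : ℝ) {n : ℕ} (hn : n ≠ 0) :
    ‖Complex.GammaSeq (a + y * Complex.I) n‖ = Real.GammaSeq a n *
      exp (-(∑ j ∈ Finset.range (n + 1), log (1 + (y / (a + j)) ^ 2)) / 2) := by
  unfold Complex.GammaSeq Real.GammaSeq
  rw [norm_div, norm_mul, norm_prod, ← Complex.ofReal_natCast n,
    Complex.norm_cpow_eq_rpow_re_of_pos (by positivity), Complex.norm_natCast]
  simp_rw [norm_add_mul_I_add_natCast ha]
  rw [Finset.prod_mul_distrib, ← exp_sum, neg_div, exp_neg, Finset.sum_div]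
  simp only [Complex.add_re, Complex.ofReal_re, Complex.mul_re, Complex.I_re, mul_zero,
    Complex.ofReal_im, Complex.I_im, mul_one, sub_self, add_zero]
  field_simp

lemma norm_GammaSeq_mul_le {a b : ℝ} (ha : 0 < a) (hab : a ≤ b) (y : ℝ) {n : ℕ} (hn : n ≠ 0) :
    ‖Complex.GammaSeq (a + y * Complex.I) n‖ * Real.GammaSeq b n ≤
      Real.GammaSeq a n * ‖Complex.GammaSeq (b + y * Complex.I) n‖ *
        exp (-(b - a) *
          (log (1 + (y / b) ^ 2) - log (1 + (y / (b + (n + 1 : ℕ))) ^ 2)) / 2) := by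
  have hb : 0 < b := ha.trans_le hab
  have GammaSeq_nonneg : ∀ c : ℝ, 0 < c → 0 ≤ Real.GammaSeq c n := fun c hc => by
    unfold Real.GammaSeq
    have : 0 ≤ ∏ j ∈ Finset.range (n + 1), (c + j) := Finset.prod_nonneg fun j _ => by positivity
    positivity
  have hexp : exp (-(∑ j ∈ Finset.range (n + 1), log (1 + (y / (a + j)) ^ 2)) / 2) ≤
      exp (-(∑ j ∈ Finset.range (n + 1), log (1 + (y / (b + j)) ^ 2)) / 2) *
        exp (-(b - a) *
          (log (1 + (y / b) ^ 2) - log (1 + (y / (b + (n + 1 : ℕ))) ^ 2)) / 2) := by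
    rw [← exp_add, exp_le_exp]
    linarith [mul_log_sub_le_sum_log_sub_sum_log ha hab y (n + 1)]
  rw [norm_GammaSeq ha y hn, norm_GammaSeq hb y hn]
  linarith [mul_le_mul_of_nonneg_left hexp
    (mul_nonneg (GammaSeq_nonneg a ha) (GammaSeq_nonneg b hb))]

/-- Euler's product turns the quotient of the two sides into a sum of values of
`x ↦ log (1 + (y / x) ^ 2)`, which convexity bounds below by a telescoping sum. -/
theorem gammaNorm_le_rpow_mul_gammaNorm {a b : ℝ} (ha : 0 < a) (hab : a ≤ b) (y : ℝ) :
    gammaNorm a y ≤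
      Real.Gamma a / Real.Gamma b * (1 + (y / b) ^ 2) ^ (-(b - a) / 2) * gammaNorm b y := by
  have hb : 0 < b := ha.trans_le hab
  have tail_tendsto :
      Tendsto (fun n : ℕ => log (1 + (y / (b + (n + 1 : ℕ))) ^ 2)) atTop (𝓝 0) := by
    have hatTop : Tendsto (fun n : ℕ => b + ((n + 1 : ℕ) : ℝ)) atTop atTop :=
      tendsto_atTop_add_const_left _ _
        (tendsto_natCast_atTop_atTop.comp (tendsto_add_atTop_nat 1))
    simpa using (((hatTop.const_div_atTop y).pow 2).const_add 1).log (by norm_num)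
  have hlim := le_of_tendsto_of_tendsto
    ((Complex.GammaSeq_tendsto_Gamma (a + y * Complex.I)).norm.mul
      (Real.GammaSeq_tendsto_Gamma b))
    (((Real.GammaSeq_tendsto_Gamma a).mul
      (Complex.GammaSeq_tendsto_Gamma (b + y * Complex.I)).norm).mul
      ((continuous_exp.tendsto _).comp
        (((tail_tendsto.const_sub (log (1 + (y / b) ^ 2))).const_mul (-(b - a))).div_const 2)))
    ((eventually_ne_atTop 0).mono fun n hn => norm_GammaSeq_mul_le ha hab y hn)
  change gammaNorm a y * Real.Gamma b ≤ Real.Gamma a * gammaNorm b y * _ at hlim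
  have exp_eq_rpow : exp (-(b - a) * (log (1 + (y / b) ^ 2) - 0) / 2) =
      (1 + (y / b) ^ 2) ^ (-(b - a) / 2) := by
    rw [rpow_def_of_pos (by positivity)]
    ring_nf
  rw [exp_eq_rpow] at hlim
  rw [div_mul_eq_mul_div, div_mul_eq_mul_div, le_div_iff₀ (Gamma_pos_of_pos hb)]
  linarith

lemma gammaNorm_le_mul_gammaNorm {a b : ℝ} (ha : 0 < a) (hab : a ≤ b) (y : ℝ) :
    gammaNorm a y ≤ Real.Gamma a / Real.Gamma b * gammaNorm b y := by
  have hb : 0 < b := ha.trans_le hab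
  have := (gammaNorm_pos hb y).le
  have := Gamma_pos_of_pos ha
  have := Gamma_pos_of_pos hb
  have hrpow : (1 + (y / b) ^ 2) ^ (-(b - a) / 2) ≤ 1 :=
    rpow_le_one_of_one_le_of_nonpos (by linarith [sq_nonneg (y / b)]) (by linarith)
  calc gammaNorm a y
      ≤ Real.Gamma a / Real.Gamma b * (1 + (y / b) ^ 2) ^ (-(b - a) / 2) * gammaNorm b y :=
        gammaNorm_le_rpow_mul_gammaNorm ha hab y
    _ ≤ Real.Gamma a / Real.Gamma b * 1 * gammaNorm b y := by gcongr
    _ = Real.Gamma a / Real.Gamma b * gammaNorm b y := by rw [mul_one]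

lemma one_add_div_sq_rpow_le {b c : ℝ} (hb : 0 < b) (hc : 0 ≤ c) (y : ℝ) :
    (1 + (y / b) ^ 2) ^ (-c / 2) ≤ (2 * (1 + b)) ^ c * (1 + |y|) ^ (-c) := by
  have hD : 0 < 2 * (1 + b) := by positivity
  have hbase : ((1 + |y|) / (2 * (1 + b))) ^ 2 ≤ 1 + (y / b) ^ 2 := by
    rw [div_pow, div_le_iff₀ (by positivity)]
    have hy : y ^ 2 = (y / b) ^ 2 * b ^ 2 := by field_simp
    nlinarith [sq_nonneg (1 - |y|), sq_abs y, sq_nonneg (y / b),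
      mul_nonneg (sq_nonneg (y / b)) hb.le]
  calc (1 + (y / b) ^ 2) ^ (-c / 2) ≤ (((1 + |y|) / (2 * (1 + b))) ^ 2) ^ (-c / 2) :=
        rpow_le_rpow_of_nonpos (by positivity) hbase (by linarith)
    _ = ((1 + |y|) / (2 * (1 + b))) ^ (-c) := by
        rw [← rpow_natCast, ← rpow_mul (by positivity)]
        congr 1; push_cast; ring
    _ = (2 * (1 + b)) ^ c * (1 + |y|) ^ (-c) := by
        rw [div_rpow (by positivity) hD.le, rpow_neg hD.le]
        field_simp

lemma gammaNorm_nat_add_half_le (m : ℕ) (y : ℝ) :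
    gammaNorm (m + 1 / 2) y ≤ 3 * m.factorial * (1 + |y|) ^ m * exp (-(π * |y|) / 2) := by
  induction m with
  | zero => simpa using gammaNorm_half_le y
  | succ m ih =>
    have := gammaNorm_pos (show (0 : ℝ) < m + 1 / 2 by positivity) y
    have hsqrt : √((m + 1 / 2 : ℝ) ^ 2 + y ^ 2) ≤ (m + 1) * (1 + |y|) :=
      calc √((m + 1 / 2 : ℝ) ^ 2 + y ^ 2) ≤ |(m + 1 / 2 : ℝ)| + |y| := by
            rw [sqrt_le_left (by positivity)]
            nlinarith [sq_abs y, sq_abs (m + 1 / 2 : ℝ), abs_nonneg y,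
              abs_nonneg (m + 1 / 2 : ℝ)]
        _ ≤ (m + 1) * (1 + |y|) := by
            rw [abs_of_nonneg (by positivity)]
            nlinarith [mul_nonneg (m.cast_nonneg : (0 : ℝ) ≤ m) (abs_nonneg y)]
    calc gammaNorm ((m + 1 : ℕ) + 1 / 2) y
        = √((m + 1 / 2 : ℝ) ^ 2 + y ^ 2) * gammaNorm (m + 1 / 2) y := by
          rw [← gammaNorm_add_one (by positivity)]
          push_cast; ring_nf
      _ ≤ ((m + 1) * (1 + |y|)) *
          (3 * m.factorial * (1 + |y|) ^ m * exp (-(π * |y|) / 2)) := by gcongr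
      _ = 3 * (m + 1).factorial * (1 + |y|) ^ (m + 1) * exp (-(π * |y|) / 2) := by
          rw [Nat.factorial_succ]; push_cast; ring

lemma exists_Gamma_le_and_inv_Gamma_le {a₀ : ℝ} (h₀ : 0 < a₀) (a₁ : ℝ) :
    ∃ M : ℝ, 0 < M ∧ ∀ a ∈ Set.Icc a₀ a₁, Real.Gamma a ≤ M ∧ (Real.Gamma a)⁻¹ ≤ M := by
  have hcont : ContinuousOn Real.Gamma (Set.Icc a₀ a₁) :=
    differentiableOn_Gamma_Ioi.continuousOn.mono fun a ha => h₀.trans_le ha.1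
  have hpos : ∀ a ∈ Set.Icc a₀ a₁, 0 < Real.Gamma a := fun a ha =>
    Gamma_pos_of_pos (h₀.trans_le ha.1)
  obtain ⟨M, hM⟩ := isCompact_Icc.exists_bound_of_continuousOn hcont
  obtain ⟨M', hM'⟩ := isCompact_Icc.exists_bound_of_continuousOn
    (hcont.inv₀ fun a ha => (hpos a ha).ne')
  refine ⟨max 1 (max M M'), by positivity, fun a ha => ⟨?_, ?_⟩⟩
  · exact (le_norm_self _).trans ((hM a ha).trans (by simp))
  · exact (le_norm_self _).trans ((hM' a ha).trans (by simp))

/-- Together with `exists_le_gammaNorm` this is Stirling's formula up to a constant factor,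
uniformly in vertical strips. -/
theorem exists_gammaNorm_le {a₀ : ℝ} (h₀ : 0 < a₀) (a₁ : ℝ) :
    ∃ C : ℝ, 0 < C ∧ ∀ a ∈ Set.Icc a₀ a₁, ∀ y : ℝ,
      gammaNorm a y ≤ C * (1 + |y|) ^ (a - 1 / 2) * exp (-(π * |y|) / 2) := by
  obtain ⟨M, hM, hΓ⟩ := exists_Gamma_le_and_inv_Gamma_le h₀ a₁
  set m := ⌈a₁⌉₊
  set b : ℝ := m + 1 / 2 with hbdef
  have hb : 0 < b := by positivity
  have := Gamma_pos_of_pos hb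
  refine ⟨M / Real.Gamma b * (2 * (1 + b)) ^ b * (3 * m.factorial), by positivity, ?_⟩
  intro a ha y
  have ha0 : 0 < a := h₀.trans_le ha.1
  have hab : a ≤ b := by linarith [ha.2, Nat.le_ceil a₁]
  have := (Gamma_pos_of_pos ha0).le
  have := (gammaNorm_pos hb y).le
  have hrpow : (1 + (y / b) ^ 2) ^ (-(b - a) / 2) ≤ (2 * (1 + b)) ^ b * (1 + |y|) ^ (-(b - a)) :=
    (one_add_div_sq_rpow_le hb (sub_nonneg.mpr hab) y).trans (by
      gcongr
      exacts [by linarith, by linarith])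
  have hexponent : (1 + |y|) ^ (-(b - a)) * (1 + |y|) ^ m = (1 + |y|) ^ (a - 1 / 2) := by
    rw [← rpow_natCast, ← rpow_add (by positivity)]
    congr 1; simp only [hbdef]; ring
  calc gammaNorm a y
      ≤ Real.Gamma a / Real.Gamma b * (1 + (y / b) ^ 2) ^ (-(b - a) / 2) * gammaNorm b y :=
        gammaNorm_le_rpow_mul_gammaNorm ha0 hab y
    _ ≤ M / Real.Gamma b * ((2 * (1 + b)) ^ b * (1 + |y|) ^ (-(b - a))) *
        (3 * m.factorial * (1 + |y|) ^ m * exp (-(π * |y|) / 2)) := by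
        gcongr
        · exact (hΓ a ha).1
        · exact gammaNorm_nat_add_half_le m y
    _ = _ := by rw [← hexponent]; ring

theorem exists_le_gammaNorm (a₁ : ℝ) :
    ∃ C : ℝ, 0 < C ∧ ∀ a ∈ Set.Icc (1 / 2) a₁, ∀ y : ℝ,
      (1 + |y|) ^ (a - 1 / 2) * exp (-(π * |y|) / 2) ≤ C * gammaNorm a y := by
  obtain ⟨M, hM, hΓ⟩ := exists_Gamma_le_and_inv_Gamma_le one_half_pos a₁
  have := Gamma_pos_of_pos (one_half_pos (α := ℝ))
  refine ⟨Real.Gamma (1 / 2) * M * (2 * (1 + |a₁|)) ^ |a₁|, by positivity, ?_⟩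
  intro a ha y
  have ha0 : 0 < a := one_half_pos.trans_le ha.1
  have haa : a ≤ |a₁| := ha.2.trans (le_abs_self _)
  have := (gammaNorm_pos ha0 y).le
  have := (inv_pos.mpr (Gamma_pos_of_pos ha0)).le
  have hconst : (2 * (1 + a)) ^ (a - 1 / 2) ≤ (2 * (1 + |a₁|)) ^ |a₁| :=
    (rpow_le_rpow (by positivity) (by gcongr) (sub_nonneg.mpr ha.1)).trans
      (rpow_le_rpow_of_exponent_le (by linarith [abs_nonneg a₁]) (by linarith))
  have hrpow : (1 + (y / a) ^ 2) ^ (-(a - 1 / 2) / 2) ≤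
      (2 * (1 + |a₁|)) ^ |a₁| * (1 + |y|) ^ (-(a - 1 / 2)) :=
    (one_add_div_sq_rpow_le ha0 (sub_nonneg.mpr ha.1) y).trans (by gcongr)
  calc (1 + |y|) ^ (a - 1 / 2) * exp (-(π * |y|) / 2)
      ≤ (1 + |y|) ^ (a - 1 / 2) * (Real.Gamma (1 / 2) * (Real.Gamma a)⁻¹ *
        (1 + (y / a) ^ 2) ^ (-(a - 1 / 2) / 2) * gammaNorm a y) := by
        gcongr
        rw [← div_eq_mul_inv]
        exact (le_gammaNorm_half y).trans
          (gammaNorm_le_rpow_mul_gammaNorm one_half_pos ha.1 y)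
    _ ≤ (1 + |y|) ^ (a - 1 / 2) * (Real.Gamma (1 / 2) * M *
        ((2 * (1 + |a₁|)) ^ |a₁| * (1 + |y|) ^ (-(a - 1 / 2))) * gammaNorm a y) := by
        gcongr
        exact (hΓ a ha).2
    _ = ((1 + |y|) ^ (a - 1 / 2) * (1 + |y|) ^ (-(a - 1 / 2))) *
        (Real.Gamma (1 / 2) * M * (2 * (1 + |a₁|)) ^ |a₁| * gammaNorm a y) := by ring
    _ = _ := by rw [← rpow_add (by positivity)]; simp

/-! ### The kernel and its decay in the strip of holomorphy -/

/-- The integrand `gammaKernel 0 (it) k s` of `I₂` in the variable `w = s / 2`. -/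
noncomputable def kernel (k : ℕ) (t : ℝ) (w : ℂ) : ℂ :=
  Complex.Gamma (k - 1 / 2 + w) / Complex.Gamma (k + 1 / 2 - w) *
    Complex.Gamma (1 / 2 + t * Complex.I - w) * Complex.Gamma (1 / 2 - t * Complex.I - w)

/-- The integrand of `I₁` in the variable `w = s / 2`. On vertical lines it only decays like
`|w|⁻¹`, so that its integrals converge conditionally. -/
noncomputable def sinKernel (k : ℕ) (t : ℝ) (w : ℂ) : ℂ :=
  kernel k t w * Complex.sin (π * w)

/-- The backward difference of `sinKernel`. Up to the factor `1 - x` it has the same Mellin–Barnes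
integral as `sinKernel`, but it is absolutely integrable on vertical lines. -/
noncomputable def sinKernelDiff (k : ℕ) (t : ℝ) (w : ℂ) : ℂ :=
  sinKernel k t w - sinKernel k t (w - 1)

lemma norm_kernel (k : ℕ) (t σ y : ℝ) :
    ‖kernel k t (σ + y * Complex.I)‖ = gammaNorm (k - 1 / 2 + σ) y / gammaNorm (k + 1 / 2 - σ) y *
      gammaNorm (1 / 2 - σ) (y - t) * gammaNorm (1 / 2 - σ) (y + t) := by
  rw [← gammaNorm_neg (k + 1 / 2 - σ) y, ← gammaNorm_neg _ (y - t), ← gammaNorm_neg _ (y + t)]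
  unfold kernel gammaNorm
  rw [norm_mul, norm_mul, norm_div]
  push_cast
  ring_nf

lemma norm_sin_pi_mul_le (σ y : ℝ) :
    ‖Complex.sin (π * (σ + y * Complex.I))‖ ≤ exp (π * |y|) := by
  have hpi_y : π * y ≤ π * |y| := by gcongr; exact le_abs_self y
  have hpi_neg_y : -(π * y) ≤ π * |y| := by rw [← mul_neg]; gcongr; exact neg_le_abs y
  have norm_exp_neg : ‖Complex.exp (-(π * (σ + y * Complex.I)) * Complex.I)‖ = exp (π * y) := by
    simp [Complex.norm_exp]
  have norm_exp_pos : ‖Complex.exp (π * (σ + y * Complex.I) * Complex.I)‖ = exp (-(π * y)) := by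
    simp [Complex.norm_exp]
  rw [Complex.sin, norm_div, norm_mul, Complex.norm_I, mul_one, Complex.norm_ofNat]
  have htriangle := norm_sub_le (Complex.exp (-(π * (σ + y * Complex.I)) * Complex.I))
    (Complex.exp (π * (σ + y * Complex.I) * Complex.I))
  rw [norm_exp_neg, norm_exp_pos] at htriangle
  linarith [exp_le_exp.mpr hpi_y, exp_le_exp.mpr hpi_neg_y]

lemma differentiableAt_Gamma_of_re_pos {s : ℂ} (hs : 0 < s.re) :
    DifferentiableAt ℂ Complex.Gamma s :=
  Complex.differentiableAt_Gamma s fun m hm => by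
    rw [hm, Complex.neg_re, Complex.natCast_re] at hs
    linarith [(m.cast_nonneg : (0 : ℝ) ≤ m)]

lemma differentiableAt_kernel {k : ℕ} (t : ℝ) {w : ℂ} (hleft : 1 / 2 - (k : ℝ) < w.re)
    (hright : w.re < 1 / 2) : DifferentiableAt ℂ (kernel k t) w := by
  have : (0 : ℝ) ≤ k := k.cast_nonneg
  unfold kernel
  refine DifferentiableAt.mul (DifferentiableAt.mul (DifferentiableAt.div ?_ ?_ ?_) ?_) ?_
  · exact (differentiableAt_Gamma_of_re_pos (by simp; linarith)).comp w (by fun_prop)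
  · exact (differentiableAt_Gamma_of_re_pos (by simp; linarith)).comp w (by fun_prop)
  · exact Complex.Gamma_ne_zero_of_re_pos (by simp; linarith)
  · exact (differentiableAt_Gamma_of_re_pos (by simp; linarith)).comp w (by fun_prop)
  · exact (differentiableAt_Gamma_of_re_pos (by simp; linarith)).comp w (by fun_prop)

lemma differentiableAt_sinKernel {k : ℕ} (t : ℝ) {w : ℂ} (hleft : 1 / 2 - (k : ℝ) < w.re)
    (hright : w.re < 1 / 2) : DifferentiableAt ℂ (sinKernel k t) w :=
  (differentiableAt_kernel t hleft hright).mul (by fun_prop)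

lemma differentiableAt_sinKernelDiff {k : ℕ} (t : ℝ) {w : ℂ} (hleft : 3 / 2 - (k : ℝ) < w.re)
    (hright : w.re < 1 / 2) : DifferentiableAt ℂ (sinKernelDiff k t) w :=
  (differentiableAt_sinKernel t (by linarith) hright).sub
    ((differentiableAt_sinKernel (k := k) t (w := w - 1) (by simp; linarith)
      (by simp; linarith)).comp w (f := fun w => w - 1) (by fun_prop))

lemma one_add_abs_add_rpow_le (y t p : ℝ) :
    (1 + |y + t|) ^ p ≤ (1 + |t|) ^ |p| * (1 + |y|) ^ p := by
  have peetre (u s : ℝ) : 1 + |u + s| ≤ (1 + |s|) * (1 + |u|) := by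
    nlinarith [abs_add_le u s, mul_nonneg (abs_nonneg u) (abs_nonneg s)]
  rcases le_total 0 p with hp | hp
  · rw [abs_of_nonneg hp, ← mul_rpow (by positivity) (by positivity)]
    exact rpow_le_rpow (by positivity) (peetre y t) hp
  · have hbase : 1 + |y| ≤ (1 + |t|) * (1 + |y + t|) := by simpa using peetre (y + t) (-t)
    have hpow := rpow_le_rpow_of_nonpos (by positivity) hbase hp
    rw [mul_rpow (by positivity) (by positivity)] at hpow
    rwa [abs_of_nonpos hp, rpow_neg (by positivity), ← div_eq_inv_mul,
      le_div_iff₀' (by positivity)]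

lemma exp_neg_abs_sub_mul_exp_neg_abs_add_le (y t : ℝ) :
    exp (-(π * |y - t|) / 2) * exp (-(π * |y + t|) / 2) ≤ exp (-(π * |y|)) := by
  have habs : 2 * |y| ≤ |y - t| + |y + t| := by
    calc 2 * |y| = |(y - t) + (y + t)| := by
          rw [show y - t + (y + t) = 2 * y by ring, abs_mul, abs_two]
      _ ≤ |y - t| + |y + t| := abs_add_le _ _
  rw [← exp_add, exp_le_exp]
  nlinarith [pi_pos]

lemma exists_gammaNorm_div_gammaNorm_le {k : ℕ} {σ₀ σ₁ : ℝ} (h₀ : 1 / 2 - (k : ℝ) < σ₀)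
    (h₁ : σ₁ ≤ k) : ∃ C : ℝ, 0 < C ∧ ∀ σ ∈ Set.Icc σ₀ σ₁, ∀ y : ℝ,
      gammaNorm (k - 1 / 2 + σ) y / gammaNorm (k + 1 / 2 - σ) y ≤
        C * (1 + |y|) ^ (2 * σ - 1) := by
  obtain ⟨C₁, hC₁, upper⟩ :=
    exists_gammaNorm_le (a₀ := k - 1 / 2 + σ₀) (by linarith) (k - 1 / 2 + σ₁)
  obtain ⟨C₂, hC₂, lower⟩ := exists_le_gammaNorm (k + 1 / 2 - σ₀)
  refine ⟨C₁ * C₂, by positivity, fun σ ⟨hσ₀, hσ₁⟩ y => ?_⟩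
  rw [div_le_iff₀ (gammaNorm_pos (show 0 < k + 1 / 2 - σ by linarith) y)]
  calc gammaNorm (k - 1 / 2 + σ) y
      ≤ C₁ * (1 + |y|) ^ (k - 1 / 2 + σ - 1 / 2) * exp (-(π * |y|) / 2) :=
        upper _ ⟨by linarith, by linarith⟩ y
    _ = C₁ * (1 + |y|) ^ (2 * σ - 1) *
        ((1 + |y|) ^ (k + 1 / 2 - σ - 1 / 2) * exp (-(π * |y|) / 2)) := by
        rw [show (k - 1 / 2 + σ - 1 / 2 : ℝ) = (2 * σ - 1) + (k + 1 / 2 - σ - 1 / 2) by ring,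
          rpow_add (by positivity)]
        ring
    _ ≤ C₁ * (1 + |y|) ^ (2 * σ - 1) * (C₂ * gammaNorm (k + 1 / 2 - σ) y) :=
        mul_le_mul_of_nonneg_left (lower _ ⟨by linarith, by linarith⟩ y) (by positivity)
    _ = C₁ * C₂ * (1 + |y|) ^ (2 * σ - 1) * gammaNorm (k + 1 / 2 - σ) y := by ring

lemma exists_gammaNorm_half_sub_le {σ₀ σ₁ : ℝ} (h₁ : σ₁ < 1 / 2) (t : ℝ) :
    ∃ C : ℝ, 0 < C ∧ ∀ σ ∈ Set.Icc σ₀ σ₁, ∀ y : ℝ,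
      gammaNorm (1 / 2 - σ) (y + t) ≤ C * (1 + |y|) ^ (-σ) * exp (-(π * |y + t|) / 2) := by
  obtain ⟨C, hC, upper⟩ := exists_gammaNorm_le (a₀ := 1 / 2 - σ₁) (by linarith) (1 / 2 - σ₀)
  refine ⟨C * (1 + |t|) ^ max |σ₀| |σ₁|, by positivity, fun σ ⟨hσ₀, hσ₁⟩ y => ?_⟩
  calc gammaNorm (1 / 2 - σ) (y + t)
      ≤ C * (1 + |y + t|) ^ (1 / 2 - σ - 1 / 2) * exp (-(π * |y + t|) / 2) :=
        upper _ ⟨by linarith, by linarith⟩ _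
    _ = C * (1 + |y + t|) ^ (-σ) * exp (-(π * |y + t|) / 2) := by ring_nf
    _ ≤ C * ((1 + |t|) ^ |σ| * (1 + |y|) ^ (-σ)) * exp (-(π * |y + t|) / 2) := by
        gcongr
        rw [← abs_neg σ]
        exact one_add_abs_add_rpow_le y t (-σ)
    _ ≤ C * ((1 + |t|) ^ max |σ₀| |σ₁| * (1 + |y|) ^ (-σ)) * exp (-(π * |y + t|) / 2) := by
        gcongr
        · linarith [abs_nonneg t]
        · exact abs_le_max_abs_abs hσ₀ hσ₁
    _ = _ := by ring

theorem exists_norm_kernel_le (k : ℕ) (t : ℝ) {σ₀ σ₁ : ℝ} (h₀ : 1 / 2 - (k : ℝ) < σ₀)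
    (h₁ : σ₁ < 1 / 2) : ∃ C : ℝ, 0 < C ∧ ∀ σ ∈ Set.Icc σ₀ σ₁, ∀ y : ℝ,
      ‖kernel k t (σ + y * Complex.I)‖ ≤ C * (1 + |y|)⁻¹ * exp (-(π * |y|)) := by
  rcases lt_or_ge σ₁ σ₀ with hempty | hle
  · exact ⟨1, one_pos, fun σ hσ => absurd (hσ.1.trans hσ.2) hempty.not_ge⟩
  have hk : (0 : ℝ) < k := by linarith
  have hk1 : (1 : ℝ) ≤ k := by exact_mod_cast Nat.cast_pos.mp hk
  obtain ⟨A, hA, ratio_le⟩ := exists_gammaNorm_div_gammaNorm_le h₀ (σ₁ := σ₁) (by linarith)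
  obtain ⟨B, hB, minus_le⟩ := exists_gammaNorm_half_sub_le (σ₀ := σ₀) h₁ (-t)
  obtain ⟨B', hB', plus_le⟩ := exists_gammaNorm_half_sub_le (σ₀ := σ₀) h₁ t
  refine ⟨A * B * B', by positivity, fun σ hσ y => ?_⟩
  have := (gammaNorm_pos (show 0 < 1 / 2 - σ by linarith [hσ.2]) (y - t)).le
  have := (gammaNorm_pos (show 0 < 1 / 2 - σ by linarith [hσ.2]) (y + t)).le
  have hpow : (1 + |y|) ^ (2 * σ - 1) * (1 + |y|) ^ (-σ) * (1 + |y|) ^ (-σ) = (1 + |y|)⁻¹ := by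
    rw [← rpow_add (by positivity), ← rpow_add (by positivity), ← rpow_neg_one]
    ring_nf
  rw [norm_kernel]
  calc gammaNorm (k - 1 / 2 + σ) y / gammaNorm (k + 1 / 2 - σ) y *
        gammaNorm (1 / 2 - σ) (y - t) * gammaNorm (1 / 2 - σ) (y + t)
      ≤ A * (1 + |y|) ^ (2 * σ - 1) * (B * (1 + |y|) ^ (-σ) * exp (-(π * |y - t|) / 2)) *
        (B' * (1 + |y|) ^ (-σ) * exp (-(π * |y + t|) / 2)) := by
        gcongr
        exacts [ratio_le σ hσ y, minus_le σ hσ y, plus_le σ hσ y]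
    _ = A * B * B' * ((1 + |y|) ^ (2 * σ - 1) * (1 + |y|) ^ (-σ) * (1 + |y|) ^ (-σ)) *
        (exp (-(π * |y - t|) / 2) * exp (-(π * |y + t|) / 2)) := by ring
    _ ≤ A * B * B' * (1 + |y|)⁻¹ * exp (-(π * |y|)) := by
        rw [hpow]
        gcongr
        exact exp_neg_abs_sub_mul_exp_neg_abs_add_le y t

theorem exists_norm_sinKernel_le (k : ℕ) (t : ℝ) {σ₀ σ₁ : ℝ} (h₀ : 1 / 2 - (k : ℝ) < σ₀)
    (h₁ : σ₁ < 1 / 2) : ∃ C : ℝ, 0 < C ∧ ∀ σ ∈ Set.Icc σ₀ σ₁, ∀ y : ℝ,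
      ‖sinKernel k t (σ + y * Complex.I)‖ ≤ C * (1 + |y|)⁻¹ := by
  obtain ⟨C, hC, kernel_le⟩ := exists_norm_kernel_le k t h₀ h₁
  refine ⟨C, hC, fun σ hσ y => ?_⟩
  rw [sinKernel, norm_mul]
  calc ‖kernel k t (σ + y * Complex.I)‖ * ‖Complex.sin (π * (σ + y * Complex.I))‖
      ≤ C * (1 + |y|)⁻¹ * exp (-(π * |y|)) * exp (π * |y|) := by
        gcongr
        exacts [kernel_le σ hσ y, norm_sin_pi_mul_le σ y]
    _ = C * (1 + |y|)⁻¹ := by rw [mul_assoc, ← exp_add]; simp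

/-! ### Vertical line integrals -/

/-- `∫ F(σ + iy) dy` over `-R ≤ y ≤ R`. -/
noncomputable def segmentIntegral (F : ℂ → ℂ) (σ R : ℝ) : ℂ :=
  ∫ y in (-R)..R, F (σ + y * Complex.I)

theorem tendsto_segmentIntegral_sub {F : ℂ → ℂ} {σ₀ σ₁ : ℝ} {B : ℝ → ℝ}
    (hF : ∀ w : ℂ, w.re ∈ Set.uIcc σ₀ σ₁ → DifferentiableAt ℂ F w) (hB : Tendsto B atTop (𝓝 0))
    (hFB : ∀ σ ∈ Set.uIcc σ₀ σ₁, ∀ y : ℝ, ‖F (σ + y * Complex.I)‖ ≤ B |y|) :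
    Tendsto (fun R => segmentIntegral F σ₀ R - segmentIntegral F σ₁ R) atTop (𝓝 0) := by
  have hlim : Tendsto (fun R => 2 * (B R * |σ₁ - σ₀|)) atTop (𝓝 0) := by
    simpa using (hB.mul_const |σ₁ - σ₀|).const_mul 2
  refine squeeze_zero_norm' ?_ hlim
  filter_upwards [eventually_ge_atTop 0] with R hR
  have horizontal_le (c : ℝ) (hc : |c| = R) :
      ‖∫ x in σ₀..σ₁, F (x + c * Complex.I)‖ ≤ B R * |σ₁ - σ₀| :=
    intervalIntegral.norm_integral_le_of_norm_le_const fun x hx => by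
      rw [← hc]
      exact hFB x (Set.uIoc_subset_uIcc hx) c
  have cauchy := Complex.integral_boundary_rect_eq_zero_of_differentiableOn F
    (σ₀ + (-R : ℝ) * Complex.I) (σ₁ + R * Complex.I)
    (fun w hw => (hF w (by simpa using hw.1)).differentiableWithinAt)
  have him (a b : ℝ) : (a + b * Complex.I : ℂ).im = b := by simp
  have hre (a b : ℝ) : (a + b * Complex.I : ℂ).re = a := by simp
  simp only [him, hre, smul_eq_mul] at cauchy
  have vertical_eq : Complex.I * (segmentIntegral F σ₀ R - segmentIntegral F σ₁ R) =
      (∫ x in σ₀..σ₁, F (x + (-R : ℝ) * Complex.I)) - ∫ x in σ₀..σ₁, F (x + R * Complex.I) := by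
    unfold segmentIntegral
    linear_combination -cauchy
  calc ‖segmentIntegral F σ₀ R - segmentIntegral F σ₁ R‖
      = ‖Complex.I * (segmentIntegral F σ₀ R - segmentIntegral F σ₁ R)‖ := by
        rw [norm_mul, Complex.norm_I, one_mul]
    _ ≤ ‖∫ x in σ₀..σ₁, F (x + (-R : ℝ) * Complex.I)‖ +
        ‖∫ x in σ₀..σ₁, F (x + R * Complex.I)‖ := vertical_eq ▸ norm_sub_le _ _
    _ ≤ 2 * (B R * |σ₁ - σ₀|) := by
        linarith [horizontal_le (-R) (by rw [abs_neg, abs_of_nonneg hR]),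
          horizontal_le R (abs_of_nonneg hR)]

lemma lineIntegral_eq_of_tendsto {Δ : ℝ} {f F : ℂ → ℂ} {L : ℂ} (hf : ∀ s, f s = F (s / 2))
    (hL : Tendsto (segmentIntegral F (Δ / 2)) atTop (𝓝 L)) :
    lineIntegral Δ f = 1 / π * L := by
  refine Tendsto.limUnder_eq ?_
  have substitution (R : ℝ) : (∫ y in (-R)..R, f (Δ + y * Complex.I)) =
      2 * segmentIntegral F (Δ / 2) (R / 2) := by
    have hscale := intervalIntegral.integral_comp_div (a := -R) (b := R)
      (fun y : ℝ => F ((Δ / 2 : ℝ) + y * Complex.I)) two_ne_zero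
    rw [neg_div, Complex.real_smul] at hscale
    rw [segmentIntegral, ← Complex.ofReal_ofNat, ← hscale]
    refine intervalIntegral.integral_congr fun y _ => ?_
    simp only [hf]
    push_cast
    ring_nf
  simp_rw [substitution]
  refine ((hL.comp (tendsto_id.atTop_div_const (two_pos (α := ℝ)))).const_mul
    (1 / (π : ℂ))).congr fun R => ?_
  simp only [Function.comp_apply, id]
  ring

lemma norm_ofReal_cpow_add_mul_I {x : ℝ} (hx : 0 < x) (σ y : ℝ) :
    ‖(x : ℂ) ^ (σ + y * Complex.I : ℂ)‖ = x ^ σ := by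
  rw [Complex.norm_cpow_eq_rpow_re_of_pos hx]; simp

lemma differentiable_ofReal_cpow {x : ℝ} (hx : x ≠ 0) :
    Differentiable ℂ fun w : ℂ => (x : ℂ) ^ w := fun _ =>
  differentiableAt_id.const_cpow (Or.inl (Complex.ofReal_ne_zero.mpr hx))

lemma continuous_comp_add_mul_I {F : ℂ → ℂ} {σ : ℝ}
    (hF : ∀ w : ℂ, w.re = σ → ContinuousAt F w) :
    Continuous fun y : ℝ => F (σ + y * Complex.I) :=
  continuous_iff_continuousAt.mpr fun y =>
    (hF (σ + y * Complex.I) (by simp)).comp (f := fun y : ℝ => (σ + y * Complex.I : ℂ))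
      (by fun_prop)

lemma continuous_mul_cpow_vertical {f : ℂ → ℂ} {x σ : ℝ} (hx : 0 < x)
    (hf : ∀ w : ℂ, w.re = σ → DifferentiableAt ℂ f w) :
    Continuous fun y : ℝ => f (σ + y * Complex.I) * (x : ℂ) ^ (σ + y * Complex.I : ℂ) :=
  continuous_comp_add_mul_I (F := fun w => f w * (x : ℂ) ^ w) fun w hw =>
    ((hf w hw).mul (differentiable_ofReal_cpow hx.ne' w)).continuousAt

lemma tendsto_segmentIntegral_mul_cpow_sub {f : ℂ → ℂ} {x σ₀ σ₁ C : ℝ} (hx : 0 < x)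
    (hf : ∀ w : ℂ, w.re ∈ Set.uIcc σ₀ σ₁ → DifferentiableAt ℂ f w)
    (hC : ∀ σ ∈ Set.uIcc σ₀ σ₁, ∀ y : ℝ, ‖f (σ + y * Complex.I)‖ ≤ C * (1 + |y|)⁻¹) :
    Tendsto (fun R => segmentIntegral (fun w => f w * (x : ℂ) ^ w) σ₀ R -
      segmentIntegral (fun w => f w * (x : ℂ) ^ w) σ₁ R) atTop (𝓝 0) := by
  obtain ⟨M, hM⟩ := isCompact_uIcc.exists_bound_of_continuousOn (s := Set.uIcc σ₀ σ₁)
    (f := fun σ : ℝ => x ^ σ) (continuous_const_rpow hx.ne').continuousOn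
  have hdecay : Tendsto (fun R : ℝ => C * (1 + R)⁻¹ * M) atTop (𝓝 0) := by
    simpa using ((tendsto_inv_atTop_zero.comp
      (tendsto_atTop_add_const_left atTop (1 : ℝ) tendsto_id)).const_mul C).mul_const M
  refine tendsto_segmentIntegral_sub
    (fun w hw => (hf w hw).mul (differentiable_ofReal_cpow hx.ne' w)) hdecay fun σ hσ y => ?_
  rw [norm_mul, norm_ofReal_cpow_add_mul_I hx]
  exact mul_le_mul (hC σ hσ y) ((le_norm_self _).trans (hM σ hσ)) (by positivity)
    ((norm_nonneg _).trans (hC σ hσ y))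

section AbsolutelyIntegrable

variable {f : ℂ → ℂ} {x σ : ℝ} {g : ℝ → ℝ}

lemma norm_mul_cpow_vertical_le (hx : 0 < x) (hb : ∀ y : ℝ, ‖f (σ + y * Complex.I)‖ ≤ g y)
    (y : ℝ) : ‖f (σ + y * Complex.I) * (x : ℂ) ^ (σ + y * Complex.I : ℂ)‖ ≤ x ^ σ * g y := by
  rw [norm_mul, norm_ofReal_cpow_add_mul_I hx, mul_comm]
  exact mul_le_mul_of_nonneg_left (hb y) (by positivity)

lemma norm_integral_mul_cpow_le (hx : 0 < x) (hg : Integrable g)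
    (hb : ∀ y : ℝ, ‖f (σ + y * Complex.I)‖ ≤ g y) :
    ‖∫ y : ℝ, f (σ + y * Complex.I) * (x : ℂ) ^ (σ + y * Complex.I : ℂ)‖ ≤ x ^ σ * ∫ y, g y := by
  rw [← integral_const_mul]
  exact norm_integral_le_of_norm_le (hg.const_mul _)
    (Eventually.of_forall (norm_mul_cpow_vertical_le hx hb))

lemma tendsto_segmentIntegral_mul_cpow (hx : 0 < x) (hg : Integrable g)
    (hb : ∀ y : ℝ, ‖f (σ + y * Complex.I)‖ ≤ g y)
    (hf : ∀ w : ℂ, w.re = σ → DifferentiableAt ℂ f w) :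
    Tendsto (segmentIntegral (fun w => f w * (x : ℂ) ^ w) σ) atTop
      (𝓝 (∫ y : ℝ, f (σ + y * Complex.I) * (x : ℂ) ^ (σ + y * Complex.I : ℂ))) :=
  intervalIntegral_tendsto_integral ((hg.const_mul (x ^ σ)).mono'
    (continuous_mul_cpow_vertical hx hf).aestronglyMeasurable
    (Eventually.of_forall (norm_mul_cpow_vertical_le hx hb))) tendsto_neg_atTop_atBot tendsto_id

end AbsolutelyIntegrable

lemma norm_one_div_pi_mul_le (z : ℂ) : ‖1 / (π : ℂ) * z‖ ≤ ‖z‖ := by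
  rw [norm_mul, norm_div, norm_one, Complex.norm_of_nonneg pi_pos.le]
  exact mul_le_of_le_one_left (norm_nonneg z) (by rw [div_le_one pi_pos]; linarith [pi_gt_three])

lemma abscissa_natCast_zero (k : ℕ) : abscissa k 0 = -k := by simp [abscissa]

section ShiftContour

variable {k : ℕ} (t : ℝ) {x σ₀ σ₁ : ℝ}

lemma tendsto_segmentIntegral_kernel_sub (hx : 0 < x) (h₀ : σ₀ ∈ Set.Ioo (1 / 2 - (k : ℝ)) (1 / 2))
    (h₁ : σ₁ ∈ Set.Ioo (1 / 2 - (k : ℝ)) (1 / 2)) :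
    Tendsto (fun R => segmentIntegral (fun w => kernel k t w * (x : ℂ) ^ w) σ₀ R -
      segmentIntegral (fun w => kernel k t w * (x : ℂ) ^ w) σ₁ R) atTop (𝓝 0) := by
  obtain ⟨C, _, kernel_le⟩ := exists_norm_kernel_le k t (lt_min h₀.1 h₁.1) (max_lt h₀.2 h₁.2)
  refine tendsto_segmentIntegral_mul_cpow_sub (C := C) hx (fun w hw => differentiableAt_kernel t
    ((lt_min h₀.1 h₁.1).trans_le hw.1) (hw.2.trans_lt (max_lt h₀.2 h₁.2))) fun σ hσ y => ?_
  have hexp : exp (-(π * |y|)) ≤ 1 := exp_le_one_iff.mpr (neg_nonpos.mpr (by positivity))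
  exact (kernel_le σ hσ y).trans (mul_le_of_le_one_right (by positivity) hexp)

lemma tendsto_segmentIntegral_sinKernel_sub (hx : 0 < x)
    (h₀ : σ₀ ∈ Set.Ioo (1 / 2 - (k : ℝ)) (1 / 2)) (h₁ : σ₁ ∈ Set.Ioo (1 / 2 - (k : ℝ)) (1 / 2)) :
    Tendsto (fun R => segmentIntegral (fun w => sinKernel k t w * (x : ℂ) ^ w) σ₀ R -
      segmentIntegral (fun w => sinKernel k t w * (x : ℂ) ^ w) σ₁ R) atTop (𝓝 0) := by
  obtain ⟨C, -, sinKernel_le⟩ :=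
    exists_norm_sinKernel_le k t (lt_min h₀.1 h₁.1) (max_lt h₀.2 h₁.2)
  exact tendsto_segmentIntegral_mul_cpow_sub hx (fun w hw => differentiableAt_sinKernel t
    ((lt_min h₀.1 h₁.1).trans_le hw.1) (hw.2.trans_lt (max_lt h₀.2 h₁.2))) sinKernel_le

end ShiftContour

theorem norm_I₂_le {k : ℕ} (hk : 2 ≤ k) (t : ℝ) {x : ℝ} (hx : 0 < x) {σ : ℝ}
    (hσ : σ ∈ Set.Ioo (1 / 2 - (k : ℝ)) (1 / 2)) {g : ℝ → ℝ} (hg : Integrable g)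
    (hb : ∀ y : ℝ, ‖kernel k t (σ + y * Complex.I)‖ ≤ g y) :
    ‖I₂ k 0 (t * Complex.I) x‖ ≤ x ^ σ * ∫ y, g y := by
  have hk2 : (2 : ℝ) ≤ k := by exact_mod_cast hk
  have shift := tendsto_segmentIntegral_kernel_sub (k := k) t hx (σ₀ := -k / 2)
    ⟨by linarith, by linarith⟩ hσ
  have limit := tendsto_segmentIntegral_mul_cpow hx hg hb fun w hw =>
    differentiableAt_kernel t (hw ▸ hσ.1) (hw ▸ hσ.2)
  have I₂_eq : I₂ k 0 (t * Complex.I) x =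
      1 / π * ∫ y : ℝ, kernel k t (σ + y * Complex.I) * (x : ℂ) ^ (σ + y * Complex.I : ℂ) := by
    unfold I₂
    rw [abscissa_natCast_zero]
    refine lineIntegral_eq_of_tendsto (F := fun w => kernel k t w * (x : ℂ) ^ w) (fun s => ?_) ?_
    · simp only [gammaKernel, kernel, sub_zero]
    · simpa using shift.add limit
  rw [I₂_eq]
  exact (norm_one_div_pi_mul_le _).trans (norm_integral_mul_cpow_le hx hg hb)

lemma segmentIntegral_sinKernelDiff {k : ℕ} (t : ℝ) {x : ℝ} (hx : 0 < x) {σ : ℝ}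
    (hσ : σ ∈ Set.Ioo (3 / 2 - (k : ℝ)) (1 / 2)) (R : ℝ) :
    segmentIntegral (fun w => sinKernelDiff k t w * (x : ℂ) ^ w) σ R =
      segmentIntegral (fun w => sinKernel k t w * (x : ℂ) ^ w) σ R -
        x * segmentIntegral (fun w => sinKernel k t w * (x : ℂ) ^ w) (σ - 1) R := by
  have intervalIntegrable (c : ℝ) (hc : c ∈ Set.Ioo (1 / 2 - (k : ℝ)) (1 / 2)) :
      IntervalIntegrable (fun y : ℝ =>
        sinKernel k t (c + y * Complex.I) * (x : ℂ) ^ (c + y * Complex.I : ℂ)) volume (-R) R :=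
    (continuous_mul_cpow_vertical hx fun w hw =>
      differentiableAt_sinKernel t (hw ▸ hc.1) (hw ▸ hc.2)).intervalIntegrable _ _
  have ⟨hleft, hright⟩ := hσ
  unfold segmentIntegral
  rw [← intervalIntegral.integral_const_mul, ← intervalIntegral.integral_sub
    (intervalIntegrable σ ⟨by linarith, hright⟩)
    ((intervalIntegrable (σ - 1) ⟨by linarith, by linarith⟩).const_mul _)]
  refine intervalIntegral.integral_congr fun y _ => ?_
  have hx0 : (x : ℂ) ≠ 0 := Complex.ofReal_ne_zero.mpr hx.ne'
  have hsub : ((σ - 1 : ℝ) + y * Complex.I : ℂ) = σ + y * Complex.I - 1 := by push_cast; ring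
  simp only [sinKernelDiff, hsub]
  rw [Complex.cpow_sub _ _ hx0, Complex.cpow_one]
  field_simp

/-- The integral over `Re w = -k/2` is compared with those over `Re w = σ` and `Re w = σ - 1`;
the combination `(1 - x) I₁` then only involves the absolutely convergent integral of
`sinKernelDiff`. -/
theorem abs_one_sub_mul_norm_I₁_le {k : ℕ} (hk : 2 ≤ k) (t : ℝ) {x : ℝ} (hx : 0 < x) {σ : ℝ}
    (hσ : σ ∈ Set.Ioo (3 / 2 - (k : ℝ)) (1 / 2)) {g : ℝ → ℝ} (hg : Integrable g)
    (hb : ∀ y : ℝ, ‖sinKernelDiff k t (σ + y * Complex.I)‖ ≤ g y) :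
    |1 - x| * ‖I₁ k 0 (t * Complex.I) x‖ ≤ x ^ σ * ∫ y, g y := by
  have norm_integral_le := norm_integral_mul_cpow_le (f := sinKernelDiff k t) hx hg hb
  rcases eq_or_ne x 1 with rfl | hx1
  · simpa using (norm_nonneg _).trans norm_integral_le
  have hk2 : (2 : ℝ) ≤ k := by exact_mod_cast hk
  have hx1' : (1 - x : ℂ) ≠ 0 := sub_ne_zero.mpr (by exact_mod_cast hx1.symm)
  have shift := tendsto_segmentIntegral_sinKernel_sub (k := k) t hx (σ₀ := -k / 2) (σ₁ := σ)
    ⟨by linarith, by linarith⟩ ⟨by linarith [hσ.1], hσ.2⟩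
  have shift' := tendsto_segmentIntegral_sinKernel_sub (k := k) t hx (σ₀ := -k / 2) (σ₁ := σ - 1)
    ⟨by linarith, by linarith⟩ ⟨by linarith [hσ.1], by linarith [hσ.2]⟩
  have limit := tendsto_segmentIntegral_mul_cpow hx hg hb fun w hw =>
    differentiableAt_sinKernelDiff t (hw ▸ hσ.1) (hw ▸ hσ.2)
  set L := ∫ y : ℝ, sinKernelDiff k t (σ + y * Complex.I) * (x : ℂ) ^ (σ + y * Complex.I : ℂ)
  have I₁_eq : I₁ k 0 (t * Complex.I) x = 1 / π * ((1 - x : ℂ)⁻¹ * L) := by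
    unfold I₁
    rw [abscissa_natCast_zero]
    refine lineIntegral_eq_of_tendsto (F := fun w => sinKernel k t w * (x : ℂ) ^ w) (fun s => ?_) ?_
    · simp only [gammaKernel, kernel, sinKernel, sub_zero, zero_add]
    · have combined := ((shift.sub (shift'.const_mul (x : ℂ))).add limit).const_mul (1 - x : ℂ)⁻¹
      rw [mul_zero, sub_zero, zero_add] at combined
      refine combined.congr fun R => ?_
      rw [segmentIntegral_sinKernelDiff t hx hσ]
      field_simp
      ring
  calc |1 - x| * ‖I₁ k 0 (t * Complex.I) x‖ = ‖(1 - x : ℂ) * I₁ k 0 (t * Complex.I) x‖ := by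
        rw [norm_mul, ← Complex.ofReal_one, ← Complex.ofReal_sub, Complex.norm_real, norm_eq_abs]
    _ = ‖1 / (π : ℂ) * L‖ := by rw [I₁_eq]; congr 1; field_simp
    _ ≤ x ^ σ * ∫ y, g y := (norm_one_div_pi_mul_le _).trans norm_integral_le

/-! ### Uniform bounds on the lines `Re w = ±1/2 - δ` -/

lemma abs_sub_add_abs_add (y t : ℝ) : |y - t| + |y + t| = 2 * max |y| |t| := by
  rcases abs_cases y with ⟨_, _⟩ | ⟨_, _⟩ <;> rcases abs_cases t with ⟨_, _⟩ | ⟨_, _⟩ <;>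
  rcases abs_cases (y - t) with ⟨_, _⟩ | ⟨_, _⟩ <;>
  rcases abs_cases (y + t) with ⟨_, _⟩ | ⟨_, _⟩ <;>
  rcases max_cases |y| |t| with _ | _ <;> linarith

lemma one_add_abs_sub_mul_one_add_abs_add_le (y t : ℝ) :
    (1 + |y - t|) * (1 + |y + t|) ≤ (1 + max |y| |t|) ^ 2 := by
  nlinarith [abs_sub_add_abs_add y t, sq_nonneg (|y - t| - |y + t|),
    sq_nonneg (|y - t| + |y + t|)]

lemma one_add_abs_le_one_add_abs_sub_mul (y t : ℝ) :
    1 + |y| ≤ (1 + |y - t|) * (1 + |y + t|) := by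
  nlinarith [abs_sub_add_abs_add y t, le_max_left |y| |t|, abs_nonneg y,
    mul_nonneg (abs_nonneg (y - t)) (abs_nonneg (y + t))]

lemma one_add_sq_le_two_mul_exp {s : ℝ} (hs : 0 ≤ s) : (1 + s) ^ 2 ≤ 2 * exp s := by
  nlinarith [quadratic_le_exp_of_nonneg hs]

lemma exists_gammaNorm_sub_mul_gammaNorm_add_le {a : ℝ} (ha : 0 < a) :
    ∃ C : ℝ, 0 < C ∧ ∀ y t : ℝ, gammaNorm a (y - t) * gammaNorm a (y + t) ≤
      C * ((1 + |y - t|) * (1 + |y + t|)) ^ (a - 1 / 2) * exp (-(π * max |y| |t|)) := by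
  obtain ⟨C, hC, upper⟩ := exists_gammaNorm_le ha a
  have upper_a := upper a ⟨le_rfl, le_rfl⟩
  refine ⟨C * C, by positivity, fun y t => ?_⟩
  have := (gammaNorm_pos ha (y + t)).le
  calc gammaNorm a (y - t) * gammaNorm a (y + t)
      ≤ (C * (1 + |y - t|) ^ (a - 1 / 2) * exp (-(π * |y - t|) / 2)) *
        (C * (1 + |y + t|) ^ (a - 1 / 2) * exp (-(π * |y + t|) / 2)) := by
        gcongr
        exacts [upper_a _, upper_a _]
    _ = C * C * ((1 + |y - t|) ^ (a - 1 / 2) * (1 + |y + t|) ^ (a - 1 / 2)) *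
        (exp (-(π * |y - t|) / 2) * exp (-(π * |y + t|) / 2)) := by ring
    _ = _ := by
        rw [← mul_rpow (by positivity) (by positivity), ← exp_add]
        congr 2
        linear_combination (-π / 2) * abs_sub_add_abs_add y t

lemma exp_neg_max_sub_le (y t : ℝ) :
    exp (-(max |y| |t| - |t|)) ≤ 2 * (1 + (y / (3 + |t|)) ^ 2)⁻¹ := by
  set s := max |y| |t| - |t| with hs
  have hs0 : 0 ≤ s := sub_nonneg.mpr (le_max_right _ _)
  have hy : |y| ≤ |t| + s := by rw [hs]; linarith [le_max_left |y| |t|]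
  have hT : 0 < 3 + |t| := by positivity
  have hquot : (y / (3 + |t|)) ^ 2 ≤ (1 + s) ^ 2 := by
    rw [← sq_abs, abs_div, abs_of_pos hT]
    gcongr
    rw [div_le_iff₀ hT]
    nlinarith [abs_nonneg t]
  rw [exp_neg, ← div_eq_mul_inv, inv_le_comm₀ (exp_pos _) (by positivity), inv_div,
    div_le_iff₀ two_pos]
  nlinarith [quadratic_le_exp_of_nonneg hs0]

lemma exp_pi_mul_abs_mul_exp_neg_le (y t : ℝ) :
    exp (π * |t|) * exp (-(π * max |y| |t|)) ≤ exp (-(max |y| |t| - |t|)) := by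
  rw [← exp_add, exp_le_exp]
  nlinarith [pi_gt_three, le_max_right |y| |t|]

lemma cosh_pi_mul_le (t : ℝ) : cosh (π * t) ≤ exp (π * |t|) := by
  simpa [abs_mul, abs_of_pos pi_pos] using cosh_le_exp_abs (π * t)

lemma gammaNorm_le_gammaNorm {a b : ℝ} (ha : 2 ≤ a) (hab : a ≤ b) (y : ℝ) :
    gammaNorm a y ≤ gammaNorm b y := by
  have hb : 0 < b := by linarith
  refine (gammaNorm_le_mul_gammaNorm (by linarith) hab y).trans
    (mul_le_of_le_one_left (gammaNorm_pos hb y).le ?_)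
  rw [div_le_one (Gamma_pos_of_pos hb)]
  exact Gamma_strictMonoOn_Ici.monotoneOn ha (ha.trans hab) hab

lemma gammaNorm_sub_div_gammaNorm_add_le_two {a δ : ℝ} (ha : 2 ≤ a) (hδ : 0 ≤ δ)
    (hδ' : δ ≤ 1 / 4) (y : ℝ) : gammaNorm (a - δ) y / gammaNorm (a + δ) y ≤ 2 := by
  have hsub : 0 < a - δ := by linarith
  have hadd := gammaNorm_pos (show 0 < a + δ by linarith) y
  have hsqrt : √((a + δ) ^ 2 + y ^ 2) ≤ 2 * √((a - δ) ^ 2 + y ^ 2) := by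
    rw [sqrt_le_left (by positivity), mul_pow, sq_sqrt (by positivity)]
    nlinarith [sq_nonneg y]
  have hshift := gammaNorm_le_gammaNorm (a := a - δ + 1) (b := a + δ + 1) (by linarith)
    (by linarith) y
  rw [gammaNorm_add_one hsub.ne', gammaNorm_add_one (show a + δ ≠ 0 by linarith)] at hshift
  have hpos : 0 < √((a - δ) ^ 2 + y ^ 2) := by positivity
  rw [div_le_iff₀ hadd]
  refine le_of_mul_le_mul_left ?_ hpos
  nlinarith [mul_le_mul_of_nonneg_right hsqrt hadd.le]

lemma gammaNorm_sub_one_div_gammaNorm_add_one_le {a δ : ℝ} (ha : 2 ≤ a) (hδ : 0 ≤ δ)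
    (hδ' : δ ≤ 1 / 4) (y : ℝ) :
    gammaNorm (a - 1 - δ) y / gammaNorm (a + 1 + δ) y ≤ 2 * (1 + y ^ 2)⁻¹ := by
  have hadd := gammaNorm_pos (show 0 < a + 1 + δ by linarith) y
  have hsub := gammaNorm_pos (show 0 < a - 1 - δ by linarith) y
  have hshift : √((a - δ) ^ 2 + y ^ 2) * √((a - 1 - δ) ^ 2 + y ^ 2) * gammaNorm (a - 1 - δ) y ≤
      gammaNorm (a + 1 + δ) y := by
    rw [mul_assoc, ← gammaNorm_add_one (by linarith), show a - 1 - δ + 1 = a - δ by ring,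
      ← gammaNorm_add_one (by linarith)]
    exact gammaNorm_le_gammaNorm (by linarith) (by linarith) y
  have hsqrt : (1 + y ^ 2) / 2 ≤ √((a - δ) ^ 2 + y ^ 2) * √((a - 1 - δ) ^ 2 + y ^ 2) := by
    rw [← sqrt_mul (by positivity)]
    refine le_sqrt_of_sq_le ?_
    calc ((1 + y ^ 2) / 2) ^ 2 ≤ (1 + y ^ 2) * (1 / 2 + y ^ 2) := by nlinarith [sq_nonneg y]
      _ ≤ ((a - δ) ^ 2 + y ^ 2) * ((a - 1 - δ) ^ 2 + y ^ 2) := by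
          gcongr <;> nlinarith
  rw [div_le_iff₀ hadd, mul_right_comm, ← div_eq_mul_inv, le_div_iff₀ (by positivity)]
  linarith [mul_le_mul_of_nonneg_right hsqrt hsub.le]

lemma exists_norm_kernel_right_le {δ : ℝ} (hδ : 0 < δ) (hδ' : δ ≤ 1 / 4) :
    ∃ C : ℝ, 0 < C ∧ ∀ k : ℕ, 2 ≤ k → ∀ t y : ℝ,
      ‖kernel k t ((1 / 2 - δ : ℝ) + y * Complex.I)‖ ≤
        C * ((1 + |y - t|) * (1 + |y + t|)) ^ (δ - 1 / 2) * exp (-(π * max |y| |t|)) := by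
  obtain ⟨C, hC, product_le⟩ := exists_gammaNorm_sub_mul_gammaNorm_add_le hδ
  refine ⟨2 * C, by positivity, fun k hk t y => ?_⟩
  have := (gammaNorm_pos hδ (y - t)).le
  have := (gammaNorm_pos hδ (y + t)).le
  rw [norm_kernel, show (k - 1 / 2 + (1 / 2 - δ) : ℝ) = k - δ by ring,
    show (k + 1 / 2 - (1 / 2 - δ) : ℝ) = k + δ by ring, show 1 / 2 - (1 / 2 - δ) = δ by ring,
    mul_assoc, mul_assoc 2, mul_assoc 2]
  gcongr ?_ * ?_
  · exact gammaNorm_sub_div_gammaNorm_add_le_two (by exact_mod_cast hk) hδ.le hδ' y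
  · exact product_le y t

lemma exists_cosh_mul_norm_kernel_right_le {δ : ℝ} (hδ : 0 < δ) (hδ' : δ ≤ 1 / 4) :
    ∃ C : ℝ, 0 < C ∧ ∀ k : ℕ, 2 ≤ k → ∀ t y : ℝ,
      cosh (π * t) * ‖kernel k t ((1 / 2 - δ : ℝ) + y * Complex.I)‖ ≤
        C * (1 + (y / (3 + |t|)) ^ 2)⁻¹ := by
  obtain ⟨C, hC, kernel_le⟩ := exists_norm_kernel_right_le hδ hδ'
  refine ⟨2 * C, by positivity, fun k hk t y => ?_⟩
  have hpow : ((1 + |y - t|) * (1 + |y + t|)) ^ (δ - 1 / 2) ≤ 1 :=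
    rpow_le_one_of_one_le_of_nonpos
      (by linarith [one_add_abs_le_one_add_abs_sub_mul y t, abs_nonneg y]) (by linarith)
  calc cosh (π * t) * ‖kernel k t ((1 / 2 - δ : ℝ) + y * Complex.I)‖
      ≤ exp (π * |t|) * (C * 1 * exp (-(π * max |y| |t|))) := by
        gcongr
        · exact cosh_pi_mul_le t
        · exact (kernel_le k hk t y).trans (by gcongr)
    _ = C * (exp (π * |t|) * exp (-(π * max |y| |t|))) := by ring
    _ ≤ C * (2 * (1 + (y / (3 + |t|)) ^ 2)⁻¹) := by
        gcongr C * ?_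
        exact (exp_pi_mul_abs_mul_exp_neg_le y t).trans (exp_neg_max_sub_le y t)
    _ = 2 * C * (1 + (y / (3 + |t|)) ^ 2)⁻¹ := by ring

lemma mul_rpow_half_add_le {δ : ℝ} (hδ : 0 ≤ δ) (hδ' : δ ≤ 1 / 2) (y t : ℝ) :
    ((1 + |y - t|) * (1 + |y + t|)) ^ (1 / 2 + δ) ≤
      (3 + |t|) ^ (1 + 2 * δ) * (1 + (max |y| |t| - |t|)) ^ 2 := by
  set m := max |y| |t|
  have hmt : 0 ≤ m - |t| := sub_nonneg.mpr (le_max_right _ _)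
  have : 0 ≤ m := (abs_nonneg y).trans (le_max_left _ _)
  calc ((1 + |y - t|) * (1 + |y + t|)) ^ (1 / 2 + δ) ≤ ((1 + m) ^ 2) ^ (1 / 2 + δ) := by
        gcongr
        exact one_add_abs_sub_mul_one_add_abs_add_le y t
    _ = (1 + m) ^ (1 + 2 * δ) := by
        rw [← rpow_natCast, ← rpow_mul (by positivity)]
        congr 1; push_cast; ring
    _ ≤ ((3 + |t|) * (1 + (m - |t|))) ^ (1 + 2 * δ) := by
        gcongr
        nlinarith [abs_nonneg t]
    _ = (3 + |t|) ^ (1 + 2 * δ) * (1 + (m - |t|)) ^ (1 + 2 * δ) :=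
        mul_rpow (by positivity) (by positivity)
    _ ≤ (3 + |t|) ^ (1 + 2 * δ) * (1 + (m - |t|)) ^ 2 := by
        gcongr
        rw [← rpow_natCast]
        exact rpow_le_rpow_of_exponent_le (by linarith) (by push_cast; linarith)

lemma exp_mul_exp_neg_mul_one_add_sq_le_two (y t : ℝ) :
    exp (π * |t|) * exp (-(π * max |y| |t|)) * (1 + (max |y| |t| - |t|)) ^ 2 ≤ 2 := by
  set s := max |y| |t| - |t|
  have hs : 0 ≤ s := sub_nonneg.mpr (le_max_right _ _)
  calc exp (π * |t|) * exp (-(π * max |y| |t|)) * (1 + s) ^ 2 ≤ exp (-s) * (2 * exp s) := by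
        gcongr
        exacts [exp_pi_mul_abs_mul_exp_neg_le y t, one_add_sq_le_two_mul_exp hs]
    _ = 2 := by rw [exp_neg]; field_simp

lemma exists_cosh_mul_norm_kernel_left_le {δ : ℝ} (hδ : 0 < δ) (hδ' : δ ≤ 1 / 4) :
    ∃ C : ℝ, 0 < C ∧ ∀ k : ℕ, 2 ≤ k → ∀ t y : ℝ,
      cosh (π * t) * ‖kernel k t ((-1 / 2 - δ : ℝ) + y * Complex.I)‖ ≤
        C * (3 + |t|) ^ (1 + 2 * δ) * (1 + y ^ 2)⁻¹ := by
  have hδ1 : 0 < 1 + δ := by linarith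
  obtain ⟨C, hC, product_le⟩ := exists_gammaNorm_sub_mul_gammaNorm_add_le hδ1
  rw [show 1 + δ - 1 / 2 = 1 / 2 + δ by ring] at product_le
  refine ⟨4 * C, by positivity, fun k hk t y => ?_⟩
  have hk2 : (2 : ℝ) ≤ k := by exact_mod_cast hk
  set m := max |y| |t|
  have := gammaNorm_pos hδ1 (y - t)
  have := gammaNorm_pos hδ1 (y + t)
  have := gammaNorm_pos (show 0 < k - 1 - δ by linarith) y
  have := gammaNorm_pos (show 0 < k + 1 + δ by linarith) y
  rw [norm_kernel, show (k - 1 / 2 + (-1 / 2 - δ) : ℝ) = k - 1 - δ by ring,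
    show (k + 1 / 2 - (-1 / 2 - δ) : ℝ) = k + 1 + δ by ring,
    show 1 / 2 - (-1 / 2 - δ) = 1 + δ by ring, mul_assoc (_ / _)]
  calc cosh (π * t) * (gammaNorm (k - 1 - δ) y / gammaNorm (k + 1 + δ) y *
        (gammaNorm (1 + δ) (y - t) * gammaNorm (1 + δ) (y + t)))
      ≤ exp (π * |t|) * ((2 * (1 + y ^ 2)⁻¹) *
        (C * ((3 + |t|) ^ (1 + 2 * δ) * (1 + (m - |t|)) ^ 2) * exp (-(π * m)))) := by
        gcongr ?_ * (?_ * ?_)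
        · exact cosh_pi_mul_le t
        · exact gammaNorm_sub_one_div_gammaNorm_add_one_le hk2 hδ.le hδ' y
        · refine (product_le y t).trans ?_
          gcongr
          exact mul_rpow_half_add_le hδ.le (by linarith) y t
    _ = 2 * C * (3 + |t|) ^ (1 + 2 * δ) * (1 + y ^ 2)⁻¹ *
        (exp (π * |t|) * exp (-(π * m)) * (1 + (m - |t|)) ^ 2) := by ring
    _ ≤ 2 * C * (3 + |t|) ^ (1 + 2 * δ) * (1 + y ^ 2)⁻¹ * 2 := by
        gcongr
        exact exp_mul_exp_neg_mul_one_add_sq_le_two y t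
    _ = 4 * C * (3 + |t|) ^ (1 + 2 * δ) * (1 + y ^ 2)⁻¹ := by ring

/-! ### The difference of the sine kernel -/

lemma Gamma_add_one_of_re_pos {s : ℂ} (hs : 0 < s.re) :
    Complex.Gamma (s + 1) = s * Complex.Gamma s :=
  Complex.Gamma_add_one s (by rintro rfl; simp at hs)

section FunctionalEquation

variable {k : ℕ} (t : ℝ) {w : ℂ} (hleft : 3 / 2 - (k : ℝ) < w.re) (hright : w.re < 1 / 2)
include hleft hright

lemma kernel_sub_one_mul :
    kernel k t (w - 1) * ((k - 3 / 2 + w) * (k + 1 / 2 - w)) =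
      kernel k t w * ((1 / 2 - w) ^ 2 + t ^ 2) := by
  have : (0 : ℝ) ≤ k := k.cast_nonneg
  have numerator : Complex.Gamma (k - 1 / 2 + w) =
      (k - 3 / 2 + w) * Complex.Gamma (k - 1 / 2 + (w - 1)) := by
    rw [show (k - 1 / 2 + (w - 1) : ℂ) = k - 3 / 2 + w by ring,
      ← Gamma_add_one_of_re_pos (by simp; linarith)]
    ring_nf
  have denominator : Complex.Gamma (k + 1 / 2 - (w - 1)) =
      (k + 1 / 2 - w) * Complex.Gamma (k + 1 / 2 - w) := by
    rw [← Gamma_add_one_of_re_pos (by simp; linarith)]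
    ring_nf
  have plus : Complex.Gamma (1 / 2 + t * Complex.I - (w - 1)) =
      (1 / 2 + t * Complex.I - w) * Complex.Gamma (1 / 2 + t * Complex.I - w) := by
    rw [← Gamma_add_one_of_re_pos (by simp; linarith)]
    ring_nf
  have minus : Complex.Gamma (1 / 2 - t * Complex.I - (w - 1)) =
      (1 / 2 - t * Complex.I - w) * Complex.Gamma (1 / 2 - t * Complex.I - w) := by
    rw [← Gamma_add_one_of_re_pos (by simp; linarith)]
    ring_nf
  have factorization : ((1 / 2 - w) ^ 2 + t ^ 2 : ℂ) =
      (1 / 2 + t * Complex.I - w) * (1 / 2 - t * Complex.I - w) := by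
    linear_combination (t : ℂ) ^ 2 * Complex.I_sq
  have hGamma : Complex.Gamma (k + 1 / 2 - w) ≠ 0 :=
    Complex.Gamma_ne_zero_of_re_pos (by simp; linarith)
  have hfactor : (k + 1 / 2 - w : ℂ) ≠ 0 := by
    intro h
    have := congrArg Complex.re h
    simp at this
    linarith
  unfold kernel
  rw [numerator, denominator, plus, minus, factorization]
  generalize (k + 1 / 2 - w : ℂ) = d at *
  field_simp

lemma sinKernel_sub_one_mul :
    sinKernel k t (w - 1) * ((k - 3 / 2 + w) * (k + 1 / 2 - w)) =
      -(sinKernel k t w * ((1 / 2 - w) ^ 2 + t ^ 2)) := by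
  have hsin : Complex.sin (π * (w - 1)) = -Complex.sin (π * w) := by
    rw [mul_sub, mul_one, Complex.sin_sub_pi]
  unfold sinKernel
  rw [hsin]
  linear_combination -Complex.sin (π * w) * kernel_sub_one_mul t hleft hright

/-- The quadratic terms in `w` cancel in the difference, which is where the decay is gained. -/
lemma sinKernelDiff_mul :
    sinKernelDiff k t w * ((k - 3 / 2 + w) * (k + 1 / 2 - w)) =
      sinKernel k t w * (w + k ^ 2 - k - 1 / 2 + t ^ 2) := by
  unfold sinKernelDiff
  linear_combination -sinKernel_sub_one_mul t hleft hright

lemma sinKernelDiff_mul' :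
    sinKernelDiff k t w * ((1 / 2 - w) ^ 2 + t ^ 2) =
      -(sinKernel k t (w - 1) * (w + k ^ 2 - k - 1 / 2 + t ^ 2)) := by
  unfold sinKernelDiff
  linear_combination sinKernel_sub_one_mul t hleft hright

end FunctionalEquation

lemma norm_add_sq_sub_le {k : ℕ} (t y : ℝ) {σ : ℝ} (hlower : 0 ≤ σ + k ^ 2 - k - 1 / 2)
    (hupper : σ ≤ k + 1 / 2) :
    ‖((σ + y * Complex.I) + k ^ 2 - k - 1 / 2 + t ^ 2 : ℂ)‖ ≤ |y| + k ^ 2 + t ^ 2 := by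
  rw [show ((σ + y * Complex.I) + k ^ 2 - k - 1 / 2 + t ^ 2 : ℂ) =
    ((σ + k ^ 2 - k - 1 / 2 + t ^ 2 : ℝ) : ℂ) + y * Complex.I by push_cast; ring]
  refine (norm_add_le _ _).trans ?_
  rw [norm_mul, Complex.norm_I, mul_one, Complex.norm_of_nonneg (by positivity),
    Complex.norm_real, norm_eq_abs]
  linarith

lemma sq_add_sq_div_eight_le_norm_mul {k δ : ℝ} (hk : 2 ≤ k) (hδ : 0 ≤ δ) (hδ' : δ ≤ 1 / 4)
    (y : ℝ) : (k ^ 2 + y ^ 2) / 8 ≤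
      ‖((k - 3 / 2 + ((1 / 2 - δ : ℝ) + y * Complex.I)) *
        (k + 1 / 2 - ((1 / 2 - δ : ℝ) + y * Complex.I)) : ℂ)‖ := by
  rw [norm_mul, show (k - 3 / 2 + ((1 / 2 - δ : ℝ) + y * Complex.I) : ℂ) =
      ((k - 1 - δ : ℝ) : ℂ) + y * Complex.I by push_cast; ring,
    show (k + 1 / 2 - ((1 / 2 - δ : ℝ) + y * Complex.I) : ℂ) =
      ((k + δ : ℝ) : ℂ) + (-y : ℝ) * Complex.I by push_cast; ring,
    Complex.norm_add_mul_I, Complex.norm_add_mul_I, ← sqrt_mul (by positivity)]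
  refine le_sqrt_of_sq_le ?_
  have hfirst : (k ^ 2 + y ^ 2) / 8 ≤ (k - 1 - δ) ^ 2 + y ^ 2 := by nlinarith [sq_nonneg y]
  have hsecond : (k ^ 2 + y ^ 2) / 8 ≤ (k + δ) ^ 2 + (-y) ^ 2 := by nlinarith [sq_nonneg y]
  rw [pow_two]
  gcongr

lemma sq_add_sq_div_mul_exp_le {k : ℝ} (hk : 2 ≤ k) (t y : ℝ) :
    (k ^ 2 + t ^ 2) / (k ^ 2 + y ^ 2) * exp (-(max |y| |t| - |y|)) ≤
      20 * (1 + (y / (k + (3 + |t|))) ^ 2)⁻¹ := by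
  set s := max |y| |t| - |y| with hs
  set S := k + (3 + |t|) with hS
  have hs0 : 0 ≤ s := sub_nonneg.mpr (le_max_left _ _)
  have ht : |t| ≤ |y| + s := by rw [hs]; linarith [le_max_right |y| |t|]
  have hS0 : 0 < S := by positivity
  have hk_le : k ^ 2 + t ^ 2 ≤ S ^ 2 := by
    rw [hS, ← sq_abs t]
    nlinarith [abs_nonneg t]
  have hS_le : S ^ 2 ≤ 10 * k ^ 2 + 3 * t ^ 2 := by
    rw [hS, ← sq_abs t]
    nlinarith [sq_nonneg (k - |t|), sq_nonneg (|t| - 3), sq_nonneg (k - 3)]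
  have ht_le : t ^ 2 ≤ 2 * y ^ 2 + 2 * s ^ 2 := by
    rw [← sq_abs t, ← sq_abs y]
    nlinarith [abs_nonneg t, abs_nonneg y, sq_nonneg (|y| - s)]
  have hexp : 1 + s ^ 2 ≤ 2 * exp s := by nlinarith [one_add_sq_le_two_mul_exp hs0]
  have hSy : S ^ 2 + y ^ 2 ≤ 20 * (k ^ 2 + y ^ 2) * exp s :=
    calc S ^ 2 + y ^ 2 ≤ 10 * (k ^ 2 + y ^ 2) * (1 + s ^ 2) := by
          nlinarith [sq_nonneg y, sq_nonneg s, mul_nonneg (sq_nonneg y) (sq_nonneg s),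
            mul_nonneg (by nlinarith : (0 : ℝ) ≤ k ^ 2 - 4) (sq_nonneg s)]
      _ ≤ 10 * (k ^ 2 + y ^ 2) * (2 * exp s) := by gcongr
      _ = 20 * (k ^ 2 + y ^ 2) * exp s := by ring
  have hinv : (1 + (y / S) ^ 2)⁻¹ = S ^ 2 / (S ^ 2 + y ^ 2) := by field_simp
  rw [hinv, exp_neg, ← div_eq_mul_inv, div_div, ← mul_div_assoc,
    div_le_div_iff₀ (by positivity) (by positivity)]
  calc (k ^ 2 + t ^ 2) * (S ^ 2 + y ^ 2) ≤ S ^ 2 * (20 * (k ^ 2 + y ^ 2) * exp s) := by gcongr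
    _ = _ := by ring

lemma one_add_abs_sq_le (y : ℝ) : (1 + |y|) ^ 2 ≤ 2 * (1 + y ^ 2) := by
  rw [← sq_abs y]
  nlinarith [sq_nonneg (1 - |y|)]

lemma abs_div_sq_add_sq_mul_rpow_le {k p : ℝ} (hk : 1 ≤ k) (hp : p ≤ -(1 / 4)) (y : ℝ) :
    |y| / (k ^ 2 + y ^ 2) * (1 + |y|) ^ p ≤ 2 * (1 + |y|) ^ (-(5 / 4) : ℝ) := by
  have hy : 0 < 1 + |y| := by positivity
  have hquot : |y| / (k ^ 2 + y ^ 2) ≤ 2 * (1 + |y|) ^ (-1 : ℝ) := by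
    rw [rpow_neg_one, ← div_eq_mul_inv, div_le_div_iff₀ (by positivity) hy]
    nlinarith [one_add_abs_sq_le y, abs_nonneg y]
  calc |y| / (k ^ 2 + y ^ 2) * (1 + |y|) ^ p
      ≤ 2 * (1 + |y|) ^ (-1 : ℝ) * (1 + |y|) ^ (-(1 / 4) : ℝ) := by
        gcongr
        linarith [abs_nonneg y]
    _ = 2 * (1 + |y|) ^ (-(5 / 4) : ℝ) := by rw [mul_assoc, ← rpow_add hy]; norm_num

lemma exists_norm_sinKernel_right_le {δ : ℝ} (hδ : 0 < δ) (hδ' : δ ≤ 1 / 4) :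
    ∃ C : ℝ, 0 < C ∧ ∀ k : ℕ, 2 ≤ k → ∀ t y : ℝ,
      ‖sinKernel k t ((1 / 2 - δ : ℝ) + y * Complex.I)‖ ≤
        C * (1 + |y|) ^ (δ - 1 / 2) * exp (-(max |y| |t| - |y|)) := by
  obtain ⟨C, hC, kernel_le⟩ := exists_norm_kernel_right_le hδ hδ'
  refine ⟨C, hC, fun k hk t y => ?_⟩
  set P := (1 + |y - t|) * (1 + |y + t|)
  have hP : P ^ (δ - 1 / 2) ≤ (1 + |y|) ^ (δ - 1 / 2) :=
    rpow_le_rpow_of_nonpos (by positivity) (one_add_abs_le_one_add_abs_sub_mul y t) (by linarith)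
  rw [sinKernel, norm_mul]
  calc ‖kernel k t ((1 / 2 - δ : ℝ) + y * Complex.I)‖ *
        ‖Complex.sin (π * ((1 / 2 - δ : ℝ) + y * Complex.I))‖
      ≤ (C * P ^ (δ - 1 / 2) * exp (-(π * max |y| |t|))) * exp (π * |y|) := by
        gcongr
        exacts [kernel_le k hk t y, norm_sin_pi_mul_le _ y]
    _ = C * P ^ (δ - 1 / 2) * (exp (π * |y|) * exp (-(π * max |t| |y|))) := by
        rw [max_comm]; ring
    _ ≤ C * (1 + |y|) ^ (δ - 1 / 2) * exp (-(max |y| |t| - |y|)) := by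
        rw [max_comm |y|]
        gcongr
        exact exp_pi_mul_abs_mul_exp_neg_le t y

lemma exists_norm_sinKernelDiff_right_le {δ : ℝ} (hδ : 0 < δ) (hδ' : δ ≤ 1 / 4) :
    ∃ C : ℝ, 0 < C ∧ ∀ k : ℕ, 2 ≤ k → ∀ t y : ℝ,
      ‖sinKernelDiff k t ((1 / 2 - δ : ℝ) + y * Complex.I)‖ ≤
        C * ((1 + (y / (k + (3 + |t|))) ^ 2)⁻¹ + (1 + |y|) ^ (-(5 / 4) : ℝ)) := by
  obtain ⟨C, hC, sinKernel_le⟩ := exists_norm_sinKernel_right_le hδ hδ'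
  refine ⟨160 * C, by positivity, fun k hk t y => ?_⟩
  have hk2 : (2 : ℝ) ≤ k := by exact_mod_cast hk
  have factors_ge := sq_add_sq_div_eight_le_norm_mul hk2 hδ.le hδ' y
  set w : ℂ := (1 / 2 - δ : ℝ) + y * Complex.I with hw
  have hwre : w.re = 1 / 2 - δ := by simp [hw]
  set q := (1 + |y|) ^ (δ - 1 / 2)
  set s := max |y| |t| - |y|
  have hq : q ≤ 1 :=
    rpow_le_one_of_one_le_of_nonpos (by linarith [abs_nonneg y]) (by linarith)
  have hs : exp (-s) ≤ 1 :=
    exp_le_one_iff.mpr (neg_nonpos.mpr (sub_nonneg.mpr (le_max_left _ _)))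
  have hdiff : ‖sinKernelDiff k t w‖ * ((k ^ 2 + y ^ 2) / 8) ≤
      (C * q * exp (-s)) * (|y| + k ^ 2 + t ^ 2) :=
    calc ‖sinKernelDiff k t w‖ * ((k ^ 2 + y ^ 2) / 8)
        ≤ ‖sinKernelDiff k t w‖ * ‖((k - 3 / 2 + w) * (k + 1 / 2 - w) : ℂ)‖ := by
          gcongr
          simpa only [Complex.ofReal_natCast] using factors_ge
      _ = ‖sinKernel k t w‖ * ‖(w + k ^ 2 - k - 1 / 2 + t ^ 2 : ℂ)‖ := by
          rw [← norm_mul, ← norm_mul, sinKernelDiff_mul t (by rw [hwre]; linarith)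
            (by rw [hwre]; linarith)]
      _ ≤ (C * q * exp (-s)) * (|y| + k ^ 2 + t ^ 2) := by
          gcongr
          exacts [sinKernel_le k hk t y, norm_add_sq_sub_le t y (by nlinarith) (by linarith)]
  calc ‖sinKernelDiff k t w‖
      ≤ (C * q * exp (-s)) * (|y| + k ^ 2 + t ^ 2) / ((k ^ 2 + y ^ 2) / 8) := by
        rwa [le_div_iff₀ (by positivity)]
    _ = 8 * C * (q * ((k ^ 2 + t ^ 2) / (k ^ 2 + y ^ 2) * exp (-s)) +
          |y| / (k ^ 2 + y ^ 2) * q * exp (-s)) := by field_simp; ring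
    _ ≤ 8 * C * (1 * (20 * (1 + (y / (k + (3 + |t|))) ^ 2)⁻¹) +
          2 * (1 + |y|) ^ (-(5 / 4) : ℝ) * 1) := by
        gcongr 8 * C * (?_ * ?_ + ?_ * ?_)
        exacts [sq_add_sq_div_mul_exp_le hk2 t y,
          abs_div_sq_add_sq_mul_rpow_le (by linarith) (by linarith) y]
    _ ≤ 160 * C * ((1 + (y / (k + (3 + |t|))) ^ 2)⁻¹ + (1 + |y|) ^ (-(5 / 4) : ℝ)) := by
        have : 0 ≤ (1 + |y|) ^ (-(5 / 4) : ℝ) := by positivity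
        nlinarith [mul_nonneg hC.le this]

/-! ### Uniform bounds near the left edge `Re w = 1/2 - k` of the strip -/

/-- The quotient of `|(j + 1 + i(y - t)) (j + 1 + i(y + t))|` by `|(2j + 1 + iy) (2j + 2 + iy)|`.
By the functional equation of `Γ`, the norm of `kernel k t` near `Re w = 1/2 - k` is essentially
the product of these quotients over `j < k - 1`. -/
noncomputable def pairRatio (t y : ℝ) (j : ℕ) : ℝ :=
  √((j + 1) ^ 2 + (y - t) ^ 2) * √((j + 1) ^ 2 + (y + t) ^ 2) /
    (√((2 * j + 1) ^ 2 + y ^ 2) * √((2 * j + 2) ^ 2 + y ^ 2))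

lemma pairRatio_nonneg (t y : ℝ) (j : ℕ) : 0 ≤ pairRatio t y j := by
  unfold pairRatio
  positivity

lemma pairRatio_le_of_mul_le {t y B : ℝ} {j : ℕ} (hB : 0 ≤ B)
    (h : ((j + 1) ^ 2 + (y - t) ^ 2) * ((j + 1) ^ 2 + (y + t) ^ 2) ≤
      B ^ 2 * (((2 * j + 1) ^ 2 + y ^ 2) * ((2 * j + 2) ^ 2 + y ^ 2))) :
    pairRatio t y j ≤ B := by
  unfold pairRatio
  rw [← sqrt_mul (by positivity), ← sqrt_mul (by positivity), ← sqrt_div (by positivity)]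
  exact sqrt_le_iff.mpr ⟨hB, (div_le_iff₀ (by positivity)).mpr h⟩

lemma pairRatio_zero_le (t y : ℝ) :
    pairRatio t y 0 ≤ 1 + (3 + |t|) ^ 2 * (1 + y ^ 2)⁻¹ := by
  set T := 3 + |t| with hT
  have ht : t ^ 2 ≤ T ^ 2 := by rw [← sq_abs t, hT]; gcongr; linarith
  refine pairRatio_le_of_mul_le (by positivity) ?_
  norm_num only [CharP.cast_eq_zero, zero_add, mul_zero]
  calc (1 + (y - t) ^ 2) * (1 + (y + t) ^ 2)
      = 1 + 2 * y ^ 2 + 2 * t ^ 2 + (y ^ 2 - t ^ 2) ^ 2 := by ring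
    _ ≤ (1 + y ^ 2 + T ^ 2) ^ 2 := by
        nlinarith [sq_nonneg y, sq_nonneg t, mul_nonneg (sq_nonneg y) (sq_nonneg t),
          mul_nonneg (sq_nonneg y) (sq_nonneg T), mul_le_mul ht ht (sq_nonneg t) (sq_nonneg T)]
    _ = (1 + T ^ 2 * (1 + y ^ 2)⁻¹) ^ 2 * ((1 + y ^ 2) * (1 + y ^ 2)) := by field_simp
    _ ≤ (1 + T ^ 2 * (1 + y ^ 2)⁻¹) ^ 2 * ((1 + y ^ 2) * (4 + y ^ 2)) := by
        gcongr
        norm_num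

/-- The inequality behind `pairRatio_le_of_pos`, in the variables `A = (j + 1)²`, `Y = y²` and
`U = t²`. -/
lemma sq_add_mul_sub_le {A Y U : ℝ} (hA : 4 ≤ A) (hY : 0 ≤ Y) (hU : 0 ≤ U) :
    (A + Y) ^ 2 + 2 * U * A - 2 * U * Y + U * U ≤
      ((9 + U) / 8) ^ 2 * ((9 / 4 * A + Y) * (4 * A + Y)) := by
  have : 0 ≤ A := by linarith
  have : 0 ≤ A - 4 := by linarith
  have : 0 ≤ U * U * (A ^ 2 - 16) := mul_nonneg (by positivity) (by nlinarith)
  have : 0 ≤ U * A * (A - 4) := by positivity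
  have : 0 ≤ A * Y := by positivity
  have : 0 ≤ U * Y := by positivity
  have : 0 ≤ U * A * Y := by positivity
  have : 0 ≤ U * Y * Y := by positivity
  have : 0 ≤ U * U * A * Y := by positivity
  have : 0 ≤ U * U * Y * Y := by positivity
  nlinarith [sq_nonneg A, sq_nonneg Y]

lemma pairRatio_le_of_pos (t y : ℝ) {j : ℕ} (hj : 1 ≤ j) :
    pairRatio t y j ≤ (3 + |t|) ^ 2 / 8 := by
  refine pairRatio_le_of_mul_le (by positivity) ?_
  have hj_one : (1 : ℝ) ≤ j := by exact_mod_cast hj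
  have hT : (9 + t ^ 2) / 8 ≤ (3 + |t|) ^ 2 / 8 := by
    rw [← sq_abs t]
    nlinarith [abs_nonneg t]
  calc ((j + 1) ^ 2 + (y - t) ^ 2) * ((j + 1) ^ 2 + (y + t) ^ 2)
      = ((j + 1) ^ 2 + y ^ 2) ^ 2 + 2 * t ^ 2 * (j + 1) ^ 2 - 2 * t ^ 2 * y ^ 2 +
          t ^ 2 * t ^ 2 := by ring
    _ ≤ ((9 + t ^ 2) / 8) ^ 2 * ((9 / 4 * (j + 1) ^ 2 + y ^ 2) * (4 * (j + 1) ^ 2 + y ^ 2)) :=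
        sq_add_mul_sub_le (by nlinarith) (sq_nonneg y) (sq_nonneg t)
    _ ≤ ((3 + |t|) ^ 2 / 8) ^ 2 * (((2 * j + 1) ^ 2 + y ^ 2) * ((2 * j + 2) ^ 2 + y ^ 2)) := by
        gcongr ?_ ^ 2 * ((?_ + y ^ 2) * (?_ + y ^ 2)) <;> nlinarith

lemma prod_pairRatio_le (t y : ℝ) (n : ℕ) :
    ∏ j ∈ Finset.range (n + 1), pairRatio t y j ≤
      (1 + (3 + |t|) ^ 2 * (1 + y ^ 2)⁻¹) * ((3 + |t|) ^ 2 / 8) ^ n := by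
  induction n with
  | zero => simpa using pairRatio_zero_le t y
  | succ n ih =>
    rw [Finset.prod_range_succ, pow_succ _ n, ← mul_assoc]
    have := pairRatio_nonneg t y (n + 1)
    gcongr
    exact pairRatio_le_of_pos t y n.succ_pos

lemma gammaNorm_natCast_add_le {a : ℝ} (ha : 0 < a) (ha' : a ≤ 1) (n : ℕ) (u : ℝ) :
    gammaNorm (n + a) u ≤ (∏ j ∈ Finset.range n, √((j + 1) ^ 2 + u ^ 2)) * gammaNorm a u := by
  induction n with
  | zero => simp
  | succ n ih =>
    have hpos : 0 < n + a := by positivity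
    have := (gammaNorm_pos hpos u).le
    rw [Nat.cast_add_one, add_right_comm, gammaNorm_add_one hpos.ne', Finset.prod_range_succ]
    calc √((n + a) ^ 2 + u ^ 2) * gammaNorm (n + a) u
        ≤ √((n + 1) ^ 2 + u ^ 2) *
          ((∏ j ∈ Finset.range n, √((j + 1) ^ 2 + u ^ 2)) * gammaNorm a u) := by gcongr
      _ = _ := by ring

lemma mul_prod_le_gammaNorm_two_mul_add {a : ℝ} (ha : 0 < a) (n : ℕ) (y : ℝ) :
    gammaNorm a y * √(a ^ 2 + y ^ 2) *
      (∏ j ∈ Finset.range n, (√((2 * j + 1) ^ 2 + y ^ 2) * √((2 * j + 2) ^ 2 + y ^ 2))) ≤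
      gammaNorm (2 * n + 1 + a) y := by
  have := (gammaNorm_pos ha y).le
  induction n with
  | zero => simp [add_comm 1 a, gammaNorm_add_one ha.ne', mul_comm]
  | succ n ih =>
    rw [show 2 * ((n + 1 : ℕ) : ℝ) + 1 + a = 2 * n + 1 + a + 1 + 1 by push_cast; ring,
      gammaNorm_add_one (by positivity), gammaNorm_add_one (by positivity),
      Finset.prod_range_succ]
    have : 0 ≤ ∏ j ∈ Finset.range n,
        (√((2 * (j : ℝ) + 1) ^ 2 + y ^ 2) * √((2 * (j : ℝ) + 2) ^ 2 + y ^ 2)) :=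
      Finset.prod_nonneg fun _ _ => by positivity
    calc _ = √((2 * n + 2) ^ 2 + y ^ 2) * (√((2 * n + 1) ^ 2 + y ^ 2) *
          (gammaNorm a y * √(a ^ 2 + y ^ 2) * (∏ j ∈ Finset.range n,
            (√((2 * j + 1) ^ 2 + y ^ 2) * √((2 * j + 2) ^ 2 + y ^ 2))))) := by ring
      _ ≤ √((2 * n + 1 + a + 1) ^ 2 + y ^ 2) *
          (√((2 * n + 1 + a) ^ 2 + y ^ 2) * gammaNorm (2 * n + 1 + a) y) := by
          gcongr √(?_ ^ 2 + _) * (√(?_ ^ 2 + _) * ?_)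
          · linarith
          · linarith

lemma half_mul_one_add_abs_le_sqrt {a : ℝ} (ha : 0 ≤ a) (ha' : a ≤ 1) (y : ℝ) :
    a / 2 * (1 + |y|) ≤ √(a ^ 2 + y ^ 2) := by
  refine le_sqrt_of_sq_le ?_
  calc (a / 2 * (1 + |y|)) ^ 2 = a ^ 2 / 4 * (1 + |y|) ^ 2 := by ring
    _ ≤ a ^ 2 / 4 * (2 * (1 + y ^ 2)) := by
        gcongr
        exact one_add_abs_sq_le y
    _ ≤ a ^ 2 + y ^ 2 := by
        nlinarith [mul_nonneg (sq_nonneg y) (show 0 ≤ 1 - a ^ 2 by nlinarith), sq_nonneg a,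
          sq_nonneg y]

lemma gammaNorm_mul_prod_le {ε : ℝ} (hε : 0 < ε) (hε' : ε ≤ 1 / 2) (n : ℕ) (y : ℝ) :
    gammaNorm ε y *
      (∏ j ∈ Finset.range (n + 1),
        (√((2 * j + 1) ^ 2 + y ^ 2) * √((2 * j + 2) ^ 2 + y ^ 2))) ≤
      2 / ε * (1 + |y|)⁻¹ * (1 + (y / (2 * n + 4 - ε)) ^ 2) ^ (-(1 - 2 * ε) / 2) *
        gammaNorm (2 * n + 4 - ε) y := by
  set D := ∏ j ∈ Finset.range (n + 1),
    (√((2 * (j : ℝ) + 1) ^ 2 + y ^ 2) * √((2 * (j : ℝ) + 2) ^ 2 + y ^ 2))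
  set q := (1 + (y / (2 * n + 4 - ε)) ^ 2) ^ (-(1 - 2 * ε) / 2) with hq
  have : 0 ≤ D := Finset.prod_nonneg fun _ _ => by positivity
  have : (0 : ℝ) ≤ n := n.cast_nonneg
  have := (gammaNorm_pos hε y).le
  have := (gammaNorm_pos (show 0 < 2 * n + 4 - ε by linarith) y).le
  have gamma_quot : Real.Gamma (2 * n + 3 + ε) / Real.Gamma (2 * n + 4 - ε) ≤ 1 :=
    (div_le_one (Gamma_pos_of_pos (by linarith))).mpr <|
      Gamma_strictMonoOn_Ici.monotoneOn (by simp; linarith) (by simp; linarith) (by linarith)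
  have key : gammaNorm ε y * (ε / 2 * (1 + |y|)) * D ≤ q * gammaNorm (2 * n + 4 - ε) y :=
    calc gammaNorm ε y * (ε / 2 * (1 + |y|)) * D ≤ gammaNorm ε y * √(ε ^ 2 + y ^ 2) * D := by
          gcongr
          exact half_mul_one_add_abs_le_sqrt hε.le (by linarith) y
      _ ≤ gammaNorm (2 * (n + 1 : ℕ) + 1 + ε) y := mul_prod_le_gammaNorm_two_mul_add hε (n + 1) y
      _ = gammaNorm (2 * n + 3 + ε) y := by push_cast; ring_nf
      _ ≤ Real.Gamma (2 * n + 3 + ε) / Real.Gamma (2 * n + 4 - ε) *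
          (1 + (y / (2 * n + 4 - ε)) ^ 2) ^ (-(2 * n + 4 - ε - (2 * n + 3 + ε)) / 2) *
          gammaNorm (2 * n + 4 - ε) y :=
          gammaNorm_le_rpow_mul_gammaNorm (by positivity) (by linarith) y
      _ ≤ 1 * q * gammaNorm (2 * n + 4 - ε) y := by
          rw [show 2 * n + 4 - ε - (2 * n + 3 + ε) = 1 - 2 * ε by ring, ← hq]
          gcongr
      _ = q * gammaNorm (2 * n + 4 - ε) y := by rw [one_mul]
  calc gammaNorm ε y * D
      = 2 / ε * (1 + |y|)⁻¹ * (gammaNorm ε y * (ε / 2 * (1 + |y|)) * D) := by field_simp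
    _ ≤ 2 / ε * (1 + |y|)⁻¹ * (q * gammaNorm (2 * n + 4 - ε) y) := by gcongr
    _ = 2 / ε * (1 + |y|)⁻¹ * q * gammaNorm (2 * n + 4 - ε) y := by ring

lemma gammaNorm_sub_mul_gammaNorm_add_le_prod {a : ℝ} (ha : 0 < a) (ha' : a ≤ 1) (n : ℕ)
    (t y : ℝ) :
    gammaNorm (n + a) (y - t) * gammaNorm (n + a) (y + t) ≤
      (∏ j ∈ Finset.range n, pairRatio t y j) *
        (∏ j ∈ Finset.range n, (√((2 * j + 1) ^ 2 + y ^ 2) * √((2 * j + 2) ^ 2 + y ^ 2))) *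
        (gammaNorm a (y - t) * gammaNorm a (y + t)) := by
  have := (gammaNorm_pos ha (y - t)).le
  have := (gammaNorm_pos (show 0 < n + a by positivity) (y + t)).le
  have : 0 ≤ ∏ j ∈ Finset.range n, √(((j : ℝ) + 1) ^ 2 + (y - t) ^ 2) :=
    Finset.prod_nonneg fun _ _ => by positivity
  have prod_eq : (∏ j ∈ Finset.range n, pairRatio t y j) *
      (∏ j ∈ Finset.range n, (√((2 * j + 1) ^ 2 + y ^ 2) * √((2 * j + 2) ^ 2 + y ^ 2))) =
      (∏ j ∈ Finset.range n, √(((j : ℝ) + 1) ^ 2 + (y - t) ^ 2)) *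
        ∏ j ∈ Finset.range n, √(((j : ℝ) + 1) ^ 2 + (y + t) ^ 2) := by
    rw [← Finset.prod_mul_distrib, ← Finset.prod_mul_distrib]
    refine Finset.prod_congr rfl fun j _ => ?_
    unfold pairRatio
    field_simp
  calc gammaNorm (n + a) (y - t) * gammaNorm (n + a) (y + t)
      ≤ ((∏ j ∈ Finset.range n, √((j + 1) ^ 2 + (y - t) ^ 2)) * gammaNorm a (y - t)) *
        ((∏ j ∈ Finset.range n, √((j + 1) ^ 2 + (y + t) ^ 2)) * gammaNorm a (y + t)) := by
        gcongr ?_ * ?_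
        exacts [gammaNorm_natCast_add_le ha ha' n _, gammaNorm_natCast_add_le ha ha' n _]
    _ = _ := by rw [prod_eq]; ring

lemma exists_norm_kernel_edge_le {ε : ℝ} (hε : 0 < ε) (hε' : ε ≤ 1 / 2) :
    ∃ C : ℝ, 0 < C ∧ ∀ k : ℕ, 2 ≤ k → ∀ t y : ℝ,
      ‖kernel k t ((1 / 2 - k + ε : ℝ) + y * Complex.I)‖ ≤
        C * (1 + |y|)⁻¹ * (1 + (y / (2 * k - ε)) ^ 2) ^ (-(1 - 2 * ε) / 2) *
          ((1 + (3 + |t|) ^ 2 * (1 + y ^ 2)⁻¹) * ((3 + |t|) ^ 2 / 8) ^ (k - 2)) *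
          (((1 + |y - t|) * (1 + |y + t|)) ^ (1 / 2 - ε) * exp (-(π * max |y| |t|))) := by
  have hε1 : 0 < 1 - ε := by linarith
  obtain ⟨C, hC, product_le⟩ := exists_gammaNorm_sub_mul_gammaNorm_add_le hε1
  rw [show 1 - ε - 1 / 2 = 1 / 2 - ε by ring] at product_le
  refine ⟨2 / ε * C, by positivity, fun k hk t y => ?_⟩
  obtain ⟨n, rfl⟩ := Nat.exists_eq_add_of_le' hk
  have : (0 : ℝ) ≤ n := n.cast_nonneg
  rw [norm_kernel, Nat.add_sub_cancel]
  push_cast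
  rw [show (n + 2 - 1 / 2 + (1 / 2 - (n + 2) + ε) : ℝ) = ε by ring,
    show (n + 2 + 1 / 2 - (1 / 2 - (n + 2) + ε) : ℝ) = 2 * n + 4 - ε by ring,
    show (1 / 2 - (1 / 2 - (n + 2) + ε) : ℝ) = (n + 1 : ℕ) + (1 - ε) by push_cast; ring,
    show (2 * (n + 2) - ε : ℝ) = 2 * n + 4 - ε by ring, mul_assoc (_ / _)]
  set G := gammaNorm (1 - ε) (y - t) * gammaNorm (1 - ε) (y + t)
  set B := gammaNorm (2 * n + 4 - ε) y
  set R := ∏ j ∈ Finset.range (n + 1), pairRatio t y j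
  set D := ∏ j ∈ Finset.range (n + 1),
    (√((2 * (j : ℝ) + 1) ^ 2 + y ^ 2) * √((2 * (j : ℝ) + 2) ^ 2 + y ^ 2))
  set X := (1 + |y|)⁻¹ * (1 + (y / (2 * n + 4 - ε)) ^ 2) ^ (-(1 - 2 * ε) / 2) with hX
  have hB : 0 < B := gammaNorm_pos (by linarith) y
  have hA := gammaNorm_pos hε y
  have hG : 0 ≤ G := (mul_pos (gammaNorm_pos hε1 _) (gammaNorm_pos hε1 _)).le
  have hR : 0 ≤ R := Finset.prod_nonneg fun j _ => pairRatio_nonneg t y j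
  have hAD : gammaNorm ε y * D / B ≤ 2 / ε * X := by
    rw [div_le_iff₀ hB, hX, ← mul_assoc (2 / ε)]
    exact gammaNorm_mul_prod_le hε hε' n y
  calc gammaNorm ε y / B * (gammaNorm ((n + 1 : ℕ) + (1 - ε)) (y - t) *
        gammaNorm ((n + 1 : ℕ) + (1 - ε)) (y + t))
      ≤ gammaNorm ε y / B * (R * D * G) := by
        gcongr ?_ * ?_
        exact gammaNorm_sub_mul_gammaNorm_add_le_prod hε1 (by linarith) (n + 1) t y
    _ = gammaNorm ε y * D / B * R * G := by ring
    _ ≤ 2 / ε * X * ((1 + (3 + |t|) ^ 2 * (1 + y ^ 2)⁻¹) * ((3 + |t|) ^ 2 / 8) ^ n) *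
        (C * ((1 + |y - t|) * (1 + |y + t|)) ^ (1 / 2 - ε) * exp (-(π * max |y| |t|))) := by
        gcongr ?_ * ?_ * ?_
        exacts [prod_pairRatio_le t y n, product_le y t]
    _ = _ := by rw [hX]; ring

lemma mul_rpow_half_sub_le {ε : ℝ} (hε : 0 ≤ ε) (hε' : ε ≤ 1 / 2) (y t : ℝ) :
    ((1 + |y - t|) * (1 + |y + t|)) ^ (1 / 2 - ε) ≤
      (3 + |t|) * (1 + (max |y| |t| - |t|)) := by
  set m := max |y| |t|
  have : 0 ≤ m - |t| := sub_nonneg.mpr (le_max_right _ _)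
  have : 0 ≤ m := (abs_nonneg y).trans (le_max_left _ _)
  calc ((1 + |y - t|) * (1 + |y + t|)) ^ (1 / 2 - ε) ≤ ((1 + m) ^ 2) ^ (1 / 2 - ε) := by
        gcongr
        exact one_add_abs_sub_mul_one_add_abs_add_le y t
    _ ≤ ((1 + m) ^ 2) ^ (1 / 2 : ℝ) :=
        rpow_le_rpow_of_exponent_le (by nlinarith) (by linarith)
    _ = 1 + m := by rw [← sqrt_eq_rpow, sqrt_sq (by linarith)]
    _ ≤ (3 + |t|) * (1 + (m - |t|)) := by nlinarith [abs_nonneg t]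

lemma exp_mul_exp_neg_mul_one_add_le (y t : ℝ) :
    exp (π * |t|) * exp (-(π * max |y| |t|)) * (1 + (max |y| |t| - |t|)) ≤
      exp (-(max |y| |t| - |t|)) := by
  set s := max |y| |t| - |t| with hs
  have : 0 ≤ s := sub_nonneg.mpr (le_max_right _ _)
  calc exp (π * |t|) * exp (-(π * max |y| |t|)) * (1 + s)
      ≤ exp (π * |t|) * exp (-(π * max |y| |t|)) * exp s := by
        gcongr
        linarith [add_one_le_exp s]
    _ = exp (-(π - 1) * s) := by rw [← exp_add, ← exp_add, hs]; ring_nf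
    _ ≤ exp (-s) := by
        gcongr
        nlinarith [pi_gt_three]

lemma inv_one_add_div_sq_le {S : ℝ} (hS : 1 ≤ S) (y : ℝ) :
    (1 + (y / S) ^ 2)⁻¹ ≤ S ^ 2 * (1 + y ^ 2)⁻¹ := by
  rw [show 1 + (y / S) ^ 2 = (S ^ 2 + y ^ 2) / S ^ 2 by field_simp, inv_div, div_eq_mul_inv]
  gcongr
  nlinarith

lemma one_add_mul_exp_neg_max_sub_le (y t : ℝ) :
    (1 + (3 + |t|) ^ 2 * (1 + y ^ 2)⁻¹) * exp (-(max |y| |t| - |t|)) ≤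
      3 * (3 + |t|) ^ 2 * (1 + y ^ 2)⁻¹ := by
  have exp_le_one : exp (-(max |y| |t| - |t|)) ≤ 1 :=
    exp_le_one_iff.mpr (neg_nonpos.mpr (sub_nonneg.mpr (le_max_right _ _)))
  have exp_le : exp (-(max |y| |t| - |t|)) ≤ 2 * ((3 + |t|) ^ 2 * (1 + y ^ 2)⁻¹) :=
    (exp_neg_max_sub_le y t).trans (by
      gcongr
      exact inv_one_add_div_sq_le (by linarith [abs_nonneg t]) y)
  have := mul_le_of_le_one_right
    (show 0 ≤ (3 + |t|) ^ 2 * (1 + y ^ 2)⁻¹ by positivity) exp_le_one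
  linarith

lemma div_eight_pow_sub_two_mul_le {T : ℝ} (hT : 0 < T) {k : ℕ} (hk : 2 ≤ k) :
    (T ^ 2 / 8) ^ (k - 2) * T ^ 3 ≤ 16 * ((T ^ 2 / 4) ^ k / T) := by
  obtain ⟨n, rfl⟩ := Nat.exists_eq_add_of_le' hk
  rw [Nat.add_sub_cancel]
  calc (T ^ 2 / 8) ^ n * T ^ 3 ≤ (T ^ 2 / 4) ^ n * T ^ 3 := by
        gcongr
        norm_num
    _ = 16 * ((T ^ 2 / 4) ^ (n + 2) / T) := by rw [pow_add]; field_simp; norm_num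

lemma exists_cosh_mul_norm_kernel_edge_le {ε : ℝ} (hε : 0 < ε) (hε' : ε ≤ 1 / 2) :
    ∃ C : ℝ, 0 < C ∧ ∀ k : ℕ, 2 ≤ k → ∀ t y : ℝ,
      cosh (π * t) * ‖kernel k t ((1 / 2 - k + ε : ℝ) + y * Complex.I)‖ ≤
        C * (((3 + |t|) ^ 2 / 4) ^ k / (3 + |t|)) * (1 + y ^ 2)⁻¹ := by
  obtain ⟨C, hC, kernel_le⟩ := exists_norm_kernel_edge_le hε hε'
  refine ⟨48 * C, by positivity, fun k hk t y => ?_⟩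
  have decay_le_one : (1 + (y / (2 * k - ε)) ^ 2) ^ (-(1 - 2 * ε) / 2) ≤ 1 :=
    rpow_le_one_of_one_le_of_nonpos (by nlinarith [sq_nonneg (y / (2 * k - ε))]) (by linarith)
  have inv_le_one : (1 + |y|)⁻¹ ≤ 1 := inv_le_one_of_one_le₀ (by linarith [abs_nonneg y])
  set T := 3 + |t|
  set m := max |y| |t|
  have : 0 ≤ m - |t| := sub_nonneg.mpr (le_max_right _ _)
  calc cosh (π * t) * ‖kernel k t ((1 / 2 - k + ε : ℝ) + y * Complex.I)‖
      ≤ exp (π * |t|) * (C * 1 * 1 * ((1 + T ^ 2 * (1 + y ^ 2)⁻¹) * (T ^ 2 / 8) ^ (k - 2)) *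
        (T * (1 + (m - |t|)) * exp (-(π * m)))) := by
        gcongr
        · exact cosh_pi_mul_le t
        · refine (kernel_le k hk t y).trans ?_
          gcongr
          exact mul_rpow_half_sub_le hε.le hε' y t
    _ = C * (T ^ 2 / 8) ^ (k - 2) * T * ((1 + T ^ 2 * (1 + y ^ 2)⁻¹) *
        (exp (π * |t|) * exp (-(π * m)) * (1 + (m - |t|)))) := by ring
    _ ≤ C * (T ^ 2 / 8) ^ (k - 2) * T *
        ((1 + T ^ 2 * (1 + y ^ 2)⁻¹) * exp (-(m - |t|))) := by
        gcongr _ * (_ * ?_)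
        exact exp_mul_exp_neg_mul_one_add_le y t
    _ ≤ C * (T ^ 2 / 8) ^ (k - 2) * T * (3 * T ^ 2 * (1 + y ^ 2)⁻¹) := by
        gcongr _ * ?_
        exact one_add_mul_exp_neg_max_sub_le y t
    _ = 3 * C * (1 + y ^ 2)⁻¹ * ((T ^ 2 / 8) ^ (k - 2) * T ^ 3) := by ring
    _ ≤ 3 * C * (1 + y ^ 2)⁻¹ * (16 * ((T ^ 2 / 4) ^ k / T)) := by
        gcongr _ * ?_
        exact div_eight_pow_sub_two_mul_le (by positivity) hk
    _ = 48 * C * ((T ^ 2 / 4) ^ k / T) * (1 + y ^ 2)⁻¹ := by ring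

lemma exists_pow_mul_half_pow_le (p : ℕ) :
    ∃ M : ℝ, 0 < M ∧ ∀ n : ℕ, (n : ℝ) ^ p * (1 / 2) ^ n ≤ M := by
  obtain ⟨M, hM⟩ := (tendsto_pow_const_mul_const_pow_of_abs_lt_one p (r := (1 / 2 : ℝ))
    (by rw [abs_of_pos] <;> norm_num)).bddAbove_range
  refine ⟨max M 1, by positivity, fun n => le_max_of_le_left (hM ⟨n, rfl⟩)⟩

lemma one_add_mul_exp_neg_pi_mul_le (t y : ℝ) :
    (1 + (3 + |t|) ^ 2 * (1 + y ^ 2)⁻¹) * exp (-(π * (max |y| |t| - |y|))) ≤ 37 := by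
  set s := max |y| |t| - |y| with hs
  have hs0 : 0 ≤ s := sub_nonneg.mpr (le_max_left _ _)
  have ht : |t| ≤ |y| + s := by rw [hs]; linarith [le_max_right |y| |t|]
  have hT : 3 + |t| ≤ 3 * (1 + |y|) * (1 + s) := by
    nlinarith [abs_nonneg y, mul_nonneg (abs_nonneg y) hs0]
  have hT_sq : (3 + |t|) ^ 2 ≤ 36 * exp s * (1 + y ^ 2) :=
    calc (3 + |t|) ^ 2 ≤ (3 * (1 + |y|) * (1 + s)) ^ 2 := by gcongr
      _ = 9 * (1 + |y|) ^ 2 * (1 + s) ^ 2 := by ring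
      _ ≤ 9 * (2 * (1 + y ^ 2)) * (2 * exp s) := by
          gcongr
          exacts [one_add_abs_sq_le y, one_add_sq_le_two_mul_exp hs0]
      _ = 36 * exp s * (1 + y ^ 2) := by ring
  have hquot : (3 + |t|) ^ 2 * (1 + y ^ 2)⁻¹ ≤ 36 * exp s := by
    rwa [← div_eq_mul_inv, div_le_iff₀ (by positivity)]
  calc (1 + (3 + |t|) ^ 2 * (1 + y ^ 2)⁻¹) * exp (-(π * s)) ≤ 37 * exp s * exp (-s) := by
        gcongr
        · linarith [one_le_exp hs0]
        · nlinarith [pi_gt_three]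
    _ = 37 := by rw [mul_assoc, ← exp_add]; simp

lemma abs_add_sq_add_sq_le {k : ℝ} (hk : 2 ≤ k) (t y : ℝ) :
    |y| + k ^ 2 + t ^ 2 ≤ k ^ 2 * (3 + |t|) ^ 2 * (1 + |y|) := by
  have hT : t ^ 2 + 9 ≤ (3 + |t|) ^ 2 := by rw [← sq_abs t]; nlinarith [abs_nonneg t]
  have hk4 : 4 ≤ k ^ 2 := by nlinarith
  have hkT : 36 ≤ k ^ 2 * (3 + |t|) ^ 2 := by nlinarith [sq_nonneg t]
  have hadd : k ^ 2 + t ^ 2 ≤ k ^ 2 * (3 + |t|) ^ 2 := by nlinarith [sq_nonneg t]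
  nlinarith [abs_nonneg y]

lemma cube_mul_div_eight_pow_sub_two_le {M T : ℝ} {k : ℕ} (hk : 2 ≤ k)
    (hM : (k : ℝ) ^ 3 * (1 / 2) ^ k ≤ M) (hT : 1 ≤ T) :
    (k : ℝ) ^ 3 * (T ^ 2 / 8) ^ (k - 2) * T ^ 2 ≤ 64 * M * ((T ^ 2 / 4) ^ k / T) := by
  have hpow : (T ^ 2 / 8) ^ (k - 2) * T ^ 2 = 64 * (1 / 2) ^ k * ((T ^ 2 / 4) ^ k / T ^ 2) := by
    obtain ⟨n, rfl⟩ := Nat.exists_eq_add_of_le' hk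
    rw [Nat.add_sub_cancel, show T ^ 2 / 8 = 1 / 2 * (T ^ 2 / 4) by ring, mul_pow, pow_add,
      pow_add]
    field_simp
    norm_num
  have : 0 ≤ M := le_trans (by positivity) hM
  calc (k : ℝ) ^ 3 * (T ^ 2 / 8) ^ (k - 2) * T ^ 2
      = 64 * ((k : ℝ) ^ 3 * (1 / 2) ^ k) * ((T ^ 2 / 4) ^ k / T ^ 2) := by
        rw [mul_assoc, hpow]
        ring
    _ ≤ 64 * M * ((T ^ 2 / 4) ^ k / T) := by
        gcongr
        nlinarith

lemma one_add_div_sq_rpow_edge_le {k ε : ℝ} (hk : 2 ≤ k) (hε : 0 ≤ ε) (hε' : ε ≤ 1 / 8) (y : ℝ) :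
    (1 + (y / (2 * k - ε)) ^ 2) ^ (-(1 - 2 * ε) / 2) ≤ 5 * k * (1 + |y|) ^ (-(3 / 4) : ℝ) := by
  have : 0 < 1 + (2 * k - ε) := by linarith
  calc (1 + (y / (2 * k - ε)) ^ 2) ^ (-(1 - 2 * ε) / 2)
      ≤ (2 * (1 + (2 * k - ε))) ^ (1 - 2 * ε) * (1 + |y|) ^ (-(1 - 2 * ε)) :=
        one_add_div_sq_rpow_le (by linarith) (by linarith) y
    _ ≤ (2 * (1 + (2 * k - ε))) ^ (1 : ℝ) * (1 + |y|) ^ (-(3 / 4) : ℝ) := by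
        gcongr
        all_goals linarith [abs_nonneg y]
    _ ≤ 5 * k * (1 + |y|) ^ (-(3 / 4) : ℝ) := by
        rw [rpow_one]
        gcongr ?_ * _
        linarith

lemma exists_norm_sinKernel_edge_le {ε : ℝ} (hε : 0 < ε) (hε' : ε ≤ 1 / 8) :
    ∃ C : ℝ, 0 < C ∧ ∀ k : ℕ, 2 ≤ k → ∀ t y : ℝ,
      ‖sinKernel k t ((1 / 2 - k + ε : ℝ) + y * Complex.I)‖ ≤
        C * k * ((3 + |t|) ^ 2 / 8) ^ (k - 2) * (1 + |y|) ^ (-(7 / 4) : ℝ) *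
          ((1 + |y - t|) * (1 + |y + t|)) ^ (1 / 2 : ℝ) := by
  obtain ⟨C, hC, kernel_le⟩ := exists_norm_kernel_edge_le hε (by linarith)
  refine ⟨185 * C, by positivity, fun k hk t y => ?_⟩
  set T := 3 + |t|
  set P := (1 + |y - t|) * (1 + |y + t|)
  set q := (1 + (y / (2 * k - ε)) ^ 2) ^ (-(1 - 2 * ε) / 2)
  have hP : 1 ≤ P := by linarith [one_add_abs_le_one_add_abs_sub_mul y t, abs_nonneg y]
  rw [sinKernel, norm_mul]
  calc _ ≤ (C * (1 + |y|)⁻¹ * q * ((1 + T ^ 2 * (1 + y ^ 2)⁻¹) * (T ^ 2 / 8) ^ (k - 2)) *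
        (P ^ (1 / 2 - ε) * exp (-(π * max |y| |t|)))) * exp (π * |y|) := by
        gcongr ?_ * ?_
        exacts [kernel_le k hk t y, norm_sin_pi_mul_le _ y]
    _ = C * (1 + |y|)⁻¹ * q * (((1 + T ^ 2 * (1 + y ^ 2)⁻¹) *
        exp (-(π * (max |y| |t| - |y|)))) * (T ^ 2 / 8) ^ (k - 2)) * P ^ (1 / 2 - ε) := by
        rw [show -(π * (max |y| |t| - |y|)) = -(π * max |y| |t|) + π * |y| by ring, exp_add]
        ring
    _ ≤ C * (1 + |y|)⁻¹ * (5 * k * (1 + |y|) ^ (-(3 / 4) : ℝ)) *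
        (37 * (T ^ 2 / 8) ^ (k - 2)) * P ^ (1 / 2 : ℝ) := by
        gcongr _ * ?_ * (?_ * _) * P ^ ?_
        · exact one_add_div_sq_rpow_edge_le (by exact_mod_cast hk) hε.le hε' y
        · exact one_add_mul_exp_neg_pi_mul_le t y
        · linarith
    _ = 185 * C * k * (T ^ 2 / 8) ^ (k - 2) * ((1 + |y|) ^ (-1 : ℝ) *
        (1 + |y|) ^ (-(3 / 4) : ℝ)) * P ^ (1 / 2 : ℝ) := by
        rw [rpow_neg_one]
        ring
    _ = 185 * C * k * (T ^ 2 / 8) ^ (k - 2) * (1 + |y|) ^ (-(7 / 4) : ℝ) * P ^ (1 / 2 : ℝ) := by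
        rw [← rpow_add (by positivity)]
        norm_num

lemma one_add_abs_div_two_le_sqrt {a : ℝ} (ha : 3 / 4 ≤ a) (u : ℝ) :
    (1 + |u|) / 2 ≤ √(a ^ 2 + u ^ 2) := by
  refine le_sqrt_of_sq_le ?_
  nlinarith [one_add_abs_sq_le u]

lemma mul_div_four_le_norm_half_sub_sq_add_sq {σ : ℝ} (hσ : σ ≤ -(1 / 4)) (y t : ℝ) :
    (1 + |y - t|) * (1 + |y + t|) / 4 ≤ ‖((1 / 2 - (σ + y * Complex.I)) ^ 2 + t ^ 2 : ℂ)‖ := by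
  have factorization : ((1 / 2 - (σ + y * Complex.I)) ^ 2 + t ^ 2 : ℂ) =
      (((1 / 2 - σ : ℝ) : ℂ) + (-(y - t) : ℝ) * Complex.I) *
        (((1 / 2 - σ : ℝ) : ℂ) + (-(y + t) : ℝ) * Complex.I) := by
    push_cast
    linear_combination (t : ℂ) ^ 2 * Complex.I_sq
  rw [factorization, norm_mul, Complex.norm_add_mul_I, Complex.norm_add_mul_I, neg_sq, neg_sq]
  calc (1 + |y - t|) * (1 + |y + t|) / 4 = (1 + |y - t|) / 2 * ((1 + |y + t|) / 2) := by ring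
    _ ≤ √((1 / 2 - σ) ^ 2 + (y - t) ^ 2) * √((1 / 2 - σ) ^ 2 + (y + t) ^ 2) := by
        gcongr ?_ * ?_
        all_goals exact one_add_abs_div_two_le_sqrt (by linarith) _

lemma sqrt_div_quarter_le (y t : ℝ) :
    ((1 + |y - t|) * (1 + |y + t|)) ^ (1 / 2 : ℝ) / ((1 + |y - t|) * (1 + |y + t|) / 4) ≤
      4 * (1 + |y|) ^ (-(1 / 2) : ℝ) := by
  have P_ge := one_add_abs_le_one_add_abs_sub_mul y t
  have hP : 0 < (1 + |y - t|) * (1 + |y + t|) := by positivity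
  generalize (1 + |y - t|) * (1 + |y + t|) = P at P_ge hP
  calc _ = 4 * P ^ (-(1 / 2) : ℝ) := by
        rw [show (-(1 / 2) : ℝ) = 1 / 2 - 1 by norm_num, rpow_sub_one hP.ne']
        ring
    _ ≤ 4 * (1 + |y|) ^ (-(1 / 2) : ℝ) := by
        gcongr 4 * ?_
        exact rpow_le_rpow_of_nonpos (by positivity) P_ge (by norm_num)

lemma exists_norm_sinKernelDiff_edge_le {ε : ℝ} (hε : 0 < ε) (hε' : ε ≤ 1 / 8) :
    ∃ C : ℝ, 0 < C ∧ ∀ k : ℕ, 2 ≤ k → ∀ t y : ℝ,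
      ‖sinKernelDiff k t ((3 / 2 - k + ε : ℝ) + y * Complex.I)‖ ≤
        C * (((3 + |t|) ^ 2 / 4) ^ k / (3 + |t|)) * (1 + |y|) ^ (-(5 / 4) : ℝ) := by
  obtain ⟨C, hC, sinKernel_le⟩ := exists_norm_sinKernel_edge_le hε hε'
  obtain ⟨M, hM, pow_le⟩ := exists_pow_mul_half_pow_le 3
  refine ⟨256 * C * M, by positivity, fun k hk t y => ?_⟩
  have hk2 : (2 : ℝ) ≤ k := by exact_mod_cast hk
  have denominator_ge :=
    mul_div_four_le_norm_half_sub_sq_add_sq (show 3 / 2 - k + ε ≤ -(1 / 4) by linarith) y t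
  have numerator_le := (norm_add_sq_sub_le (k := k) t y (σ := 3 / 2 - k + ε) (by nlinarith)
    (by linarith)).trans (abs_add_sq_add_sq_le hk2 t y)
  set w : ℂ := (3 / 2 - k + ε : ℝ) + y * Complex.I with hw
  have hwre : w.re = 3 / 2 - k + ε := by simp [hw]
  have hw1 : w - 1 = (1 / 2 - k + ε : ℝ) + y * Complex.I := by rw [hw]; push_cast; ring
  have relation := congrArg norm (sinKernelDiff_mul' (k := k) t (w := w)
    (by rw [hwre]; linarith) (by rw [hwre]; linarith))
  rw [norm_mul, norm_neg, norm_mul (sinKernel k t (w - 1)), hw1] at relation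
  set T := 3 + |t|
  set P := (1 + |y - t|) * (1 + |y + t|)
  have decay : (1 + |y|) ^ (-(7 / 4) : ℝ) * (1 + |y|) * (1 + |y|) ^ (-(1 / 2) : ℝ) =
      (1 + |y|) ^ (-(5 / 4) : ℝ) := by
    rw [← rpow_add_one (by positivity), ← rpow_add (by positivity)]
    norm_num
  calc ‖sinKernelDiff k t w‖
      ≤ (C * k * (T ^ 2 / 8) ^ (k - 2) * (1 + |y|) ^ (-(7 / 4) : ℝ) * P ^ (1 / 2 : ℝ)) *
        (k ^ 2 * T ^ 2 * (1 + |y|)) / (P / 4) := by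
        rw [le_div_iff₀ (by positivity)]
        refine (mul_le_mul_of_nonneg_left denominator_ge (norm_nonneg _)).trans ?_
        rw [relation]
        gcongr ?_ * ?_
        exact sinKernel_le k hk t y
    _ = C * (k ^ 3 * (T ^ 2 / 8) ^ (k - 2) * T ^ 2) *
        ((1 + |y|) ^ (-(7 / 4) : ℝ) * (1 + |y|)) * (P ^ (1 / 2 : ℝ) / (P / 4)) := by ring
    _ ≤ C * (64 * M * ((T ^ 2 / 4) ^ k / T)) *
        ((1 + |y|) ^ (-(7 / 4) : ℝ) * (1 + |y|)) * (4 * (1 + |y|) ^ (-(1 / 2) : ℝ)) := by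
        gcongr _ * ?_ * _ * ?_
        · exact cube_mul_div_eight_pow_sub_two_le hk (pow_le k) (by linarith [abs_nonneg t])
        · exact sqrt_div_quarter_le y t
    _ = 256 * C * M * ((T ^ 2 / 4) ^ k / T) * ((1 + |y|) ^ (-(7 / 4) : ℝ) * (1 + |y|) *
        (1 + |y|) ^ (-(1 / 2) : ℝ)) := by ring
    _ = 256 * C * M * ((T ^ 2 / 4) ^ k / T) * (1 + |y|) ^ (-(5 / 4) : ℝ) := by rw [decay]

/-! ### Bounds for `I₁` and `I₂` -/

lemma integral_inv_one_add_div_sq {S : ℝ} (hS : 0 < S) :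
    ∫ y : ℝ, (1 + (y / S) ^ 2)⁻¹ = S * π := by
  rw [Measure.integral_comp_div (fun y : ℝ => (1 + y ^ 2)⁻¹), integral_univ_inv_one_add_sq,
    abs_of_pos hS, smul_eq_mul]

lemma integrable_one_add_abs_rpow : Integrable fun y : ℝ => (1 + |y|) ^ (-(5 / 4) : ℝ) := by
  simpa only [norm_eq_abs] using
    integrable_one_add_norm (E := ℝ) (μ := volume) (r := 5 / 4) (by norm_num)

lemma cosh_mul_norm_I₂_le {k : ℕ} (hk : 2 ≤ k) (t : ℝ) {x : ℝ} (hx : 0 < x) {σ : ℝ}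
    (hσ : σ ∈ Set.Ioo (1 / 2 - (k : ℝ)) (1 / 2)) {g : ℝ → ℝ} (hg : Integrable g)
    (hb : ∀ y : ℝ, cosh (π * t) * ‖kernel k t (σ + y * Complex.I)‖ ≤ g y) :
    cosh (π * t) * ‖I₂ k 0 (t * Complex.I) x‖ ≤ x ^ σ * ∫ y, g y := by
  have norm_le := norm_I₂_le hk t hx hσ (hg.div_const (cosh (π * t)))
    fun y => (le_div_iff₀' (cosh_pos _)).mpr (hb y)
  rwa [integral_div, ← mul_div_assoc, le_div_iff₀' (cosh_pos _)] at norm_le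

theorem exists_cosh_mul_norm_I₂_right_le {δ : ℝ} (hδ : 0 < δ) (hδ' : δ ≤ 1 / 4) :
    ∃ C : ℝ, 0 < C ∧ ∀ k : ℕ, 2 ≤ k → ∀ t x : ℝ, 0 < x →
      cosh (π * t) * ‖I₂ k 0 (t * Complex.I) x‖ ≤ C * x ^ (1 / 2 - δ) * (3 + |t|) := by
  obtain ⟨C, hC, kernel_le⟩ := exists_cosh_mul_norm_kernel_right_le hδ hδ'
  refine ⟨C * π, by positivity, fun k hk t x hx => ?_⟩
  have hk2 : (2 : ℝ) ≤ k := by exact_mod_cast hk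
  have hT : 0 < 3 + |t| := by positivity
  have I₂_le := cosh_mul_norm_I₂_le hk t hx (σ := 1 / 2 - δ) ⟨by linarith, by linarith⟩
    ((integrable_inv_one_add_sq.comp_div hT.ne').const_mul C) (kernel_le k hk t)
  rw [integral_const_mul, integral_inv_one_add_div_sq hT] at I₂_le
  linarith

theorem exists_cosh_mul_norm_I₂_left_le {δ : ℝ} (hδ : 0 < δ) (hδ' : δ ≤ 1 / 4) :
    ∃ C : ℝ, 0 < C ∧ ∀ k : ℕ, 2 ≤ k → ∀ t x : ℝ, 0 < x →
      cosh (π * t) * ‖I₂ k 0 (t * Complex.I) x‖ ≤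
        C * x ^ (-1 / 2 - δ) * (3 + |t|) ^ (1 + 2 * δ) := by
  obtain ⟨C, hC, kernel_le⟩ := exists_cosh_mul_norm_kernel_left_le hδ hδ'
  refine ⟨C * π, by positivity, fun k hk t x hx => ?_⟩
  have hk2 : (2 : ℝ) ≤ k := by exact_mod_cast hk
  have I₂_le := cosh_mul_norm_I₂_le hk t hx (σ := -1 / 2 - δ) ⟨by linarith, by linarith⟩
    (integrable_inv_one_add_sq.const_mul _) (kernel_le k hk t)
  rw [integral_const_mul, integral_univ_inv_one_add_sq] at I₂_le
  linarith

theorem exists_cosh_mul_norm_I₂_edge_le {ε : ℝ} (hε : 0 < ε) (hε' : ε ≤ 1 / 2) :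
    ∃ C : ℝ, 0 < C ∧ ∀ k : ℕ, 2 ≤ k → ∀ t x : ℝ, 0 < x →
      cosh (π * t) * ‖I₂ k 0 (t * Complex.I) x‖ ≤
        C * x ^ (1 / 2 - k + ε) * (((3 + |t|) ^ 2 / 4) ^ k / (3 + |t|)) := by
  obtain ⟨C, hC, kernel_le⟩ := exists_cosh_mul_norm_kernel_edge_le hε hε'
  refine ⟨C * π, by positivity, fun k hk t x hx => ?_⟩
  have hk2 : (2 : ℝ) ≤ k := by exact_mod_cast hk
  have I₂_le := cosh_mul_norm_I₂_le hk t hx (σ := 1 / 2 - k + ε) ⟨by linarith, by linarith⟩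
    (integrable_inv_one_add_sq.const_mul _) (kernel_le k hk t)
  rw [integral_const_mul, integral_univ_inv_one_add_sq] at I₂_le
  linarith

theorem exists_abs_one_sub_mul_norm_I₁_right_le {δ : ℝ} (hδ : 0 < δ) (hδ' : δ ≤ 1 / 4) :
    ∃ C : ℝ, 0 < C ∧ ∀ k : ℕ, 2 ≤ k → ∀ t x : ℝ, 0 < x →
      |1 - x| * ‖I₁ k 0 (t * Complex.I) x‖ ≤ C * x ^ (1 / 2 - δ) * (k + (3 + |t|)) := by
  obtain ⟨C, hC, kernel_le⟩ := exists_norm_sinKernelDiff_right_le hδ hδ'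
  set J := ∫ y : ℝ, (1 + |y|) ^ (-(5 / 4) : ℝ)
  have hJ0 : 0 ≤ J := integral_nonneg fun y => by positivity
  refine ⟨C * (π + J), by positivity, fun k hk t x hx => ?_⟩
  have hk2 : (2 : ℝ) ≤ k := by exact_mod_cast hk
  set S := (k : ℝ) + (3 + |t|)
  have hS : 1 ≤ S := by linarith [abs_nonneg t]
  have inv_integrable := integrable_inv_one_add_sq.comp_div (R := S) (by positivity)
  calc |1 - x| * ‖I₁ k 0 (t * Complex.I) x‖
      ≤ x ^ (1 / 2 - δ) *
          ∫ y, C * ((1 + (y / S) ^ 2)⁻¹ + (1 + |y|) ^ (-(5 / 4) : ℝ)) :=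
        abs_one_sub_mul_norm_I₁_le hk t hx ⟨by linarith, by linarith⟩
          ((inv_integrable.add integrable_one_add_abs_rpow).const_mul C) (kernel_le k hk t)
    _ = C * x ^ (1 / 2 - δ) * (π * S + J) := by
        rw [integral_const_mul, integral_add inv_integrable integrable_one_add_abs_rpow,
          integral_inv_one_add_div_sq (by positivity)]
        ring
    _ ≤ C * x ^ (1 / 2 - δ) * (π * S + J * S) := by
        gcongr
        exact le_mul_of_one_le_right hJ0 hS
    _ = C * (π + J) * x ^ (1 / 2 - δ) * S := by ring

theorem exists_abs_one_sub_mul_norm_I₁_edge_le {ε : ℝ} (hε : 0 < ε) (hε' : ε ≤ 1 / 8) :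
    ∃ C : ℝ, 0 < C ∧ ∀ k : ℕ, 2 ≤ k → ∀ t x : ℝ, 0 < x →
      |1 - x| * ‖I₁ k 0 (t * Complex.I) x‖ ≤
        C * x ^ (3 / 2 - k + ε) * (((3 + |t|) ^ 2 / 4) ^ k / (3 + |t|)) := by
  obtain ⟨C, hC, kernel_le⟩ := exists_norm_sinKernelDiff_edge_le hε hε'
  set J := ∫ y : ℝ, (1 + |y|) ^ (-(5 / 4) : ℝ)
  have : 0 ≤ J := integral_nonneg fun y => by positivity
  refine ⟨C * (1 + J), by positivity, fun k hk t x hx => ?_⟩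
  have hk2 : (2 : ℝ) ≤ k := by exact_mod_cast hk
  have I₁_le := abs_one_sub_mul_norm_I₁_le hk t hx (σ := 3 / 2 - k + ε)
    ⟨by linarith, by linarith⟩ (integrable_one_add_abs_rpow.const_mul _) (kernel_le k hk t)
  rw [integral_const_mul] at I₁_le
  calc |1 - x| * ‖I₁ k 0 (t * Complex.I) x‖
      ≤ C * J * x ^ (3 / 2 - k + ε) * (((3 + |t|) ^ 2 / 4) ^ k / (3 + |t|)) := by linarith
    _ ≤ C * (1 + J) * x ^ (3 / 2 - k + ε) * (((3 + |t|) ^ 2 / 4) ^ k / (3 + |t|)) := by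
        gcongr
        linarith

lemma exists_norm_I₁_edge_le_of_two_le {ε : ℝ} (hε : 0 < ε) (hε' : ε ≤ 1 / 8) :
    ∃ C : ℝ, 0 < C ∧ ∀ k : ℕ, 2 ≤ k → ∀ t x : ℝ, 2 ≤ x →
      ‖I₁ k 0 (t * Complex.I) x‖ ≤
        C * x ^ (1 / 2 - k + ε) * (((3 + |t|) ^ 2 / 4) ^ k / (3 + |t|)) := by
  obtain ⟨C, hC, I₁_le⟩ := exists_abs_one_sub_mul_norm_I₁_edge_le hε hε'
  refine ⟨2 * C, by positivity, fun k hk t x hx => ?_⟩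
  have hx0 : 0 < x := by linarith
  have x_mul_le : x * ‖I₁ k 0 (t * Complex.I) x‖ ≤
      2 * (|1 - x| * ‖I₁ k 0 (t * Complex.I) x‖) := by
    rw [abs_sub_comm, abs_of_nonneg (by linarith)]
    nlinarith [norm_nonneg (I₁ k 0 (t * Complex.I) x)]
  refine le_of_mul_le_mul_left (x_mul_le.trans ?_) hx0
  calc _ ≤ 2 * (C * x ^ (3 / 2 - k + ε) * (((3 + |t|) ^ 2 / 4) ^ k / (3 + |t|))) := by
        gcongr 2 * ?_
        exact I₁_le k hk t x hx0
    _ = x * (2 * C * x ^ (1 / 2 - k + ε) * (((3 + |t|) ^ 2 / 4) ^ k / (3 + |t|))) := by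
        rw [show (3 / 2 - k + ε : ℝ) = (1 / 2 - k + ε) + 1 by ring, rpow_add_one hx0.ne']
        ring

/-! ### The divisor bound -/

lemma add_one_le_mul_two_pow_rpow {ε : ℝ} (hε : 0 < ε) (a : ℕ) :
    (a : ℝ) + 1 ≤ (1 + (ε * log 2)⁻¹) * ((2 : ℝ) ^ a) ^ ε := by
  have hlog : 0 < ε * log 2 := mul_pos hε (log_pos one_lt_two)
  have pow_eq : ((2 : ℝ) ^ a) ^ ε = exp (a * (ε * log 2)) := by
    rw [← rpow_natCast, ← rpow_mul two_pos.le, rpow_def_of_pos two_pos]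
    ring_nf
  have a_le : (a : ℝ) ≤ (ε * log 2)⁻¹ * exp (a * (ε * log 2)) := by
    rw [← div_eq_inv_mul, le_div_iff₀ hlog]
    linarith [add_one_le_exp (a * (ε * log 2))]
  rw [pow_eq]
  linarith [one_le_exp (x := a * (ε * log 2)) (by positivity)]

lemma add_one_le_pow_rpow {ε p : ℝ} (hp : 0 ≤ p) (hpε : 2 ≤ p ^ ε) (a : ℕ) :
    (a : ℝ) + 1 ≤ (p ^ a) ^ ε :=
  calc (a : ℝ) + 1 ≤ 2 ^ a := by exact_mod_cast Nat.lt_two_pow_self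
    _ ≤ (p ^ ε) ^ a := by gcongr
    _ = (p ^ a) ^ ε := by
        rw [← rpow_natCast, ← rpow_natCast, ← rpow_mul hp, ← rpow_mul hp, mul_comm]

lemma exists_card_divisors_le {ε : ℝ} (hε : 0 < ε) :
    ∃ C : ℝ, 0 < C ∧ ∀ n : ℕ, n ≠ 0 → (n.divisors.card : ℝ) ≤ C * (n : ℝ) ^ ε := by
  set M : ℝ := 1 + (ε * log 2)⁻¹
  have hM : 1 ≤ M := le_add_of_nonneg_right (by positivity)
  set P : ℕ := ⌈(2 : ℝ) ^ (1 / ε)⌉₊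
  have two_le_rpow {p : ℕ} (hp : P ≤ p) : 2 ≤ (p : ℝ) ^ ε :=
    calc (2 : ℝ) = ((2 : ℝ) ^ (1 / ε)) ^ ε := by
          rw [← rpow_mul two_pos.le, one_div_mul_cancel hε.ne', rpow_one]
      _ ≤ (p : ℝ) ^ ε := by
          gcongr
          exact Nat.ceil_le.mp hp
  have factor_le {p : ℕ} (hp : p.Prime) (a : ℕ) :
      (a : ℝ) + 1 ≤ (if p < P then M else 1) * ((p : ℝ) ^ a) ^ ε := by
    split_ifs with hpP
    · refine (add_one_le_mul_two_pow_rpow hε a).trans ?_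
      gcongr
      exact_mod_cast hp.two_le
    · rw [one_mul]
      exact add_one_le_pow_rpow p.cast_nonneg (two_le_rpow (not_lt.mp hpP)) a
  refine ⟨M ^ P, by positivity, fun n hn => ?_⟩
  calc (n.divisors.card : ℝ) = ∏ p ∈ n.primeFactors, ((n.factorization p : ℝ) + 1) := by
        rw [Nat.card_divisors hn]
        push_cast
        rfl
    _ ≤ ∏ p ∈ n.primeFactors, ((if p < P then M else 1) * ((p : ℝ) ^ n.factorization p) ^ ε) :=
        Finset.prod_le_prod (fun _ _ => by positivity) fun p hp =>
          factor_le (Nat.prime_of_mem_primeFactors hp) _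
    _ = M ^ (n.primeFactors.filter (· < P)).card * (n : ℝ) ^ ε := by
        rw [Finset.prod_mul_distrib, finsetProd_rpow _ _ (fun _ _ => by positivity),
          Finset.prod_ite, Finset.prod_const, Finset.prod_const_one, mul_one]
        congr 2
        exact_mod_cast Nat.prod_factorization_pow_eq_self hn
    _ ≤ M ^ P * (n : ℝ) ^ ε := by
        gcongr
        calc (n.primeFactors.filter (· < P)).card ≤ (Finset.range P).card :=
              Finset.card_le_card fun p hp => by simpa using (Finset.mem_filter.mp hp).2
          _ = P := Finset.card_range P

lemma norm_tau_le (t : ℝ) (n : ℕ) : ‖tau (t * Complex.I) n‖ ≤ n.divisors.card :=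
  calc ‖tau (t * Complex.I) n‖ ≤ ∑ _ ∈ n.divisorsAntidiagonal, (1 : ℝ) := by
        refine norm_sum_le_of_le _ ?_
        rintro ⟨a, b⟩ hab
        obtain ⟨rfl, hn⟩ := Nat.mem_divisorsAntidiagonal.mp hab
        obtain ⟨ha, hb⟩ := mul_ne_zero_iff.mp hn
        rw [show ((a : ℂ) / b) = ((a / b : ℝ) : ℂ) by push_cast; rfl,
          Complex.norm_cpow_eq_rpow_re_of_pos (by positivity)]
        simp
    _ = n.divisors.card := by
        rw [Finset.sum_const, nsmul_one, ← Nat.map_div_right_divisors, Finset.card_map]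

/-! ### The terms of the three sums -/

lemma norm_hypH_neg (k : ℕ) (v : ℂ) {x : ℝ} (hx : 0 < x) :
    ‖hypH k 0 v (-x⁻¹)‖ = 1 / 2 * x ^ ((k : ℝ) - 1 / 2) * ‖I₂ k 0 v x‖ := by
  rw [hypH, if_neg (by simpa using hx.le), neg_neg, show -1 / -x⁻¹ = x by field_simp, norm_mul,
    norm_mul, Complex.norm_cpow_eq_rpow_re_of_pos (inv_pos.mpr hx), inv_rpow hx.le,
    ← rpow_neg hx.le]
  simp

lemma norm_hypH_pos (k : ℕ) (v : ℂ) {x : ℝ} (hx : 0 < x) :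
    ‖hypH k 0 v x⁻¹‖ = 1 / 2 * x ^ ((k : ℝ) - 1 / 2) * ‖I₁ k 0 v x‖ := by
  have norm_cos : ‖Complex.cos (π * ((k : ℂ) - 0))‖ = 1 := by
    rw [sub_zero, show (π * k : ℂ) = ((k * π : ℝ) : ℂ) by push_cast; ring, ← Complex.ofReal_cos,
      cos_nat_mul_pi]
    simp
  rw [hypH, if_pos (inv_pos.mpr hx), one_div x⁻¹, inv_inv, norm_mul, norm_mul, norm_div, norm_mul,
    norm_cos, Complex.norm_cpow_eq_rpow_re_of_pos (inv_pos.mpr hx), inv_rpow hx.le,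
    ← rpow_neg hx.le]
  simp

lemma pow_mul_norm_tau_mul_tau_div_pow_mul_le (k : ℕ) (t : ℝ) (n : ℕ) {a r : ℕ} (ha : 0 < a)
    (hr : 0 < r) {h : ℂ} {J : ℝ} (hJ : 0 ≤ J)
    (hh : ‖h‖ = 1 / 2 * ((a : ℝ) / r) ^ ((k : ℝ) - 1 / 2) * J) :
    (r : ℝ) ^ k * ‖tau 0 n * tau (t * Complex.I) a / (a : ℂ) ^ k * h‖ ≤
      n.divisors.card * a.divisors.card * (((a : ℝ) / r) ^ (-(1 / 2) : ℝ) * J) := by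
  have tau_zero_le : ‖tau 0 n‖ ≤ n.divisors.card := by simpa using norm_tau_le 0 n
  have power_eq : (r : ℝ) ^ k / (a : ℝ) ^ k * ((a : ℝ) / r) ^ ((k : ℝ) - 1 / 2) =
      ((a : ℝ) / r) ^ (-(1 / 2) : ℝ) := by
    rw [sub_eq_add_neg, rpow_add (by positivity), rpow_natCast, div_pow]
    field_simp
  rw [norm_mul, norm_div, norm_mul, hh, norm_pow, Complex.norm_natCast]
  calc _ = ‖tau 0 n‖ * ‖tau (t * Complex.I) a‖ * (((r : ℝ) ^ k / (a : ℝ) ^ k *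
        ((a : ℝ) / r) ^ ((k : ℝ) - 1 / 2)) * (1 / 2 * J)) := by ring
    _ ≤ n.divisors.card * a.divisors.card * (((a : ℝ) / r) ^ (-(1 / 2) : ℝ) * J) := by
        rw [power_eq]
        gcongr
        · exact norm_tau_le t a
        · linarith

/-- The summand of `V₂` with index `n`, so that `V₂` is treated in parallel with `V₁` and `V₃`. -/
noncomputable def V₂term (k N : ℕ) (v : ℂ) (r n : ℕ) : ℂ :=
  tau 0 n * tau v (r - n * N) / ((r - n * N : ℕ) : ℂ) ^ k *
    hypH k 0 v ((r : ℝ) / ((r : ℝ) - n * N))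

lemma cosh_mul_pow_mul_norm_V₁term_le (k : ℕ) {N r n : ℕ} (t : ℝ) (hr : 1 ≤ r)
    (hn : 1 + r ≤ n * N) :
    cosh (π * t) * ((r : ℝ) ^ k * ‖V₁term k N (t * Complex.I) r n‖) ≤
      n.divisors.card * (n * N - r).divisors.card *
        ((((n * N - r : ℕ) : ℝ) / r) ^ (-(1 / 2) : ℝ) *
          (cosh (π * t) * ‖I₂ k 0 (t * Complex.I) (((n * N - r : ℕ) : ℝ) / r)‖)) := by
  have ha : 0 < n * N - r := by lia
  have hcast : ((n * N - r : ℕ) : ℝ) = (n : ℝ) * N - r := by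
    rw [Nat.cast_sub (by lia), Nat.cast_mul]
  have term_le := pow_mul_norm_tau_mul_tau_div_pow_mul_le k t n ha hr (norm_nonneg _)
    (norm_hypH_neg k (t * Complex.I) (by positivity))
  rw [V₁term, if_pos hn, neg_div, ← hcast, ← inv_div ((n * N - r : ℕ) : ℝ)]
  refine (mul_le_mul_of_nonneg_left term_le (cosh_pos _).le).trans_eq ?_
  ring

lemma pow_mul_norm_V₂term_le (k : ℕ) {N r n : ℕ} (t : ℝ) (hr : 1 ≤ r) (hn : n * N < r) :
    (r : ℝ) ^ k * ‖V₂term k N (t * Complex.I) r n‖ ≤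
      n.divisors.card * (r - n * N).divisors.card *
        ((((r - n * N : ℕ) : ℝ) / r) ^ (-(1 / 2) : ℝ) *
          ‖I₁ k 0 (t * Complex.I) (((r - n * N : ℕ) : ℝ) / r)‖) := by
  have ha : 0 < r - n * N := by lia
  have hcast : ((r - n * N : ℕ) : ℝ) = (r : ℝ) - n * N := by
    rw [Nat.cast_sub (by lia), Nat.cast_mul]
  refine pow_mul_norm_tau_mul_tau_div_pow_mul_le k t n ha hr (norm_nonneg _) ?_
  rw [← norm_hypH_pos k _ (by positivity), ← hcast, inv_div]

lemma pow_mul_norm_V₃term_le (k : ℕ) {N r n : ℕ} (t : ℝ) (hr : 1 ≤ r) (hn : 1 ≤ n) :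
    (r : ℝ) ^ k * ‖V₃term k N (t * Complex.I) r n‖ ≤
      n.divisors.card * (n * N + r).divisors.card *
        ((((n * N + r : ℕ) : ℝ) / r) ^ (-(1 / 2) : ℝ) *
          ‖I₁ k 0 (t * Complex.I) (((n * N + r : ℕ) : ℝ) / r)‖) := by
  have hcast : ((n * N + r : ℕ) : ℝ) = (n : ℝ) * N + r := by push_cast; rfl
  rw [V₃term, if_pos hn]
  refine pow_mul_norm_tau_mul_tau_div_pow_mul_le k t n (by lia) hr (norm_nonneg _) ?_
  rw [← norm_hypH_pos k _ (by positivity), ← hcast, inv_div]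

lemma exists_card_divisors_mul_card_divisors_le {ε : ℝ} (hε : 0 < ε) :
    ∃ C : ℝ, 0 < C ∧ ∀ m n : ℕ, m ≠ 0 → n ≠ 0 → ∀ B : ℝ, m ≤ B → n ≤ B →
      (m.divisors.card : ℝ) * n.divisors.card ≤ C * B ^ ε := by
  obtain ⟨C, hC, card_le⟩ := exists_card_divisors_le (half_pos hε)
  refine ⟨C * C, by positivity, fun m n hm hn B hmB hnB => ?_⟩
  have hB : 0 < B := hmB.trans_lt' (by exact_mod_cast Nat.pos_of_ne_zero hm)
  calc (m.divisors.card : ℝ) * n.divisors.card ≤ (C * B ^ (ε / 2)) * (C * B ^ (ε / 2)) := by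
        gcongr ?_ * ?_
        · exact (card_le m hm).trans (by gcongr)
        · exact (card_le n hn).trans (by gcongr)
    _ = C * C * B ^ ε := by
        rw [mul_mul_mul_comm, ← rpow_add hB, add_halves]

lemma two_mul_rpow_le {u p : ℝ} (hu : 0 ≤ u) (hp : p ≤ 2) : (2 * u) ^ p ≤ 4 * u ^ p := by
  rw [mul_rpow two_pos.le hu]
  gcongr
  calc (2 : ℝ) ^ p ≤ 2 ^ (2 : ℝ) := rpow_le_rpow_of_exponent_le one_le_two hp
    _ = 4 := by norm_num

lemma rpow_neg_le_rpow_of_inv_le {x y p : ℝ} (hy : 0 < y) (h : y⁻¹ ≤ x) (hp : 0 ≤ p) :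
    x ^ (-p) ≤ y ^ p :=
  calc x ^ (-p) ≤ (y⁻¹) ^ (-p) :=
        rpow_le_rpow_of_nonpos (by positivity) h (neg_nonpos.mpr hp)
    _ = y ^ p := by rw [inv_rpow hy.le, rpow_neg hy.le, inv_inv]

lemma rpow_mul_div_div_rpow_le {r N n δ : ℝ} (hr : 1 ≤ r) (hN : 1 ≤ N) (hn : 0 ≤ n)
    (hδ : 0 ≤ δ) :
    r ^ (2 * δ) * (r / N / n) ^ (1 + δ / 2) ≤ r ^ (3 * δ) * (r / N) * (1 / n ^ (1 + δ / 2)) := by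
  have hr0 : 0 < r := by linarith
  have div_rpow_le : (r / N) ^ (1 + δ / 2) ≤ r / N * r ^ δ := by
    rw [rpow_one_add' (by positivity) (by positivity)]
    gcongr
    calc (r / N) ^ (δ / 2) ≤ r ^ (δ / 2) := by
          gcongr
          exact div_le_self (by linarith) hN
      _ ≤ r ^ δ := rpow_le_rpow_of_exponent_le hr (by linarith)
  calc r ^ (2 * δ) * (r / N / n) ^ (1 + δ / 2)
      = r ^ (2 * δ) * (r / N) ^ (1 + δ / 2) * (1 / n ^ (1 + δ / 2)) := by
        rw [div_rpow (by positivity) hn]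
        ring
    _ ≤ r ^ (2 * δ) * (r / N * r ^ δ) * (1 / n ^ (1 + δ / 2)) := by gcongr
    _ = r ^ (3 * δ) * (r / N) * (1 / n ^ (1 + δ / 2)) := by
        rw [show 3 * δ = 2 * δ + δ by ring, rpow_add hr0 (2 * δ)]
        ring

lemma exists_V₁term_le_of_mul_le_two_mul {δ : ℝ} (hδ : 0 < δ) (hδ' : δ ≤ 1 / 4) :
    ∃ C : ℝ, 0 < C ∧ ∀ k N r n : ℕ, ∀ t : ℝ, 2 ≤ k → 1 ≤ N → 1 ≤ r → 1 + r ≤ n * N →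
      n * N ≤ 2 * r →
      cosh (π * t) * ((r : ℝ) ^ k * ‖V₁term k N (t * Complex.I) r n‖) ≤
        C * (3 + |t|) * (r : ℝ) ^ (2 * δ) := by
  obtain ⟨C, hC, I₂_le⟩ := exists_cosh_mul_norm_I₂_right_le hδ hδ'
  obtain ⟨D, hD, card_le⟩ := exists_card_divisors_mul_card_divisors_le hδ
  refine ⟨4 * D * C, by positivity, fun k N r n t hk hN hr hn hnr => ?_⟩
  have hr' : (0 : ℝ) < r := by exact_mod_cast hr
  have hn0 : n ≠ 0 := by rintro rfl; lia
  have hnr2 : n ≤ 2 * r := (Nat.le_mul_of_pos_right n hN).trans hnr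
  have term_le := cosh_mul_pow_mul_norm_V₁term_le k t hr hn
  set a := n * N - r
  have ha : 1 ≤ a := by lia
  set x : ℝ := (a : ℝ) / r with hx
  have x_ge : (r : ℝ)⁻¹ ≤ x := by
    rw [hx, inv_eq_one_div]
    gcongr
    exact_mod_cast ha
  have hx0 : 0 < x := x_ge.trans_lt' (by positivity)
  calc _ ≤ _ := term_le
    _ ≤ D * (2 * (r : ℝ)) ^ δ * (x ^ (-(1 / 2) : ℝ) * (C * x ^ (1 / 2 - δ) * (3 + |t|))) := by
        gcongr ?_ * (_ * ?_)
        · exact card_le n a hn0 (by lia) _ (by exact_mod_cast hnr2) (by norm_cast; lia)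
        · exact I₂_le k hk t x hx0
    _ = D * C * (3 + |t|) * ((2 * r) ^ δ * x ^ (-δ)) := by
        rw [show -δ = -(1 / 2) + (1 / 2 - δ) by ring, rpow_add hx0]
        ring
    _ ≤ D * C * (3 + |t|) * ((4 * r ^ δ) * r ^ δ) := by
        gcongr _ * (?_ * ?_)
        · exact two_mul_rpow_le hr'.le (by linarith)
        · exact rpow_neg_le_rpow_of_inv_le hr' x_ge hδ.le
    _ = 4 * D * C * (3 + |t|) * r ^ (2 * δ) := by
        rw [two_mul δ, rpow_add hr']
        ring

lemma exists_V₁term_le_of_two_mul_lt_mul {δ : ℝ} (hδ : 0 < δ) (hδ' : δ ≤ 1 / 4) :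
    ∃ C : ℝ, 0 < C ∧ ∀ k N r n : ℕ, ∀ t : ℝ, 2 ≤ k → 1 ≤ N → 1 ≤ r → 1 + r ≤ n * N →
      2 * r < n * N →
      cosh (π * t) * ((r : ℝ) ^ k * ‖V₁term k N (t * Complex.I) r n‖) ≤
        C * (3 + |t|) ^ (1 + 2 * δ) * ((r : ℝ) ^ (2 * δ) * ((r : ℝ) / N / n) ^ (1 + δ / 2)) := by
  obtain ⟨C, hC, I₂_le⟩ := exists_cosh_mul_norm_I₂_left_le hδ hδ'
  obtain ⟨D, hD, card_le⟩ := exists_card_divisors_mul_card_divisors_le (half_pos hδ)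
  refine ⟨4 * D * C, by positivity, fun k N r n t hk hN hr hn hnr => ?_⟩
  have hr' : (1 : ℝ) ≤ r := by exact_mod_cast hr
  have hn0 : 0 < n := Nat.pos_of_ne_zero (by rintro rfl; lia)
  have term_le := cosh_mul_pow_mul_norm_V₁term_le k t hr hn
  have hcast : ((n * N - r : ℕ) : ℝ) = (n : ℝ) * N - r := by
    rw [Nat.cast_sub (by lia), Nat.cast_mul]
  set a := n * N - r
  set x : ℝ := (a : ℝ) / r with hx
  set u : ℝ := (r : ℝ) / N / n with hu
  have hu0 : 0 < u := by positivity
  have mul_eq : (n : ℝ) * N = r / u := by rw [hu]; field_simp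
  have hu1 : 2 * u < 1 := by
    have : 2 * (r : ℝ) < r / u := mul_eq ▸ by exact_mod_cast hnr
    rw [lt_div_iff₀ hu0] at this
    nlinarith
  have x_ge : (2 * u)⁻¹ ≤ x := by
    rw [hx, hcast, mul_eq, inv_le_iff_one_le_mul₀ (by positivity),
      show (r / u - r) / r * (2 * u) = 2 - 2 * u by field_simp]
    linarith
  have hx0 : 0 < x := x_ge.trans_lt' (by positivity)
  calc _ ≤ _ := term_le
    _ ≤ D * ((r : ℝ) / u) ^ (δ / 2) *
        (x ^ (-(1 / 2) : ℝ) * (C * x ^ (-1 / 2 - δ) * (3 + |t|) ^ (1 + 2 * δ))) := by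
        gcongr ?_ * (_ * ?_)
        · rw [← mul_eq]
          exact card_le n a hn0.ne' (by lia) _
            (by exact_mod_cast Nat.le_mul_of_pos_right n hN) (by norm_cast; lia)
        · exact I₂_le k hk t x hx0
    _ = D * C * (3 + |t|) ^ (1 + 2 * δ) *
        ((r : ℝ) ^ (δ / 2) * u ^ (-(δ / 2)) * x ^ (-(1 + δ))) := by
        rw [show -(1 + δ) = -(1 / 2) + (-1 / 2 - δ) by ring, rpow_add hx0,
          div_rpow (by positivity) hu0.le, rpow_neg hu0.le (δ / 2)]
        ring
    _ ≤ D * C * (3 + |t|) ^ (1 + 2 * δ) *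
        ((r : ℝ) ^ (2 * δ) * u ^ (-(δ / 2)) * (4 * u ^ (1 + δ))) := by
        gcongr _ * (_ ^ ?_ * _ * ?_)
        · linarith
        · exact (rpow_neg_le_rpow_of_inv_le (by positivity) x_ge (by linarith)).trans
            (two_mul_rpow_le hu0.le (by linarith))
    _ = 4 * D * C * (3 + |t|) ^ (1 + 2 * δ) * ((r : ℝ) ^ (2 * δ) * u ^ (1 + δ / 2)) := by
        rw [show 1 + δ / 2 = -(δ / 2) + (1 + δ) by ring, rpow_add hu0 (-(δ / 2))]
        ring

theorem exists_V₁term_le {δ : ℝ} (hδ : 0 < δ) (hδ' : δ ≤ 1 / 4) :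
    ∃ C : ℝ, 0 < C ∧ ∀ k N r n : ℕ, ∀ t : ℝ, 2 ≤ k → 1 ≤ N → 1 ≤ r →
      cosh (π * t) * ((r : ℝ) ^ k * ‖V₁term k N (t * Complex.I) r n‖) ≤
        C * ((3 + |t|) ^ (2 * δ) * (k + (3 + |t|)) * ((r : ℝ) ^ (3 * δ) * (r / N))) *
          (1 / (n : ℝ) ^ (1 + δ / 2)) := by
  obtain ⟨C₁, hC₁, near_le⟩ := exists_V₁term_le_of_mul_le_two_mul hδ hδ'
  obtain ⟨C₂, hC₂, far_le⟩ := exists_V₁term_le_of_two_mul_lt_mul hδ hδ'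
  refine ⟨4 * C₁ + C₂, by positivity, fun k N r n t hk hN hr => ?_⟩
  have hr' : (1 : ℝ) ≤ r := by exact_mod_cast hr
  have hN' : (1 : ℝ) ≤ N := by exact_mod_cast hN
  by_cases hn : 1 + r ≤ n * N
  swap
  · rw [V₁term, if_neg hn, norm_zero, mul_zero, mul_zero]
    positivity
  have hn0 : 0 < n := Nat.pos_of_ne_zero (by rintro rfl; lia)
  set T := 3 + |t|
  have hT : 1 ≤ T := by linarith [abs_nonneg t]
  set u : ℝ := (r : ℝ) / N / n with hu
  have hu0 : 0 < u := by positivity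
  have term_le : cosh (π * t) * ((r : ℝ) ^ k * ‖V₁term k N (t * Complex.I) r n‖) ≤
      (4 * C₁ + C₂) * T ^ (1 + 2 * δ) * ((r : ℝ) ^ (2 * δ) * u ^ (1 + δ / 2)) := by
    rcases le_or_gt (n * N) (2 * r) with hnr | hnr
    · have hu1 : 1 ≤ 2 * u := by
        rw [hu, div_div, ← mul_div_assoc, one_le_div (by positivity), mul_comm (N : ℝ)]
        exact_mod_cast hnr
      calc _ ≤ C₁ * T * (r : ℝ) ^ (2 * δ) * 1 := by simpa using near_le k N r n t hk hN hr hn hnr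
        _ ≤ C₁ * T ^ (1 + 2 * δ) * (r : ℝ) ^ (2 * δ) * (4 * u ^ (1 + δ / 2)) := by
            gcongr _ * ?_ * _ * ?_
            · exact self_le_rpow_of_one_le hT (by linarith)
            · exact (one_le_rpow hu1 (by linarith)).trans (two_mul_rpow_le hu0.le (by linarith))
        _ = 4 * C₁ * T ^ (1 + 2 * δ) * ((r : ℝ) ^ (2 * δ) * u ^ (1 + δ / 2)) := by ring
        _ ≤ _ := by gcongr; linarith
    · calc _ ≤ _ := far_le k N r n t hk hN hr hn hnr
        _ ≤ _ := by gcongr; linarith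
  calc _ ≤ (4 * C₁ + C₂) * T ^ (1 + 2 * δ) * ((r : ℝ) ^ (2 * δ) * u ^ (1 + δ / 2)) := term_le
    _ ≤ (4 * C₁ + C₂) * (T ^ (2 * δ) * (k + T)) *
        ((r : ℝ) ^ (3 * δ) * (r / N) * (1 / (n : ℝ) ^ (1 + δ / 2))) := by
        gcongr _ * ?_ * ?_
        · rw [add_comm 1, rpow_add_one (by positivity)]
          gcongr
          exact le_add_of_nonneg_left k.cast_nonneg
        · exact rpow_mul_div_div_rpow_le hr' hN' n.cast_nonneg hδ.le
    _ = _ := by ring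

theorem exists_V₂term_le {δ : ℝ} (hδ : 0 < δ) (hδ' : δ ≤ 1 / 4) :
    ∃ C : ℝ, 0 < C ∧ ∀ k N r n : ℕ, ∀ t : ℝ, 2 ≤ k → 1 ≤ N → 1 ≤ r → 1 ≤ n → n * N < r →
      (r : ℝ) ^ k * ‖V₂term k N (t * Complex.I) r n‖ ≤
        C * ((k + (3 + |t|)) * ((r : ℝ) ^ (3 * δ) * (r / N))) * (1 / (n : ℝ) ^ (1 + δ / 2)) := by
  obtain ⟨C, hC, I₁_le⟩ := exists_abs_one_sub_mul_norm_I₁_right_le hδ hδ'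
  obtain ⟨D, hD, card_le⟩ := exists_card_divisors_mul_card_divisors_le hδ
  refine ⟨D * C, by positivity, fun k N r n t hk hN hr hn hnr => ?_⟩
  have hr' : (1 : ℝ) ≤ r := by exact_mod_cast hr
  have term_le := pow_mul_norm_V₂term_le k t hr hnr
  have hcast : ((r - n * N : ℕ) : ℝ) = (r : ℝ) - n * N := by
    rw [Nat.cast_sub (by lia), Nat.cast_mul]
  set a := r - n * N
  have ha : 1 ≤ a := by lia
  set x : ℝ := (a : ℝ) / r with hx
  set u : ℝ := (r : ℝ) / N / n with hu
  have hu0 : 0 < u := by positivity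
  have hu1 : 1 ≤ u := by
    rw [hu, div_div, one_le_div (by positivity), mul_comm (N : ℝ)]
    exact_mod_cast hnr.le
  have one_sub_x : 1 - x = u⁻¹ := by
    rw [hx, hcast, hu]
    field_simp
    ring
  have x_ge : (r : ℝ)⁻¹ ≤ x := by
    rw [hx, inv_eq_one_div]
    gcongr
    exact_mod_cast ha
  have hx0 : 0 < x := x_ge.trans_lt' (by positivity)
  have I₁_le := I₁_le k hk t x hx0
  rw [one_sub_x, abs_of_pos (inv_pos.mpr hu0), inv_mul_le_iff₀ hu0] at I₁_le
  calc _ ≤ _ := term_le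
    _ ≤ D * (r : ℝ) ^ δ * (x ^ (-(1 / 2) : ℝ) * (u * (C * x ^ (1 / 2 - δ) * (k + (3 + |t|))))) := by
        gcongr ?_ * (_ * ?_)
        exact card_le n a (by lia) (by lia) _
          (by exact_mod_cast (Nat.le_mul_of_pos_right n hN).trans hnr.le) (by norm_cast; lia)
    _ = D * C * (k + (3 + |t|)) * ((r : ℝ) ^ δ * x ^ (-δ) * u) := by
        rw [show -δ = -(1 / 2) + (1 / 2 - δ) by ring, rpow_add hx0]
        ring
    _ ≤ D * C * (k + (3 + |t|)) * ((r : ℝ) ^ δ * (r : ℝ) ^ δ * u ^ (1 + δ / 2)) := by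
        gcongr _ * (_ * ?_ * ?_)
        · exact rpow_neg_le_rpow_of_inv_le (by positivity) x_ge hδ.le
        · exact self_le_rpow_of_one_le hu1 (by linarith)
    _ ≤ D * C * (k + (3 + |t|)) * ((r : ℝ) ^ (3 * δ) * (r / N) * (1 / (n : ℝ) ^ (1 + δ / 2))) := by
        rw [← rpow_add (by positivity) δ, ← two_mul δ]
        gcongr _ * ?_
        exact rpow_mul_div_div_rpow_le hr' (by exact_mod_cast hN) n.cast_nonneg hδ.le
    _ = _ := by ring

theorem exists_V₃term_le {δ : ℝ} (hδ : 0 < δ) (hδ' : δ ≤ 1 / 4) :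
    ∃ C : ℝ, 0 < C ∧ ∀ k N r n : ℕ, ∀ t : ℝ, 2 ≤ k → 1 ≤ N → 1 ≤ r →
      (r : ℝ) ^ k * ‖V₃term k N (t * Complex.I) r n‖ ≤
        C * ((k + (3 + |t|)) * ((r : ℝ) ^ (3 * δ) * (r / N))) * (1 / (n : ℝ) ^ (1 + δ / 2)) := by
  obtain ⟨C, hC, I₁_le⟩ := exists_abs_one_sub_mul_norm_I₁_right_le hδ hδ'
  obtain ⟨D, hD, card_le⟩ := exists_card_divisors_mul_card_divisors_le (half_pos hδ)
  refine ⟨D * C, by positivity, fun k N r n t hk hN hr => ?_⟩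
  have hr' : (1 : ℝ) ≤ r := by exact_mod_cast hr
  by_cases hn : 1 ≤ n
  swap
  · rw [V₃term, if_neg hn, norm_zero, mul_zero]
    positivity
  have term_le := pow_mul_norm_V₃term_le k (N := N) t hr hn
  set a := n * N + r with ha
  set x : ℝ := (a : ℝ) / r with hx
  set u : ℝ := (r : ℝ) / N / n with hu
  have hu0 : 0 < u := by positivity
  have a_eq : (a : ℝ) = r * x := by rw [hx]; field_simp
  have x_eq : x = 1 + u⁻¹ := by
    rw [hx, ha, hu]
    push_cast
    field_simp
    ring
  have hx0 : 0 < x := by positivity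
  have I₁_le := I₁_le k hk t x hx0
  rw [x_eq, abs_sub_comm, add_sub_cancel_left, abs_of_pos (inv_pos.mpr hu0), inv_mul_le_iff₀ hu0,
    ← x_eq] at I₁_le
  calc _ ≤ _ := term_le
    _ ≤ D * (r * x) ^ (δ / 2) *
        (x ^ (-(1 / 2) : ℝ) * (u * (C * x ^ (1 / 2 - δ) * (k + (3 + |t|))))) := by
        gcongr ?_ * (_ * ?_)
        rw [← a_eq]
        exact card_le n a (by lia) (by lia) _ (by norm_cast; nlinarith) le_rfl
    _ = D * C * (k + (3 + |t|)) * ((r : ℝ) ^ (δ / 2) * u * x ^ (-(δ / 2))) := by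
        rw [show -(δ / 2) = δ / 2 + (-(1 / 2) + (1 / 2 - δ)) by ring, rpow_add hx0, rpow_add hx0,
          mul_rpow (by positivity) hx0.le]
        ring
    _ ≤ D * C * (k + (3 + |t|)) * ((r : ℝ) ^ (2 * δ) * u * u ^ (δ / 2)) := by
        gcongr _ * (_ ^ ?_ * _ * ?_)
        · linarith
        · exact rpow_neg_le_rpow_of_inv_le hu0 (by linarith) (by linarith)
    _ ≤ D * C * (k + (3 + |t|)) * ((r : ℝ) ^ (3 * δ) * (r / N) * (1 / (n : ℝ) ^ (1 + δ / 2))) := by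
        rw [mul_assoc ((r : ℝ) ^ (2 * δ)), ← rpow_one_add' hu0.le (by positivity)]
        gcongr _ * ?_
        exact rpow_mul_div_div_rpow_le hr' (by exact_mod_cast hN) n.cast_nonneg hδ.le
    _ = _ := by ring

lemma rpow_mul_rpow_edge_le {ε : ℝ} (hε : 0 ≤ ε) (hε' : ε ≤ 1 / 8) {k : ℕ} (hk : 2 ≤ k)
    {n N x L : ℝ} (hn : 1 ≤ n) (hN : 1 ≤ N) (hx : 0 < x) (hxN : x ≤ 2 * (n * N))
    (hL : x⁻¹ ≤ L / n) :
    (2 * (n * N)) ^ ε * x ^ (-(k : ℝ) + ε) ≤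
      2 * (L ^ k * N ^ (2 * ε) * (1 / n ^ (3 / 2 : ℝ))) := by
  have hL0 : 0 ≤ L := by
    have := (inv_pos.mpr hx).trans_le hL
    exact (pos_of_mul_pos_left (div_eq_mul_inv L n ▸ this) (by positivity)).le
  have x_rpow_le : x ^ (-(k : ℝ) + ε) ≤ L ^ k / n ^ 2 * (2 * (n * N)) ^ ε := by
    rw [rpow_add hx, rpow_neg hx.le, rpow_natCast, ← inv_pow]
    gcongr
    calc (x⁻¹) ^ k ≤ (L / n) ^ k := by gcongr
      _ = L ^ k / n ^ k := div_pow _ _ _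
      _ ≤ L ^ k / n ^ 2 := by gcongr
  have rpow_two_mul_le : (2 * (n * N)) ^ (2 * ε) ≤ 2 * (n ^ (1 / 2 : ℝ) * N ^ (2 * ε)) := by
    rw [mul_rpow (by positivity) (by positivity), mul_rpow (by positivity) (by positivity)]
    gcongr
    · exact rpow_le_self_of_one_le one_le_two (by linarith)
    · linarith
  have div_sq_eq : n ^ (1 / 2 : ℝ) / n ^ 2 = 1 / n ^ (3 / 2 : ℝ) := by
    rw [← rpow_natCast, ← rpow_sub (by positivity), one_div (n ^ (3 / 2 : ℝ)),
      ← rpow_neg (by positivity)]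
    norm_num
  calc (2 * (n * N)) ^ ε * x ^ (-(k : ℝ) + ε)
      ≤ (2 * (n * N)) ^ ε * (L ^ k / n ^ 2 * (2 * (n * N)) ^ ε) := by gcongr
    _ = L ^ k / n ^ 2 * (2 * (n * N)) ^ (2 * ε) := by
        rw [two_mul ε, rpow_add (by positivity)]
        ring
    _ ≤ L ^ k / n ^ 2 * (2 * (n ^ (1 / 2 : ℝ) * N ^ (2 * ε))) := by gcongr
    _ = 2 * (L ^ k * N ^ (2 * ε) * (n ^ (1 / 2 : ℝ) / n ^ 2)) := by ring
    _ = _ := by rw [div_sq_eq]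

lemma exists_card_divisors_mul_rpow_edge_le {ε : ℝ} (hε : 0 < ε) (hε' : ε ≤ 1 / 8) :
    ∃ C : ℝ, 0 < C ∧ ∀ k N r n a : ℕ, 2 ≤ k → 1 ≤ N → 1 ≤ r → 1 ≤ n → 1 ≤ a →
      a ≤ 2 * (n * N) → ∀ L : ℝ, n * r ≤ L * a →
      (n.divisors.card : ℝ) * a.divisors.card *
          (((a : ℝ) / r) ^ (-(1 / 2) : ℝ) * ((a : ℝ) / r) ^ (1 / 2 - k + ε)) ≤
        C * (L ^ k * (N : ℝ) ^ (2 * ε) * (1 / (n : ℝ) ^ (3 / 2 : ℝ))) := by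
  obtain ⟨D, hD, card_le⟩ := exists_card_divisors_mul_card_divisors_le hε
  refine ⟨D * 2, by positivity, fun k N r n a hk hN hr hn ha haN L hL => ?_⟩
  have hn_le : n ≤ 2 * (n * N) := by nlinarith
  set x : ℝ := (a : ℝ) / r with hx
  have hx0 : 0 < x := by positivity
  have x_le : x ≤ 2 * (n * N) :=
    (div_le_self a.cast_nonneg (by exact_mod_cast hr)).trans (by exact_mod_cast haN)
  have x_inv_le : x⁻¹ ≤ L / n := by
    rw [hx, inv_div, div_le_div_iff₀ (by positivity) (by positivity)]
    linarith
  calc _ ≤ D * (2 * ((n : ℝ) * N)) ^ ε * (x ^ (-(1 / 2) : ℝ) * x ^ (1 / 2 - k + ε)) := by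
        gcongr ?_ * _
        exact card_le n a (by lia) (by lia) _ (by exact_mod_cast hn_le) (by exact_mod_cast haN)
    _ = D * ((2 * ((n : ℝ) * N)) ^ ε * x ^ (-(k : ℝ) + ε)) := by
        rw [← rpow_add hx0, show (-(1 / 2) + (1 / 2 - k + ε) : ℝ) = -k + ε by ring]
        ring
    _ ≤ D * (2 * (L ^ k * (N : ℝ) ^ (2 * ε) * (1 / (n : ℝ) ^ (3 / 2 : ℝ)))) := by
        gcongr D * ?_
        exact rpow_mul_rpow_edge_le hε.le hε' hk (by exact_mod_cast hn) (by exact_mod_cast hN)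
          hx0 x_le x_inv_le
    _ = _ := by ring

theorem exists_V₁term_edge_le {ε : ℝ} (hε : 0 < ε) (hε' : ε ≤ 1 / 8) :
    ∃ C : ℝ, 0 < C ∧ ∀ k N r n : ℕ, ∀ t : ℝ, 2 ≤ k → 1 ≤ r → r < N →
      cosh (π * t) * ((r : ℝ) ^ k * ‖V₁term k N (t * Complex.I) r n‖) ≤
        C * (((3 + |t|) ^ 2 / 4) ^ k / (3 + |t|) * ((r : ℝ) / (N - r)) ^ k * (N : ℝ) ^ (2 * ε)) *
          (1 / (n : ℝ) ^ (3 / 2 : ℝ)) := by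
  obtain ⟨C, hC, I₂_le⟩ := exists_cosh_mul_norm_I₂_edge_le hε (by linarith)
  obtain ⟨D, hD, card_mul_le⟩ := exists_card_divisors_mul_rpow_edge_le hε hε'
  refine ⟨C * D, by positivity, fun k N r n t hk hr hrN => ?_⟩
  have hrN' : 0 < (N : ℝ) - r := sub_pos.mpr (by exact_mod_cast hrN)
  by_cases hn : 1 + r ≤ n * N
  swap
  · rw [V₁term, if_neg hn, norm_zero, mul_zero, mul_zero]
    positivity
  have hn1 : 1 ≤ n := Nat.pos_of_ne_zero (by rintro rfl; lia)
  have hn1' : (1 : ℝ) ≤ n := by exact_mod_cast hn1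
  have term_le := cosh_mul_pow_mul_norm_V₁term_le k t hr hn
  have hcast : ((n * N - r : ℕ) : ℝ) = (n : ℝ) * N - r := by
    rw [Nat.cast_sub (by lia), Nat.cast_mul]
  have n_mul_r_le : (n : ℝ) * r ≤ r / (N - r) * (n * N - r : ℕ) := by
    rw [hcast, div_mul_eq_mul_div, le_div_iff₀ hrN']
    nlinarith [mul_nonneg (sq_nonneg (r : ℝ)) (sub_nonneg.mpr hn1')]
  set a := n * N - r
  have ha : 1 ≤ a := by lia
  set x : ℝ := (a : ℝ) / r
  set Q : ℝ := ((3 + |t|) ^ 2 / 4) ^ k / (3 + |t|)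
  calc _ ≤ _ := term_le
    _ ≤ n.divisors.card * a.divisors.card *
        (x ^ (-(1 / 2) : ℝ) * (C * x ^ (1 / 2 - k + ε) * Q)) := by
        gcongr _ * (_ * ?_)
        exact I₂_le k hk t x (by positivity)
    _ = C * Q * (n.divisors.card * a.divisors.card *
        (x ^ (-(1 / 2) : ℝ) * x ^ (1 / 2 - k + ε))) := by ring
    _ ≤ C * Q * (D * (((r : ℝ) / (N - r)) ^ k * (N : ℝ) ^ (2 * ε) *
        (1 / (n : ℝ) ^ (3 / 2 : ℝ)))) := by
        gcongr C * Q * ?_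
        exact card_mul_le k N r n a hk (by lia) hr hn1 ha (by lia) _ n_mul_r_le
    _ = _ := by ring

theorem exists_V₃term_edge_le {ε : ℝ} (hε : 0 < ε) (hε' : ε ≤ 1 / 8) :
    ∃ C : ℝ, 0 < C ∧ ∀ k N r n : ℕ, ∀ t : ℝ, 2 ≤ k → 1 ≤ r → r < N →
      (r : ℝ) ^ k * ‖V₃term k N (t * Complex.I) r n‖ ≤
        C * (((3 + |t|) ^ 2 / 4) ^ k / (3 + |t|) * ((r : ℝ) / (N - r)) ^ k * (N : ℝ) ^ (2 * ε)) *
          (1 / (n : ℝ) ^ (3 / 2 : ℝ)) := by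
  obtain ⟨C, hC, I₁_le⟩ := exists_norm_I₁_edge_le_of_two_le hε hε'
  obtain ⟨D, hD, card_mul_le⟩ := exists_card_divisors_mul_rpow_edge_le hε hε'
  refine ⟨C * D, by positivity, fun k N r n t hk hr hrN => ?_⟩
  have hrN' : 0 < (N : ℝ) - r := sub_pos.mpr (by exact_mod_cast hrN)
  by_cases hn : 1 ≤ n
  swap
  · rw [V₃term, if_neg hn, norm_zero, mul_zero]
    positivity
  have term_le := pow_mul_norm_V₃term_le k (N := N) t hr hn
  have n_mul_r_le : (n : ℝ) * r ≤ r / (N - r) * (n * N + r : ℕ) := by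
    rw [div_mul_eq_mul_div, le_div_iff₀ hrN']
    push_cast
    nlinarith [mul_nonneg (sq_nonneg (r : ℝ)) n.cast_nonneg]
  set a := n * N + r with ha
  have hNn : N ≤ n * N := Nat.le_mul_of_pos_left N hn
  set x : ℝ := (a : ℝ) / r with hx
  have two_le_x : 2 ≤ x := by
    rw [hx, le_div_iff₀ (by positivity)]
    exact_mod_cast (show 2 * r ≤ a by lia)
  have hx0 : 0 < x := by linarith
  set Q : ℝ := ((3 + |t|) ^ 2 / 4) ^ k / (3 + |t|)
  calc _ ≤ _ := term_le
    _ ≤ n.divisors.card * a.divisors.card *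
        (x ^ (-(1 / 2) : ℝ) * (C * x ^ (1 / 2 - k + ε) * Q)) := by
        gcongr
        exact I₁_le k hk t x two_le_x
    _ = C * Q * (n.divisors.card * a.divisors.card *
        (x ^ (-(1 / 2) : ℝ) * x ^ (1 / 2 - k + ε))) := by ring
    _ ≤ C * Q * (D * (((r : ℝ) / (N - r)) ^ k * (N : ℝ) ^ (2 * ε) *
        (1 / (n : ℝ) ^ (3 / 2 : ℝ)))) := by
        gcongr C * Q * ?_
        exact card_mul_le k N r n a hk (by lia) hr hn (by lia) (by lia) _ n_mul_r_le
    _ = _ := by ring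

lemma summable_of_mul_norm_le {f : ℕ → ℂ} {c A p : ℝ} (hc : 0 < c) (hp : 1 < p)
    (hf : ∀ n, c * ‖f n‖ ≤ A * (1 / (n : ℝ) ^ p)) : Summable f := by
  refine Summable.of_norm_bounded ((summable_one_div_nat_rpow.mpr hp).mul_left (A / c)) fun n => ?_
  rw [div_mul_eq_mul_div, le_div_iff₀' hc]
  exact hf n

lemma mul_norm_tsum_le {f : ℕ → ℂ} {c A p : ℝ} (hc : 0 < c) (hp : 1 < p)
    (hf : ∀ n, c * ‖f n‖ ≤ A * (1 / (n : ℝ) ^ p)) :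
    c * ‖∑' n, f n‖ ≤ A * ∑' n : ℕ, 1 / (n : ℝ) ^ p := by
  have norm_le := tsum_of_norm_bounded
    ((summable_one_div_nat_rpow.mpr hp).mul_left (A / c)).hasSum fun n => by
      rw [div_mul_eq_mul_div, le_div_iff₀' hc]
      exact hf n
  rwa [tsum_mul_left, div_mul_eq_mul_div, le_div_iff₀' hc] at norm_le

lemma tsum_one_div_nat_rpow_pos {p : ℝ} (hp : 1 < p) : 0 < ∑' n : ℕ, 1 / (n : ℝ) ^ p :=
  (summable_one_div_nat_rpow.mpr hp).tsum_pos (fun n => by positivity) 1 (by simp)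

lemma norm_natCast_cpow_sub_mul_I {r : ℕ} (hr : 1 ≤ r) (k : ℕ) (t : ℝ) :
    ‖(r : ℂ) ^ ((k : ℂ) - t * Complex.I)‖ = (r : ℝ) ^ k := by
  rw [Complex.norm_natCast_cpow_of_pos hr]
  simp

lemma norm_V₁_le {k N r : ℕ} {t A p : ℝ} (hr : 1 ≤ r) (hp : 1 < p)
    (term_le : ∀ n, cosh (π * t) * ((r : ℝ) ^ k * ‖V₁term k N (t * Complex.I) r n‖) ≤
      A * (1 / (n : ℝ) ^ p)) :
    ‖V₁ k N (t * Complex.I) r‖ ≤ A * ∑' n : ℕ, 1 / (n : ℝ) ^ p := by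
  have hc := cosh_pos (π * t)
  rw [V₁, norm_mul, norm_mul, norm_natCast_cpow_sub_mul_I hr, ← mul_assoc, Complex.cos_mul_I,
    ← Complex.ofReal_mul, ← Complex.ofReal_cosh, Complex.norm_real, norm_of_nonneg hc.le]
  exact mul_norm_tsum_le (by positivity) hp fun n => (mul_assoc _ _ _).trans_le (term_le n)

lemma norm_V₂_le {k N r : ℕ} {t A p : ℝ} (hr : 1 ≤ r) (hN : 1 ≤ N) (hA : 0 ≤ A) (hp : 1 < p)
    (term_le : ∀ n, 1 ≤ n → n * N < r →
      (r : ℝ) ^ k * ‖V₂term k N (t * Complex.I) r n‖ ≤ A * (1 / (n : ℝ) ^ p)) :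
    ‖V₂ k N (t * Complex.I) r‖ ≤ A * ∑' n : ℕ, 1 / (n : ℝ) ^ p := by
  have norm_eq : ‖V₂ k N (t * Complex.I) r‖ =
      (r : ℝ) ^ k * ‖∑ n ∈ Finset.Icc 1 ((r - 1) / N), V₂term k N (t * Complex.I) r n‖ := by
    rw [V₂, norm_mul, norm_mul, norm_natCast_cpow_sub_mul_I hr, norm_pow, norm_neg, norm_one,
      one_pow, one_mul]
    rfl
  calc _ ≤ (r : ℝ) ^ k * ∑ n ∈ Finset.Icc 1 ((r - 1) / N), ‖V₂term k N (t * Complex.I) r n‖ := by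
        rw [norm_eq]
        gcongr
        exact norm_sum_le _ _
    _ ≤ ∑ n ∈ Finset.Icc 1 ((r - 1) / N), A * (1 / (n : ℝ) ^ p) := by
        rw [Finset.mul_sum]
        refine Finset.sum_le_sum fun n hn => ?_
        obtain ⟨one_le_n, n_le⟩ := Finset.mem_Icc.mp hn
        rw [Nat.le_div_iff_mul_le hN] at n_le
        exact term_le n one_le_n (by lia)
    _ ≤ A * ∑' n : ℕ, 1 / (n : ℝ) ^ p := by
        rw [← Finset.mul_sum]
        gcongr
        exact (summable_one_div_nat_rpow.mpr hp).sum_le_tsum _ fun n _ => by positivity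

lemma norm_V₃_le {k N r : ℕ} {t A p : ℝ} (hr : 1 ≤ r) (hp : 1 < p)
    (term_le : ∀ n, (r : ℝ) ^ k * ‖V₃term k N (t * Complex.I) r n‖ ≤ A * (1 / (n : ℝ) ^ p)) :
    ‖V₃ k N (t * Complex.I) r‖ ≤ A * ∑' n : ℕ, 1 / (n : ℝ) ^ p := by
  rw [V₃, norm_mul, norm_mul, norm_natCast_cpow_sub_mul_I hr, norm_pow, norm_neg, norm_one,
    one_pow, one_mul]
  exact mul_norm_tsum_le (by positivity) hp term_le

theorem summable_V₁term {k N r : ℕ} (t : ℝ) (hk : 2 ≤ k) (hN : 1 ≤ N) (hr : 1 ≤ r) :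
    Summable (V₁term k N (t * Complex.I) r) := by
  obtain ⟨C, -, term_le⟩ := exists_V₁term_le (δ := 1 / 4) (by norm_num) le_rfl
  have := cosh_pos (π * t)
  exact summable_of_mul_norm_le (c := cosh (π * t) * r ^ k) (by positivity) (by norm_num) fun n =>
    (mul_assoc _ _ _).trans_le (term_le k N r n t hk hN hr)

theorem summable_V₃term {k N r : ℕ} (t : ℝ) (hk : 2 ≤ k) (hN : 1 ≤ N) (hr : 1 ≤ r) :
    Summable (V₃term k N (t * Complex.I) r) := by
  obtain ⟨C, -, term_le⟩ := exists_V₃term_le (δ := 1 / 4) (by norm_num) le_rfl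
  exact summable_of_mul_norm_le (c := (r : ℝ) ^ k) (by positivity) (by norm_num)
    (term_le k N r · t hk hN hr)

lemma exists_norm_V₁_add_V₂_add_V₃_le {δ : ℝ} (hδ : 0 < δ) (hδ' : δ ≤ 1 / 4) :
    ∃ C : ℝ, 0 < C ∧ ∀ (k N r : ℕ) (t : ℝ), 2 ≤ k → 1 ≤ N → 1 ≤ r →
      ‖V₁ k N (t * Complex.I) r + V₂ k N (t * Complex.I) r + V₃ k N (t * Complex.I) r‖ ≤
        C * ((3 + |t|) ^ (2 * δ) * (k + (3 + |t|)) * ((r : ℝ) ^ (3 * δ) * (r / N))) := by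
  obtain ⟨C₁, hC₁, V₁term_le⟩ := exists_V₁term_le hδ hδ'
  obtain ⟨C₂, hC₂, V₂term_le⟩ := exists_V₂term_le hδ hδ'
  obtain ⟨C₃, hC₃, V₃term_le⟩ := exists_V₃term_le hδ hδ'
  have hp : 1 < 1 + δ / 2 := by linarith
  have := tsum_one_div_nat_rpow_pos hp
  set Z := ∑' n : ℕ, 1 / (n : ℝ) ^ (1 + δ / 2)
  refine ⟨(C₁ + C₂ + C₃) * Z, by positivity, fun k N r t hk hN hr => ?_⟩
  have V₁_le := norm_V₁_le hr hp (V₁term_le k N r · t hk hN hr)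
  have V₂_le := norm_V₂_le hr hN (by positivity) hp (V₂term_le k N r · t hk hN hr)
  have V₃_le := norm_V₃_le hr hp (V₃term_le k N r · t hk hN hr)
  set T := 3 + |t|
  have one_le : 1 ≤ T ^ (2 * δ) := one_le_rpow (by linarith [abs_nonneg t]) (by positivity)
  set E := (k + T) * ((r : ℝ) ^ (3 * δ) * (r / N))
  calc _ ≤ C₁ * (T ^ (2 * δ) * (k + T) * ((r : ℝ) ^ (3 * δ) * (r / N))) * Z +
        C₂ * E * Z + C₃ * E * Z :=
        norm_add₃_le.trans (add_le_add_three V₁_le V₂_le V₃_le)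
    _ = (C₁ * T ^ (2 * δ) + C₂ * 1 + C₃ * 1) * (E * Z) := by ring
    _ ≤ (C₁ * T ^ (2 * δ) + C₂ * T ^ (2 * δ) + C₃ * T ^ (2 * δ)) * (E * Z) := by gcongr
    _ = _ := by ring

lemma exists_norm_V₁_add_V₂_add_V₃_edge_le {ε : ℝ} (hε : 0 < ε) (hε' : ε ≤ 1 / 8) :
    ∃ C : ℝ, 0 < C ∧ ∀ (k N r : ℕ) (t : ℝ), 2 ≤ k → 1 ≤ r → r < N →
      ‖V₁ k N (t * Complex.I) r + V₂ k N (t * Complex.I) r + V₃ k N (t * Complex.I) r‖ ≤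
        C * (((3 + |t|) ^ 2 / 4) ^ k / (3 + |t|) * ((r : ℝ) / (N - r)) ^ k *
          (N : ℝ) ^ (2 * ε)) := by
  obtain ⟨C₁, hC₁, V₁term_le⟩ := exists_V₁term_edge_le hε hε'
  obtain ⟨C₃, hC₃, V₃term_le⟩ := exists_V₃term_edge_le hε hε'
  have hp : (1 : ℝ) < 3 / 2 := by norm_num
  have := tsum_one_div_nat_rpow_pos hp
  refine ⟨(C₁ + C₃) * ∑' n : ℕ, 1 / (n : ℝ) ^ (3 / 2 : ℝ), by positivity,
    fun k N r t hk hr hrN => ?_⟩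
  have V₂_eq_zero : V₂ k N (t * Complex.I) r = 0 := by
    rw [V₂, Nat.div_eq_of_lt (by lia), Finset.Icc_eq_empty (by norm_num), Finset.sum_empty,
      mul_zero]
  rw [V₂_eq_zero, add_zero]
  refine (norm_add_le_of_le (norm_V₁_le hr hp (V₁term_le k N r · t hk hr hrN))
    (norm_V₃_le hr hp (V₃term_le k N r · t hk hr hrN))).trans_eq ?_
  ring

lemma norm_sum_divisors_moebius_mul_le {f : ℕ → ℂ} {l : ℕ} {B : ℝ}
    (hf : ∀ r ∈ l.divisors, ‖f r‖ ≤ B) :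
    ‖∑ d ∈ l.divisors, ∑ r ∈ d.divisors, (ArithmeticFunction.moebius (d / r) : ℂ) * f r‖ ≤
      l.divisors.card * l.divisors.card * B := by
  have inner_le : ∀ d ∈ l.divisors,
      ‖∑ r ∈ d.divisors, (ArithmeticFunction.moebius (d / r) : ℂ) * f r‖ ≤
        l.divisors.card * B := by
    intro d hd
    have hB : 0 ≤ B := (norm_nonneg _).trans (hf d hd)
    have divisors_subset : d.divisors ⊆ l.divisors :=
      Nat.divisors_subset_of_dvd (Nat.ne_zero_of_mem_divisors hd) (Nat.dvd_of_mem_divisors hd)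
    calc _ ≤ ∑ _r ∈ d.divisors, B := by
          refine norm_sum_le_of_le _ fun r hr => ?_
          rw [norm_mul, Complex.norm_intCast]
          exact (mul_le_of_le_one_left (norm_nonneg _)
            (by exact_mod_cast ArithmeticFunction.abs_moebius_le_one)).trans
              (hf r (divisors_subset hr))
      _ = d.divisors.card * B := by rw [Finset.sum_const, nsmul_eq_mul]
      _ ≤ l.divisors.card * B := by gcongr
  refine (norm_sum_le_of_le _ inner_le).trans_eq ?_
  rw [Finset.sum_const, nsmul_eq_mul, mul_assoc]

lemma norm_V_le {k N l : ℕ} {t B : ℝ} (hl : 1 ≤ l)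
    (hB : ∀ r ∈ l.divisors, ‖V₁ k N (t * Complex.I) r + V₂ k N (t * Complex.I) r +
      V₃ k N (t * Complex.I) r‖ ≤ B) :
    ‖V k N (t * Complex.I) l‖ ≤
      2 / (l : ℝ) ^ (1 / 2 : ℝ) * (l.divisors.card * l.divisors.card * B) := by
  have norm_prefactor : ‖(2 * (-1) ^ k / (l : ℂ) ^ ((1 : ℂ) / 2 - t * Complex.I) : ℂ)‖ =
      2 / (l : ℝ) ^ (1 / 2 : ℝ) := by
    rw [norm_div, norm_mul, Complex.norm_natCast_cpow_of_pos hl]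
    simp
  rw [V, norm_mul, norm_prefactor]
  gcongr
  exact norm_sum_divisors_moebius_mul_le hB

theorem exists_norm_V_le {δ : ℝ} (hδ : 0 < δ) (hδ' : δ ≤ 1 / 4) :
    ∃ C : ℝ, 0 < C ∧ ∀ (k N l : ℕ) (t : ℝ), 2 ≤ k → 1 ≤ N → 1 ≤ l →
      ‖V k N (t * Complex.I) l‖ ≤
        C * (((l : ℝ) * (3 + |t|)) ^ (4 * δ) * ((l : ℝ) ^ (1 / 2 : ℝ) * (k + (3 + |t|)) / N)) := by
  obtain ⟨C, hC, sum_le⟩ := exists_norm_V₁_add_V₂_add_V₃_le hδ hδ'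
  obtain ⟨D, hD, card_le⟩ := exists_card_divisors_mul_card_divisors_le hδ
  refine ⟨2 * D * C, by positivity, fun k N l t hk hN hl => ?_⟩
  have hl' : (0 : ℝ) < l := by exact_mod_cast hl
  set T := 3 + |t|
  have hT : 1 ≤ T := by linarith [abs_nonneg t]
  have V_le := norm_V_le (k := k) (N := N) (t := t) hl
    (B := C * (T ^ (2 * δ) * (k + T) * ((l : ℝ) ^ (3 * δ) * (l / N)))) fun r hr => by
      refine (sum_le k N r t hk hN (Nat.pos_of_mem_divisors hr)).trans ?_
      gcongr <;> exact Nat.divisor_le hr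
  have div_sqrt_eq : (l : ℝ) / (l : ℝ) ^ (1 / 2 : ℝ) = (l : ℝ) ^ (1 / 2 : ℝ) := by
    rw [← sqrt_eq_rpow, div_sqrt]
  calc _ ≤ _ := V_le
    _ ≤ 2 / (l : ℝ) ^ (1 / 2 : ℝ) *
        (D * (l : ℝ) ^ δ * (C * (T ^ (4 * δ) * (k + T) * ((l : ℝ) ^ (3 * δ) * (l / N))))) := by
        gcongr _ * (?_ * (C * (_ ^ ?_ * _ * _)))
        · exact card_le l l (by lia) (by lia) _ le_rfl le_rfl
        · linarith
    _ = 2 * D * C * ((l : ℝ) ^ δ * (l : ℝ) ^ (3 * δ) * T ^ (4 * δ) *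
        ((l : ℝ) / (l : ℝ) ^ (1 / 2 : ℝ) * (k + T) / N)) := by ring
    _ = _ := by
        rw [div_sqrt_eq, ← rpow_add hl', show δ + 3 * δ = 4 * δ by ring,
          mul_rpow hl'.le (by linarith)]

theorem exists_norm_V_edge_le {ε : ℝ} (hε : 0 < ε) (hε' : ε ≤ 1 / 8) :
    ∃ C : ℝ, 0 < C ∧ ∀ (k N l : ℕ) (t : ℝ), 2 ≤ k → 1 ≤ l → l < N →
      ‖V k N (t * Complex.I) l‖ ≤
        C * (((l : ℝ) * (3 + |t|) ^ 2 / (4 * ((N : ℝ) - l))) ^ k *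
          ((N : ℝ) ^ (3 * ε) / ((l : ℝ) ^ (1 / 2 : ℝ) * (3 + |t|)))) := by
  obtain ⟨C, hC, sum_le⟩ := exists_norm_V₁_add_V₂_add_V₃_edge_le hε hε'
  obtain ⟨D, hD, card_le⟩ := exists_card_divisors_mul_card_divisors_le hε
  refine ⟨2 * D * C, by positivity, fun k N l t hk hl hlN => ?_⟩
  have hlN' : (l : ℝ) < N := by exact_mod_cast hlN
  have : 0 < (N : ℝ) - l := sub_pos.mpr hlN'
  have hN : 0 < (N : ℝ) := hlN'.trans_le' l.cast_nonneg
  set T := 3 + |t|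
  have V_le := norm_V_le (k := k) (N := N) (t := t) hl
    (B := C * ((T ^ 2 / 4) ^ k / T * ((l : ℝ) / (N - l)) ^ k * (N : ℝ) ^ (2 * ε))) fun r hr => by
      have hrl : r ≤ l := Nat.divisor_le hr
      have : 0 < (N : ℝ) - r := sub_pos.mpr (by exact_mod_cast hrl.trans_lt hlN)
      refine (sum_le k N r t hk (Nat.pos_of_mem_divisors hr) (hrl.trans_lt hlN)).trans ?_
      gcongr
  have pow_eq : ((l : ℝ) * T ^ 2 / (4 * ((N : ℝ) - l))) ^ k =
      (T ^ 2 / 4) ^ k * ((l : ℝ) / (N - l)) ^ k := by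
    rw [← mul_pow, div_mul_div_comm, mul_comm (l : ℝ)]
  calc _ ≤ _ := V_le
    _ ≤ 2 / (l : ℝ) ^ (1 / 2 : ℝ) * (D * (N : ℝ) ^ ε *
        (C * ((T ^ 2 / 4) ^ k / T * ((l : ℝ) / (N - l)) ^ k * (N : ℝ) ^ (2 * ε)))) := by
        gcongr _ * (?_ * _)
        exact card_le l l (by lia) (by lia) _ hlN'.le hlN'.le
    _ = _ := by
        rw [pow_eq, show 3 * ε = ε + 2 * ε by ring, rpow_add hN]
        field_simp

end SecondMoment

theorem mainTheorem5_general :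
    (∀ (k N r : ℕ) (t : ℝ), 2 ≤ k → 1 ≤ N → 1 ≤ r →
      Summable (SecondMoment.V₁term k N (t * Complex.I) r) ∧
      Summable (SecondMoment.V₃term k N (t * Complex.I) r)) ∧
    ∀ ε : ℝ, 0 < ε → ∃ C : ℝ, 0 < C ∧
      ∀ (k N l : ℕ) (t T : ℝ), 2 ≤ k → 1 ≤ N → 1 ≤ l → T = 3 + |t| →
        ‖SecondMoment.V k N (t * Complex.I) l‖ ≤
          C * (((l : ℝ) * k * T ^ 2) ^ ε * ((l : ℝ) ^ (1 / 2 : ℝ) * (k + T) / N)) ∧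
        (l < N →
          ‖SecondMoment.V k N (t * Complex.I) l‖ ≤
            C * (((l : ℝ) * T ^ 2 / (4 * ((N : ℝ) - l))) ^ k *
              ((N : ℝ) ^ ε / ((l : ℝ) ^ (1 / 2 : ℝ) * T)))) := by
  refine ⟨fun k N r t hk hN hr => ⟨SecondMoment.summable_V₁term t hk hN hr,
    SecondMoment.summable_V₃term t hk hN hr⟩, fun ε hε => ?_⟩
  obtain ⟨δ, hδ, hδε, hδ'⟩ : ∃ δ : ℝ, 0 < δ ∧ δ ≤ ε / 4 ∧ δ ≤ 1 / 8 :=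
    ⟨min (ε / 4) (1 / 8), by positivity, min_le_left _ _, min_le_right _ _⟩
  obtain ⟨C₁, hC₁, V_le⟩ := SecondMoment.exists_norm_V_le hδ (by linarith)
  obtain ⟨C₂, -, V_edge_le⟩ := SecondMoment.exists_norm_V_edge_le hδ hδ'
  refine ⟨max C₁ C₂, lt_max_of_lt_left hC₁, ?_⟩
  rintro k N l t _ hk hN hl rfl
  have hl' : (1 : ℝ) ≤ l := by exact_mod_cast hl
  have hk' : (2 : ℝ) ≤ k := by exact_mod_cast hk
  have := abs_nonneg t
  constructor
  · refine (V_le k N l t hk hN hl).trans ?_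
    gcongr ?_ * (?_ * _)
    · exact le_max_left _ _
    · calc ((l : ℝ) * (3 + |t|)) ^ (4 * δ) ≤ ((l : ℝ) * (3 + |t|)) ^ ε := by
            gcongr
            · nlinarith
            · linarith
        _ ≤ ((l : ℝ) * k * (3 + |t|) ^ 2) ^ ε := by
            rw [mul_assoc]
            gcongr
            nlinarith
  · intro hlN
    have : 0 < (N : ℝ) - l := sub_pos.mpr (by exact_mod_cast hlN)
    refine (V_edge_le k N l t hk hl hlN).trans ?_
    gcongr ?_ * (_ * (_ ^ ?_ / _))
    · exact le_max_right _ _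
    · exact_mod_cast hN
    · linarith

theorem mainTheorem5 :
    (∀ (k N r : ℕ) (t : ℝ), 2 ≤ k → 1 ≤ N → 1 ≤ r →
      Summable (SecondMoment.V₁term k N (t * Complex.I) r) ∧
      Summable (SecondMoment.V₃term k N (t * Complex.I) r)) ∧
    ∀ ε : ℝ, 0 < ε → ∃ C : ℝ, 0 < C ∧
      ∀ (k N l : ℕ) (t T : ℝ), 2 ≤ k → 1 ≤ N → 1 ≤ l → T = 3 + |t| →
        ((N : ℝ) / (1 + T ^ 2) ≤ (l : ℝ) →
          ‖SecondMoment.V k N (t * Complex.I) l‖ ≤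
            C * (((l : ℝ) * k * T ^ 2) ^ ε * ((l : ℝ) ^ (1 / 2 : ℝ) * (k + T) / N))) ∧
        ((l : ℝ) < (N : ℝ) / (1 + T ^ 2) →
          ‖SecondMoment.V k N (t * Complex.I) l‖ ≤
            C * (((l : ℝ) * T ^ 2 / (4 * ((N : ℝ) - l))) ^ k *
              ((N : ℝ) ^ ε / ((l : ℝ) ^ (1 / 2 : ℝ) * T)))) := by
  refine ⟨mainTheorem5_general.1, fun ε hε => ?_⟩
  obtain ⟨C, hC, V_le⟩ := mainTheorem5_general.2 ε hε
  refine ⟨C, hC, fun k N l t T hk hN hl hT => ?_⟩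
  obtain ⟨large_le, small_le⟩ := V_le k N l t T hk hN hl hT
  refine ⟨fun _ => large_le, fun hlN => small_le (Nat.cast_lt.mp (hlN.trans_le ?_))⟩
  exact div_le_self N.cast_nonneg (by nlinarith)
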